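/- Let $\mathbb Z[x_1,\dots,x_d]$ denote the set of linear polynomials $f=a_1x_1+\dots+a_dx_d+c$ with integer $a_i,c$; put $\gcd(f)=\gcd(a_1,\dots,a_d,c)$ and $\|f\|=\max(|a_1|,\dots,|a_d|,|c|)$. The polynomial $f$ is primitive if $f\neq 0$ and $\gcd(f)=1$; the primitive part of $g\ne 0$ is the primitive $f$ with $g=\gcd(g)\cdot f$. A system of divisibility constraints is a finite conjunction $\Phi=\bigwedge_{i=1}^m f_i\mid g_i$ of constraints between linear polynomials with all $f_i\neq 0$; $\|\Phi\|$ is the maximum of the $\|f_i\|,\|g_i\|$. An integer solution is $\mathbf a\in\mathbb Z^d$ with $f_i(\mathbf a)\neq 0$ and $f_i(\mathbf a)$ dividing $g_i(\mathbf a)$ for all $i$; a solution modulo a prime $p$ is $\mathbf b\in\mathbb Z^d$ with $f_i(\mathbf b)\ne0$ and $v_p(f_i(\mathbf b))\le v_p(g_i(\mathbf b))$ for all $i$, where $v_p(0)=\infty$. For primitive $f$, the divisibility module $M_f(\Phi)$ is the smallest $\mathbb Z$-module of linear polynomials that contains $f$ and such that, whenever $g\mid h$ is a constraint of $\Phi$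 and $b\cdot g\in M_f(\Phi)$ with $b\in\mathbb Z$, also $b\cdot h\in M_f(\Phi)$. For an order $x_1\prec\dots\prec x_d$ of the variables, $\mathrm{lv}(f)$ is the largest variable with non-zero coefficient in $f$, or $x_0:=\bot$ (smaller than all variables) if $f$ is constant. $\Phi$ is increasing for the order if $M_f(\Phi)\cap\mathbb Z[x_1,\dots,x_k]=\mathbb Zf$ for all $1\le k\le d$ and all primitive $f$ with $\mathrm{lv}(f)=x_k$. $\Phi$ has the elimination property for the order if for the primitive part $f$ of each left-hand side of $\Phi$ and each $0\le k\le d$, the set $\{g:\mathrm{lv}(g)\preceq x_k\text{ and }f\mid g\text{ occurs in }\Phi\}$ is linearly independent and is a basis of $M_f(\Phi)\cap\mathbb Z[x_1,\dots,x_k]$. **Lemma.** There is a polynomial-time algorithm (integers encoded in binary) that, given a system $\Phi=\bigwedge_{i=1}^m f_i\mid g_i$ in $d$ variables and an order $\prec$ of these variables, computes a system $\Psi=\bigwedge_{i=1}^n f_i'\mid g_i'$ in the same variables that has the elimination property for $\prec$ and has the same solutions as $\Phi$, both over $\mathbb Z$ and modulo every prime. Moreover: 1. For every non-primitive $f$ and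 every $g$, the constraint $f\mid g$ occurs in $\Phi$ if and only if it occurs in $\Psi$; and for every constraint $f_i'\mid g_i'$ of $\Psi$ with $f_i'$ primitive there is a constraint $f_j\mid g_j$ of $\Phi$ such that $f_i'$ is the primitive part of $f_j$. 2. $M_f(\Phi)=M_f(\Psi)$ for every primitive $f$; in particular, for every order $\prec'$, $\Phi$ is increasing for $\prec'$ if and only if $\Psi$ is. 3. $\|\Psi\|\le (d+1)^{O(d)}\,(m+\|\Phi\|+2)^{O(m^3d)}$ and $n\le m(d+2)$. The implied constants are absolute, and an exponent $O(e)$ means at most $C\cdot\max(1,e)$. -/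

import Mathlib

namespace DivSys

/-! ### Linear polynomials and systems of divisibility constraints -/

/-- The linear polynomial `a₁ x₁ + ⋯ + a_d x_d + c` with integer coefficients, stored as the pair
`(a, c)` of its coefficient vector and its constant. -/
abbrev LinPoly (d : ℕ) : Type := (Fin d → ℤ) × ℤ

/-- The value of a linear polynomial at an integer point. -/
def evalAt {d : ℕ} (f : LinPoly d) (x : Fin d → ℤ) : ℤ := (∑ i, f.1 i * x i) + f.2

/-- The gcd of all the coefficients and the constant of a linear polynomial. -/
def content {d : ℕ} (f : LinPoly d) : ℕ := Int.gcd (Finset.univ.gcd f.1) f.2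

/-- A linear polynomial is primitive if it is non-zero and its gcd is `1`. -/
def IsPrimitive {d : ℕ} (f : LinPoly d) : Prop := f ≠ 0 ∧ content f = 1

/-- `f` is the primitive part of the (non-zero) polynomial `g`. -/
def IsPrimitivePart {d : ℕ} (f g : LinPoly d) : Prop :=
  IsPrimitive f ∧ g = (content g : ℤ) • f

/-- The infinity norm: the largest absolute value of a coefficient or of the constant. -/
def polyNorm {d : ℕ} (f : LinPoly d) : ℕ :=
  max (Finset.univ.sup fun i => (f.1 i).natAbs) f.2.natAbs

/-- A divisibility constraint `lhs ∣ rhs` between linear polynomials, with `lhs ≠ 0`. -/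
structure DivConstraint (d : ℕ) where
  lhs : LinPoly d
  rhs : LinPoly d
  lhs_ne_zero : lhs ≠ 0

/-- A system of divisibility constraints in `d` variables: a finite conjunction of constraints. -/
abbrev DivSystem (d : ℕ) : Type := List (DivConstraint d)

/-- The constraint `f ∣ g` occurs in the system. -/
def Occurs {d : ℕ} (Φ : DivSystem d) (f g : LinPoly d) : Prop :=
  ∃ c ∈ Φ, c.lhs = f ∧ c.rhs = g

/-- The infinity norm of a system: the maximum of the norms of its left- and right-hand sides. -/
def sysNorm {d : ℕ} (Φ : DivSystem d) : ℕ :=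
  (Φ.map fun c => max (polyNorm c.lhs) (polyNorm c.rhs)).foldr max 0

/-! ### Solutions -/

/-- Divisibility as it is interpreted in systems: there is a unique integer quotient. So `0`
divides nothing, and a non-zero integer divides its multiples. -/
def UDvd (a b : ℤ) : Prop := ∃! q : ℤ, b = q * a

/-- Integer solutions. -/
def IsSolution {d : ℕ} (Φ : DivSystem d) (x : Fin d → ℤ) : Prop :=
  ∀ c ∈ Φ, UDvd (evalAt c.lhs x) (evalAt c.rhs x)

/-- Solutions modulo a prime `p`: at an integer point, each left-hand side is non-zero and its
`p`-adic valuation is at most that of the right-hand side. For a prime `p`,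
`emultiplicity (p : ℤ) a` is the `p`-adic valuation of `a`, with value `⊤` at `a = 0`. -/
def IsSolutionMod {d : ℕ} (p : ℕ) (Φ : DivSystem d) (x : Fin d → ℤ) : Prop :=
  ∀ c ∈ Φ, evalAt c.lhs x ≠ 0 ∧
    emultiplicity (p : ℤ) (evalAt c.lhs x) ≤ emultiplicity (p : ℤ) (evalAt c.rhs x)

/-! ### Divisibility modules, leading variables, elimination property

An order on the variables is given by a permutation `ord` of `Fin d`: the variable in position `j`
(counted from `0`) is `ord j`, that is, `ord 0 ≺ ord 1 ≺ ⋯ ≺ ord (d - 1)`. -/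

/-- The divisibility module of `f`: the smallest `ℤ`-module `M` of linear polynomials that
contains `f` and such that `b • h ∈ M` whenever `g ∣ h` is a constraint and `b • g ∈ M`. -/
def divModule {d : ℕ} (Φ : DivSystem d) (f : LinPoly d) : Submodule ℤ (LinPoly d) :=
  sInf {M | f ∈ M ∧ ∀ c ∈ Φ, ∀ b : ℤ, b • c.lhs ∈ M → b • c.rhs ∈ M}

/-- The rank (`1, …, d`) of the leading variable of `f` in the order, and `0` (standing for `⊥`)
if `f` is constant. -/
def leadingRank {d : ℕ} (ord : Equiv.Perm (Fin d)) (f : LinPoly d) : ℕ :=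
  Finset.univ.sup fun j : Fin d => if f.1 (ord j) = 0 then 0 else (j : ℕ) + 1

/-- The linear polynomials that use only the first `k` variables of the order. -/
def firstVars {d : ℕ} (ord : Equiv.Perm (Fin d)) (k : ℕ) : Submodule ℤ (LinPoly d) where
  carrier := {f | ∀ j : Fin d, k ≤ (j : ℕ) → f.1 (ord j) = 0}
  add_mem' := by
    intro f g hf hg j hj
    simp [hf j hj, hg j hj]
  zero_mem' := by
    intro j _
    simp
  smul_mem' := by
    intro b f hf j hj
    simp [hf j hj]

/-- The elimination property for an order: for the primitive part `f` of every left-hand side and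
every `0 ≤ k ≤ d`, the polynomials `g` with leading variable at most the `k`-th one and such that
`f ∣ g` occurs in the system are linearly independent and form a basis of the part of the
divisibility module of `f` that uses only the first `k` variables. -/
def HasElimination {d : ℕ} (ord : Equiv.Perm (Fin d)) (Φ : DivSystem d) : Prop :=
  ∀ c ∈ Φ, ∀ f : LinPoly d, IsPrimitivePart f c.lhs → ∀ k ≤ d,
    LinearIndependent ℤ
      (Subtype.val : {g : LinPoly d | leadingRank ord g ≤ k ∧ Occurs Φ f g} → LinPoly d) ∧
    Submodule.span ℤ {g : LinPoly d | leadingRank ord g ≤ k ∧ Occurs Φ f g} =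
      divModule Φ f ⊓ firstVars ord k

/-- Increasing form with respect to an order. -/
def IsIncreasing {d : ℕ} (ord : Equiv.Perm (Fin d)) (Φ : DivSystem d) : Prop :=
  ∀ f : LinPoly d, IsPrimitive f → ∀ k, 1 ≤ k → k ≤ d → leadingRank ord f = k →
    divModule Φ f ⊓ firstVars ord k = Submodule.span ℤ {f}

/-! ### The machine model

Programs manipulate finite binary trees whose leaves are integers. Every elementary step is charged
the total bit length of the data it reads and writes (logarithmic cost), so that polynomial time for
these programs is the usual polynomial time of Turing machines. -/

/-- Data: binary trees with integer leaves. -/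
inductive Val : Type
  | int (z : ℤ) : Val
  | pair (a b : Val) : Val

/-- The size of a datum: its number of nodes, plus a sign bit and the binary length of every
integer leaf. -/
def Val.size : Val → ℕ
  | .int z => 2 + Nat.size z.natAbs
  | .pair a b => 1 + a.size + b.size

/-- Elementary operations. -/
inductive Op : Type
  | copy : Op
  | const (z : ℤ) : Op
  | fst : Op
  | snd : Op
  | isInt : Op
  | add : Op
  | sub : Op
  | mul : Op
  | div : Op
  | le : Op

/-- The result of an elementary operation (with value `0` on data of the wrong shape). Truth values
are the integers `1` and `0`, and `div` is integer division with remainder. -/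
def Op.eval : Op → Val → Val
  | .copy, x => x
  | .const z, _ => .int z
  | .fst, .pair a _ => a
  | .snd, .pair _ b => b
  | .isInt, .int _ => .int 1
  | .add, .pair (.int a) (.int b) => .int (a + b)
  | .sub, .pair (.int a) (.int b) => .int (a - b)
  | .mul, .pair (.int a) (.int b) => .int (a * b)
  | .div, .pair (.int a) (.int b) => .int (a / b)
  | .le, .pair (.int a) (.int b) => .int (if a ≤ b then 1 else 0)
  | _, _ => .int 0

/-- Programs: elementary operations, sequential composition (`seq P Q` runs `P`, then `Q` on its
result), pairing of the results of two programs run on the same input, branching, and unbounded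
iteration (`loop C P` applies `P` as long as the test `C` yields something other than `0`). -/
inductive Prog : Type
  | op (o : Op) : Prog
  | seq (P Q : Prog) : Prog
  | both (P Q : Prog) : Prog
  | ite (C P Q : Prog) : Prog
  | loop (C P : Prog) : Prog

/-- `Runs P x y t`: the program `P`, started on `x`, halts with result `y` at total cost `t`. -/
inductive Runs : Prog → Val → Val → ℕ → Prop
  | op (o : Op) (x : Val) : Runs (.op o) x (o.eval x) (1 + x.size + (o.eval x).size)
  | seq {P Q : Prog} {x y z : Val} {s t : ℕ} :
      Runs P x y s → Runs Q y z t → Runs (.seq P Q) x z (1 + s + t)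
  | both {P Q : Prog} {x y z : Val} {s t : ℕ} :
      Runs P x y s → Runs Q x z t → Runs (.both P Q) x (.pair y z) (1 + x.size + s + t)
  | ite_true {C P Q : Prog} {x v y : Val} {s t : ℕ} :
      Runs C x v s → v ≠ .int 0 → Runs P x y t → Runs (.ite C P Q) x y (1 + x.size + s + t)
  | ite_false {C P Q : Prog} {x y : Val} {s t : ℕ} :
      Runs C x (.int 0) s → Runs Q x y t → Runs (.ite C P Q) x y (1 + x.size + s + t)
  | loop_stop {C P : Prog} {x : Val} {s : ℕ} :
      Runs C x (.int 0) s → Runs (.loop C P) x x (1 + x.size + s)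
  | loop_step {C P : Prog} {x v y z : Val} {s t u : ℕ} :
      Runs C x v s → v ≠ .int 0 → Runs P x y t → Runs (.loop C P) y z u →
      Runs (.loop C P) x z (1 + x.size + s + t + u)

/-! ### Encodings (integers in binary, lists as right-nested pairs ending in the leaf `0`) -/

/-- The encoding of a list of data. -/
def encodeList : List Val → Val
  | [] => .int 0
  | x :: l => .pair x (encodeList l)

/-- The encoding of a linear polynomial: its list of coefficients, and its constant. -/
def encodePoly {d : ℕ} (f : LinPoly d) : Val :=
  .pair (encodeList (List.ofFn fun i => .int (f.1 i))) (.int f.2)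

/-- The encoding of a system: the list of its pairs of left- and right-hand sides. -/
def encodeSystem {d : ℕ} (Φ : DivSystem d) : Val :=
  encodeList (Φ.map fun c => .pair (encodePoly c.lhs) (encodePoly c.rhs))

/-- The encoding of an order: the list of the variables, in increasing order. -/
def encodeOrder {d : ℕ} (ord : Equiv.Perm (Fin d)) : Val :=
  encodeList (List.ofFn fun j => .int ((ord j : ℕ) : ℤ))

/-- The input of the algorithm: a system together with an order on its variables. -/
def encodeInput {d : ℕ} (Φ : DivSystem d) (ord : Equiv.Perm (Fin d)) : Val :=
  .pair (encodeSystem Φ) (encodeOrder ord)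

end DivSys

/-!
The system `Ψ` keeps the constraints of `Φ` whose left-hand side is not primitive, and for the
primitive part `f` of every left-hand side it has the constraints `f ∣ g` with `g` in a basis of the
divisibility module `M_f(Φ)`. If the basis is in echelon form for the columns
`x_d, …, x_1, constant` (largest variable of the order first), then its members in the first `k`
variables form a basis of `M_f(Φ) ∩ ℤ[x_1, …, x_k]`, which is the elimination property
(`linearIndepOn_pivotRows`, `span_pivotRows_inter`, `hasElimination_elimSystem`). Every constraint
`f ∣ g` with `g ∈ M_f(Φ)` follows from `Φ`, and a constraint of `Φ` whose left-hand side `f` is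
primitive has its right-hand side in `M_f(Φ)`. So solutions and divisibility modules do not change
(`forall_elimSystem_iff`, `divModule_elimSystem`).

The module `M_f(Φ)` is the limit of an ascending chain of lattices that starts with `ℤ f`. For a
constraint `g ∣ h` and the present lattice `L`, the integers `b` with `b • g ∈ L` form an ideal; if
its generator `b` has `b • h ∉ L`, then `b • h` is added to `L` (`closeStep`), and if no constraint
gives anything new, then `L = M_f(Φ)` (`CloseInv.rowSpan_eq`). The lattice is stored by an echelon
basis. Inserting a row by unimodular row operations also yields the generator `b`
(`insertStep_spec`, `smul_mem_rowSpan_iff`).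

Two estimates make this polynomial and give the norm bound.

* All lattices of the chain are generated by `f` and multiples `v_i • h_i` of the right-hand sides,
  where the non-zero `v_i` divide `∏ β_j` for numbers `β_j` bounded by `(m + ‖Φ‖ + 2) ^ (2 (d + 1))`
  (`IsTame`, `IsTame.sup`). When `v_i` becomes non-zero, Cramer's rule for the lattice of `f` and the
  right-hand sides already in use gives a small `Δ` with `Δ • g_i` in that lattice
  (`exists_small_multiple`). The product of the `β_j` maps that lattice into the present one, so the
  product gains only the factor `Δ`; and a later change of `v_i` replaces it by a divisor.
* A reduced echelon basis is bounded in terms of arbitrary generators of the lattice, again by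
  Cramer's rule (`polyNorm_le_of_isReduced`). So the rows stay below `rowBound Φ`, whose exponent is
  `O(m³ d)`, and the pivots have polynomial bit length. As a pivot that changes is replaced by a
  proper divisor, the chain has polynomially many steps (`potential_anti`).

Programs are not written out. `PolyTime e f` says that a single program turns the datum `e c` into
`f c` for all `c` in an index type, in polynomial time. It is closed under composition, pairing,
branching, recursion along lists (`PolyTime.mapAcc`) and loops with an invariant that bounds the
states and a measure that bounds the number of rounds (`PolyTime.exists_while`). The extended
Euclidean algorithm and the closure of a lattice are such loops (`exists_xgcd`,
`PolyTime.exists_closure`), everything else is recursion along lists.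
-/

namespace DivSys

/-! ### Polynomial bounds and polynomial-time computable families -/

theorem Val.two_le_size (v : Val) : 2 ≤ v.size := by
  induction v with
  | int z => simp [Val.size]
  | pair a b ha hb => simp only [Val.size]; omega

theorem Runs.size_le {P : Prog} {x y : Val} {t : ℕ} (h : Runs P x y t) : y.size ≤ t := by
  induction h <;> (try simp only [Val.size] at *) <;> omega

/-- The numbers `n c` are bounded by a fixed power of the size of the datum `e c`. As sizes are at
least `2`, this is the same as a polynomial bound. -/
def PolyBounded {γ : Type} (e : γ → Val) (n : γ → ℕ) : Prop :=
  ∃ k, ∀ c, n c ≤ (e c).size ^ k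

/-- One program turns the datum `e c` into the datum `f c`, for every index `c`, in time bounded by
a fixed power of the size of `e c`. The index type serves to restrict the inputs and to let the
data depend on objects of varying type. -/
def PolyTime {γ : Type} (e f : γ → Val) : Prop :=
  ∃ (P : Prog) (k : ℕ), ∀ c, ∃ t, Runs P (e c) (f c) t ∧ t ≤ (e c).size ^ k

section Bounds

variable {γ δ : Type} {e f : γ → Val} {m n : γ → ℕ}

theorem PolyBounded.mono (h : PolyBounded e n) (hm : ∀ c, m c ≤ n c) : PolyBounded e m := by
  obtain ⟨k, hk⟩ := h
  exact ⟨k, fun c => (hm c).trans (hk c)⟩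

theorem PolyBounded.const (e : γ → Val) (a : ℕ) : PolyBounded e fun _ => a :=
  ⟨a, fun c => (Nat.lt_two_pow_self (n := a)).le.trans
    (Nat.pow_le_pow_left (e c).two_le_size a)⟩

theorem PolyBounded.self (e : γ → Val) : PolyBounded e fun c => (e c).size :=
  ⟨1, fun c => by simp⟩

theorem PolyBounded.mul (hm : PolyBounded e m) (hn : PolyBounded e n) :
    PolyBounded e fun c => m c * n c := by
  obtain ⟨k, hk⟩ := hm
  obtain ⟨l, hl⟩ := hn
  exact ⟨k + l, fun c => by rw [pow_add]; exact Nat.mul_le_mul (hk c) (hl c)⟩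

theorem PolyBounded.add (hm : PolyBounded e m) (hn : PolyBounded e n) :
    PolyBounded e fun c => m c + n c := by
  obtain ⟨k, hk⟩ := hm
  obtain ⟨l, hl⟩ := hn
  refine ⟨max k l + 1, fun c => ?_⟩
  have h2 := (e c).two_le_size
  have h1 : 1 ≤ (e c).size := by omega
  have a1 : (e c).size ^ k ≤ (e c).size ^ max k l := Nat.pow_le_pow_right h1 (le_max_left _ _)
  have a2 : (e c).size ^ l ≤ (e c).size ^ max k l := Nat.pow_le_pow_right h1 (le_max_right _ _)
  have a3 : (e c).size ^ max k l * 2 ≤ (e c).size ^ (max k l + 1) := by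
    rw [pow_succ]; exact Nat.mul_le_mul_left _ h2
  exact (add_le_add (hk c) (hl c)).trans (by omega)

theorem PolyBounded.const_mul (a : ℕ) (hn : PolyBounded e n) : PolyBounded e fun c => a * n c :=
  (PolyBounded.const e a).mul hn

theorem PolyBounded.pow (hm : PolyBounded e m) (a : ℕ) : PolyBounded e fun c => m c ^ a := by
  obtain ⟨k, hk⟩ := hm
  exact ⟨k * a, fun c => by rw [pow_mul]; exact Nat.pow_le_pow_left (hk c) a⟩

theorem PolyBounded.trans (h : PolyBounded e fun c => (f c).size) (hn : PolyBounded f n) :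
    PolyBounded e n := by
  obtain ⟨k, hk⟩ := hn
  exact (h.pow k).mono hk

theorem PolyTime.size (h : PolyTime e f) : PolyBounded e fun c => (f c).size := by
  obtain ⟨P, k, hk⟩ := h
  refine ⟨k, fun c => ?_⟩
  obtain ⟨t, ht, hle⟩ := hk c
  exact ht.size_le.trans hle

theorem PolyTime.bounded (h : PolyTime e f) (hn : PolyBounded f n) : PolyBounded e n :=
  h.size.trans hn

theorem PolyTime.of_bounded (P : Prog) (t : γ → ℕ) (hr : ∀ c, Runs P (e c) (f c) (t c))
    (ht : PolyBounded e t) : PolyTime e f := by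
  obtain ⟨k, hk⟩ := ht
  exact ⟨P, k, fun c => ⟨t c, hr c, hk c⟩⟩

end Bounds

section Basic

variable {γ δ : Type} {e f g : γ → Val}

theorem PolyTime.reindex (h : PolyTime e f) (r : δ → γ) :
    PolyTime (fun x => e (r x)) fun x => f (r x) := by
  obtain ⟨P, k, hk⟩ := h
  exact ⟨P, k, fun c => hk _⟩

theorem PolyTime.comp (h : PolyTime e f) (h' : PolyTime f g) : PolyTime e g := by
  have hb := h.size
  obtain ⟨P, k, hP⟩ := h
  obtain ⟨Q, l, hQ⟩ := h'
  choose s hs hsk using hP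
  choose t ht htl using hQ
  refine .of_bounded (.seq P Q) (fun c => 1 + s c + t c) (fun c => .seq (hs c) (ht c)) ?_
  exact ((PolyBounded.const e 1).add ⟨k, hsk⟩).add (hb.trans ⟨l, htl⟩)

theorem PolyTime.op (o : Op) (h : PolyBounded e fun c => (o.eval (e c)).size) :
    PolyTime e fun c => o.eval (e c) :=
  .of_bounded (.op o) _ (fun c => .op o (e c))
    (((PolyBounded.const e 1).add (.self e)).add h)

theorem PolyTime.id (e : γ → Val) : PolyTime e e :=
  .op .copy (.self e)

theorem PolyTime.const (e : γ → Val) (z : ℤ) : PolyTime e fun _ => .int z :=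
  .op (.const z) (.const e _)

theorem PolyTime.pair (h : PolyTime e f) (h' : PolyTime e g) :
    PolyTime e fun c => .pair (f c) (g c) := by
  obtain ⟨P, k, hP⟩ := h
  obtain ⟨Q, l, hQ⟩ := h'
  choose s hs hsk using hP
  choose t ht htl using hQ
  exact .of_bounded (.both P Q) (fun c => 1 + (e c).size + s c + t c)
    (fun c => .both (hs c) (ht c))
    ((((PolyBounded.const e 1).add (.self e)).add ⟨k, hsk⟩).add ⟨l, htl⟩)

theorem PolyTime.fst (h : PolyTime e fun c => .pair (f c) (g c)) : PolyTime e f := by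
  refine h.comp (.op (e := fun c => .pair (f c) (g c)) .fst ?_)
  exact (PolyBounded.self _).mono fun c => by simp only [Op.eval, Val.size]; omega

theorem PolyTime.snd (h : PolyTime e fun c => .pair (f c) (g c)) : PolyTime e g := by
  refine h.comp (.op (e := fun c => .pair (f c) (g c)) .snd ?_)
  exact (PolyBounded.self _).mono fun c => by simp only [Op.eval, Val.size]; omega

/-- A datum that can be computed in an environment can be computed in a larger one. -/
theorem PolyTime.weaken (h : PolyTime e f) (r : δ → γ) (w : δ → Val) :
    PolyTime (fun x => .pair (e (r x)) (w x)) fun x => f (r x) :=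
  (PolyTime.id (fun x => Val.pair (e (r x)) (w x))).fst.comp (h.reindex r)

theorem PolyTime.congr (h : PolyTime e f) (hfg : ∀ c, f c = g c) : PolyTime e g :=
  (funext hfg : f = g) ▸ h

end Basic

section Arithmetic

variable {γ : Type} {e : γ → Val} {a b : γ → ℤ}

theorem Val.size_int_le {z w : ℤ} (h : z.natAbs ≤ w.natAbs) :
    (Val.int z).size ≤ (Val.int w).size := by
  simpa [Val.size] using Nat.size_le_size h

theorem size_mul_le (m n : ℕ) : Nat.size (m * n) ≤ Nat.size m + Nat.size n := by
  rw [Nat.size_le, pow_add]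
  rcases Nat.eq_zero_or_pos n with rfl | hn
  · simp
  · exact Nat.mul_lt_mul'' (Nat.lt_size_self m) (Nat.lt_size_self n)

theorem size_add_le (m n : ℕ) : Nat.size (m + n) ≤ max (Nat.size m) (Nat.size n) + 1 := by
  rw [Nat.size_le, pow_succ]
  have h1 := (Nat.lt_size_self m).trans_le
    (Nat.pow_le_pow_right two_pos (le_max_left (Nat.size m) (Nat.size n)))
  have h2 := (Nat.lt_size_self n).trans_le
    (Nat.pow_le_pow_right two_pos (le_max_right (Nat.size m) (Nat.size n)))
  omega

theorem PolyTime.add (ha : PolyTime e fun c => .int (a c)) (hb : PolyTime e fun c => .int (b c)) :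
    PolyTime e fun c => .int (a c + b c) := by
  refine (ha.pair hb).comp (.op (e := fun c => .pair (.int (a c)) (.int (b c))) .add ?_)
  refine ((PolyBounded.self _).add (.self _)).mono fun c => ?_
  have h1 := Nat.size_le_size (Int.natAbs_add_le (a c) (b c))
  have h2 := size_add_le (a c).natAbs (b c).natAbs
  simp only [Op.eval, Val.size]
  omega

theorem PolyTime.sub (ha : PolyTime e fun c => .int (a c)) (hb : PolyTime e fun c => .int (b c)) :
    PolyTime e fun c => .int (a c - b c) := by
  refine (ha.pair hb).comp (.op (e := fun c => .pair (.int (a c)) (.int (b c))) .sub ?_)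
  refine ((PolyBounded.self _).add (.self _)).mono fun c => ?_
  have h1 := Nat.size_le_size (Int.natAbs_sub_le (a c) (b c))
  have h2 := size_add_le (a c).natAbs (b c).natAbs
  simp only [Op.eval, Val.size]
  omega

theorem PolyTime.mul (ha : PolyTime e fun c => .int (a c)) (hb : PolyTime e fun c => .int (b c)) :
    PolyTime e fun c => .int (a c * b c) := by
  refine (ha.pair hb).comp (.op (e := fun c => .pair (.int (a c)) (.int (b c))) .mul ?_)
  refine ((PolyBounded.self _).add (.self _)).mono fun c => ?_
  have h2 := size_mul_le (a c).natAbs (b c).natAbs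
  simp only [Op.eval, Val.size, Int.natAbs_mul]
  omega

theorem natAbs_ediv_le (x y : ℤ) : (x / y).natAbs ≤ x.natAbs := by
  have := Int.abs_ediv_le_abs x y
  rw [Int.abs_eq_natAbs, Int.abs_eq_natAbs] at this
  exact_mod_cast this

theorem PolyTime.div (ha : PolyTime e fun c => .int (a c)) (hb : PolyTime e fun c => .int (b c)) :
    PolyTime e fun c => .int (a c / b c) := by
  refine (ha.pair hb).comp (.op (e := fun c => .pair (.int (a c)) (.int (b c))) .div ?_)
  refine (PolyBounded.self _).mono fun c => ?_
  have h1 := Nat.size_le_size (natAbs_ediv_le (a c) (b c))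
  simp only [Op.eval, Val.size]
  omega

theorem PolyTime.mod (ha : PolyTime e fun c => .int (a c)) (hb : PolyTime e fun c => .int (b c)) :
    PolyTime e fun c => .int (a c % b c) :=
  (ha.sub (hb.mul (ha.div hb))).congr fun c => by rw [Int.emod_def]

theorem PolyTime.neg (ha : PolyTime e fun c => .int (a c)) : PolyTime e fun c => .int (-a c) :=
  ((PolyTime.const e 0).sub ha).congr fun c => by rw [zero_sub]

end Arithmetic

section Tests

variable {γ δ : Type} {e f g : γ → Val} {a b : γ → ℤ} {p : γ → Prop}

/-- An integer that is non-zero exactly if `p c` holds is computable in polynomial time from `e c`. -/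
def PolyTimeTest (e : γ → Val) (p : γ → Prop) : Prop :=
  ∃ t : γ → ℤ, (∀ c, t c ≠ 0 ↔ p c) ∧ PolyTime e fun c => .int (t c)

theorem PolyTimeTest.reindex (h : PolyTimeTest e p) (r : δ → γ) :
    PolyTimeTest (fun x => e (r x)) fun x => p (r x) := by
  obtain ⟨t, h1, h2⟩ := h
  exact ⟨fun x => t (r x), fun x => h1 _, h2.reindex r⟩

theorem PolyTimeTest.le (ha : PolyTime e fun c => .int (a c))
    (hb : PolyTime e fun c => .int (b c)) : PolyTimeTest e fun c => a c ≤ b c := by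
  refine ⟨fun c => if a c ≤ b c then 1 else 0, fun c => by simp, ?_⟩
  refine (ha.pair hb).comp (.op (e := fun c => .pair (.int (a c)) (.int (b c))) .le ?_)
  refine (PolyBounded.const _ 3).mono fun c => ?_
  simp only [Op.eval, Val.size]
  split_ifs <;> simp

/-- Branching; each branch need only be right where it is taken. -/
theorem PolyTime.ite' (hp : PolyTimeTest e p)
    (hf : PolyTime (fun c : {c // p c} => e c) fun c => f c)
    (hg : PolyTime (fun c : {c // ¬ p c} => e c) fun c => g c) [∀ c, Decidable (p c)] :
    PolyTime e fun c => if p c then f c else g c := by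
  obtain ⟨t, h1, C, k, hC⟩ := hp
  obtain ⟨P, l, hP⟩ := hf
  obtain ⟨Q, m, hQ⟩ := hg
  obtain ⟨n, hn⟩ := (((PolyBounded.const e 1).add (.self e)).add
    ((PolyBounded.self e).pow k)).add (((PolyBounded.self e).pow l).add ((PolyBounded.self e).pow m))
  refine ⟨.ite C P Q, n, fun c => ?_⟩
  obtain ⟨s, hs, hsk⟩ := hC c
  have hn := hn c
  beta_reduce at hn hs ⊢
  by_cases hc : p c
  · obtain ⟨u, hu, hul⟩ := hP ⟨c, hc⟩
    replace hul : u ≤ (e c).size ^ l := hul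
    rw [if_pos hc]
    exact ⟨_, .ite_true hs (by simpa using (h1 c).2 hc) hu, by omega⟩
  · obtain ⟨u, hu, hul⟩ := hQ ⟨c, hc⟩
    replace hul : u ≤ (e c).size ^ m := hul
    have h0 : t c = 0 := by
      by_contra h
      exact hc ((h1 c).1 h)
    rw [h0] at hs
    rw [if_neg hc]
    exact ⟨_, .ite_false hs hu, by omega⟩

theorem PolyTime.ite (hp : PolyTimeTest e p) (hf : PolyTime e f) (hg : PolyTime e g)
    [∀ c, Decidable (p c)] : PolyTime e fun c => if p c then f c else g c :=
  .ite' hp (hf.reindex Subtype.val) (hg.reindex Subtype.val)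

open Classical in
theorem PolyTimeTest.not (hp : PolyTimeTest e p) : PolyTimeTest e fun c => ¬ p c :=
  ⟨fun c => if p c then 0 else 1, fun c => by simp,
    (PolyTime.ite hp (.const e 0) (.const e 1)).congr fun c => by
      beta_reduce; split_ifs <;> rfl⟩

open Classical in
theorem PolyTimeTest.and {q : γ → Prop} (hp : PolyTimeTest e p) (hq : PolyTimeTest e q) :
    PolyTimeTest e fun c => p c ∧ q c := by
  obtain ⟨t, h1, h2⟩ := hq
  refine ⟨fun c => if p c then t c else 0, fun c => ?_,
    (PolyTime.ite hp h2 (.const e 0)).congr fun c => by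
      beta_reduce; split_ifs <;> rfl⟩
  beta_reduce
  rw [← h1 c]
  by_cases h : p c <;> simp [h]

theorem PolyTimeTest.eq (ha : PolyTime e fun c => .int (a c))
    (hb : PolyTime e fun c => .int (b c)) : PolyTimeTest e fun c => a c = b c := by
  have h := (PolyTimeTest.le ha hb).and (.le hb ha)
  simpa only [← le_antisymm_iff] using h

/-- Testing whether a datum is an integer leaf. -/
theorem PolyTimeTest.isInt (hf : PolyTime e f) : PolyTimeTest e fun c => ∃ z, f c = .int z := by
  have key : ∀ v : Val, (∃ z, v = .int z) ∧ Op.eval .isInt v = .int 1 ∨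
      ¬ (∃ z, v = .int z) ∧ Op.eval .isInt v = .int 0 := by
    intro v
    cases v <;> simp [Op.eval]
  classical
  refine ⟨fun c => if ∃ z, f c = .int z then 1 else 0, fun c => by simp, ?_⟩
  refine hf.comp ((PolyTime.op (e := f) .isInt ?_).congr fun c => ?_)
  · refine (PolyBounded.const _ 3).mono fun c => ?_
    rcases key (f c) with ⟨_, h⟩ | ⟨_, h⟩ <;> rw [h] <;> simp [Val.size]
  · rcases key (f c) with ⟨h1, h⟩ | ⟨h1, h⟩ <;> rw [h] <;> simp [h1]

end Tests

/-! ### Loops -/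

section Loop

variable {γ : Type}

/-- Iteration along a sequence of states `s c 0, …, s c (N c)`. Both the number of rounds and the
sizes of all states have to be bounded polynomially. -/
theorem PolyTime.loop {s : γ → ℕ → Val} {N : γ → ℕ}
    (hC : PolyTimeTest (fun p : {p : γ × ℕ // p.2 ≤ N p.1} => s p.1.1 p.1.2)
      fun p => p.1.2 < N p.1.1)
    (hP : PolyTime (fun p : {p : γ × ℕ // p.2 < N p.1} => s p.1.1 p.1.2)
      fun p => s p.1.1 (p.1.2 + 1))
    (hN : PolyBounded (fun c => s c 0) N)
    (hs : ∃ k, ∀ c, ∀ i ≤ N c, (s c i).size ≤ (s c 0).size ^ k) :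
    PolyTime (fun c => s c 0) fun c => s c (N c) := by
  obtain ⟨t, h1, C, k, hC⟩ := hC
  obtain ⟨P, l, hP⟩ := hP
  obtain ⟨m, hs⟩ := hs
  have hB : PolyBounded (fun c => s c 0) fun c =>
      (N c + 1) * (1 + (s c 0).size ^ m + ((s c 0).size ^ m) ^ k + ((s c 0).size ^ m) ^ l) := by
    have h := (PolyBounded.self fun c => s c 0).pow m
    exact (hN.add (.const _ 1)).mul ((((PolyBounded.const _ 1).add h).add (h.pow k)).add (h.pow l))
  have key : ∀ c, ∀ j i, i + j = N c → ∃ u, Runs (.loop C P) (s c i) (s c (N c)) u ∧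
      u ≤ (j + 1) * (1 + (s c 0).size ^ m + ((s c 0).size ^ m) ^ k + ((s c 0).size ^ m) ^ l) := by
    intro c j
    induction j with
    | zero =>
      intro i hi
      obtain rfl : i = N c := by omega
      obtain ⟨u, hu, hle⟩ := hC ⟨(c, N c), le_rfl⟩
      have h0 : t ⟨(c, N c), le_rfl⟩ = 0 := by
        by_contra h
        exact absurd ((h1 _).1 h) (lt_irrefl _)
      beta_reduce at hu
      rw [h0] at hu
      refine ⟨_, Runs.loop_stop hu, ?_⟩
      have h2 := hs c (N c) le_rfl
      have h3 : u ≤ ((s c 0).size ^ m) ^ k := hle.trans (Nat.pow_le_pow_left h2 k)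
      omega
    | succ j ih =>
      intro i hi
      have hlt : i < N c := by omega
      obtain ⟨u, hu, hle⟩ := hC ⟨(c, i), hlt.le⟩
      obtain ⟨v, hv, hvle⟩ := hP ⟨(c, i), hlt⟩
      obtain ⟨w, hw, hwle⟩ := ih (i + 1) (by omega)
      have h0 : t ⟨(c, i), hlt.le⟩ ≠ 0 := (h1 _).2 hlt
      refine ⟨_, .loop_step hu (by simpa using h0) hv hw, ?_⟩
      have h2 := hs c i hlt.le
      have h3 : u ≤ ((s c 0).size ^ m) ^ k := hle.trans (Nat.pow_le_pow_left h2 k)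
      have h4 : v ≤ ((s c 0).size ^ m) ^ l := hvle.trans (Nat.pow_le_pow_left h2 l)
      rw [Nat.succ_mul]
      omega
  obtain ⟨n, hn⟩ := hB
  refine ⟨.loop C P, n, fun c => ?_⟩
  obtain ⟨u, hu, hle⟩ := key c (N c) 0 (by omega)
  exact ⟨u, hu, hle.trans (hn c)⟩

/-- Iteration as long as a test holds. It is justified by an invariant `R` that bounds the sizes of
the states and a measure `μ` that decreases in each round; what is known about the result is that
the invariant holds and the test fails. -/
theorem PolyTime.exists_while {e : γ → Val} {S : γ → Type} (eS : ∀ c, S c → Val)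
    (R : ∀ c, S c → Prop) (test : ∀ c, S c → Prop) (step : ∀ c, S c → S c) (μ : ∀ c, S c → ℕ)
    (init : ∀ c, S c) (hinit : PolyTime e fun c => eS c (init c)) (hR : ∀ c, R c (init c))
    (hstep : ∀ c s, R c s → test c s → R c (step c s) ∧ μ c (step c s) < μ c s)
    (hμ : PolyBounded e fun c => μ c (init c))
    (hsize : ∃ k, ∀ c s, R c s → (eS c s).size ≤ (e c).size ^ k)
    (hC : PolyTimeTest (fun p : Σ c, {s : S c // R c s} => .pair (e p.1) (eS p.1 p.2))
      fun p => test p.1 p.2)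
    (hP : PolyTime (fun p : Σ c, {s : S c // R c s} => .pair (e p.1) (eS p.1 p.2))
      fun p => eS p.1 (step p.1 p.2)) :
    ∃ r : ∀ c, S c, (∀ c, R c (r c) ∧ ¬ test c (r c)) ∧ PolyTime e fun c => eS c (r c) := by
  classical
  have hhalt : ∀ c, ∃ n, ¬ test c ((step c)^[n] (init c)) := by
    intro c
    by_contra! h
    have hRi : ∀ n, R c ((step c)^[n] (init c)) ∧
        μ c ((step c)^[n] (init c)) + n ≤ μ c (init c) := by
      intro n
      induction n with
      | zero => exact ⟨hR c, le_rfl⟩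
      | succ n ih =>
        rw [Function.iterate_succ_apply']
        obtain ⟨h1, h2⟩ := hstep c _ ih.1 (h n)
        exact ⟨h1, by omega⟩
    have := (hRi (μ c (init c) + 1)).2
    omega
  -- the number of rounds
  let N : γ → ℕ := fun c => Nat.find (hhalt c)
  have hlt : ∀ c n, n < N c → test c ((step c)^[n] (init c)) := fun c n hn => by
    have := Nat.find_min (hhalt c) hn
    push Not at this
    exact this
  have hN : ∀ c, ¬ test c ((step c)^[N c] (init c)) := fun c => Nat.find_spec (hhalt c)
  have hinv : ∀ c, ∀ n ≤ N c, R c ((step c)^[n] (init c)) ∧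
      μ c ((step c)^[n] (init c)) + n ≤ μ c (init c) := by
    intro c n
    induction n with
    | zero => exact fun _ => ⟨hR c, le_rfl⟩
    | succ n ih =>
      intro hn
      have ih := ih (by omega)
      rw [Function.iterate_succ_apply']
      obtain ⟨h1, h2⟩ := hstep c _ ih.1 (hlt c n hn)
      exact ⟨h1, by omega⟩
  refine ⟨fun c => (step c)^[N c] (init c), fun c => ⟨(hinv c _ le_rfl).1, hN c⟩, ?_⟩
  have h0 : PolyTime e fun c => Val.pair (e c) (eS c (init c)) := (PolyTime.id e).pair hinit
  have hloop : PolyTime (fun c => Val.pair (e c) (eS c ((step c)^[0] (init c))))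
      fun c => Val.pair (e c) (eS c ((step c)^[N c] (init c))) := by
    refine PolyTime.loop (s := fun c n => Val.pair (e c) (eS c ((step c)^[n] (init c)))) (N := N)
      ?_ ?_ ?_ ?_
    · obtain ⟨t, h1, h2⟩ := hC.reindex (fun p : {p : γ × ℕ // p.2 ≤ N p.1} =>
        (⟨p.1.1, (step p.1.1)^[p.1.2] (init p.1.1), (hinv _ _ p.2).1⟩ : Σ c, {s : S c // R c s}))
      refine ⟨t, fun p => (h1 p).trans ⟨fun h => ?_, fun h => hlt _ _ h⟩, h2⟩
      refine lt_of_le_of_ne p.2 fun hp => ?_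
      have h' : test p.1.1 ((step p.1.1)^[p.1.2] (init p.1.1)) := h
      rw [hp] at h'
      exact hN _ h'
    · have h := hP.reindex (fun p : {p : γ × ℕ // p.2 < N p.1} =>
        (⟨p.1.1, (step p.1.1)^[p.1.2] (init p.1.1), (hinv _ _ p.2.le).1⟩ :
          Σ c, {s : S c // R c s}))
      refine (((PolyTime.id (fun p : {p : γ × ℕ // p.2 < N p.1} => Val.pair (e p.1.1)
        (eS p.1.1 ((step p.1.1)^[p.1.2] (init p.1.1))))).fst).pair h).congr fun p => ?_
      rw [Function.iterate_succ_apply']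
    · refine ((PolyTime.id _).fst.bounded hμ).mono fun c => ?_
      have := (hinv c _ le_rfl).2
      omega
    · obtain ⟨k, hk⟩ := hsize
      obtain ⟨l, hl⟩ := ((PolyTime.id (fun c => Val.pair (e c)
        (eS c ((step c)^[0] (init c))))).fst.bounded
          (((PolyBounded.const _ 1).add (.self e)).add ((PolyBounded.self e).pow k)))
      refine ⟨l, fun c i hi => le_trans ?_ (hl c)⟩
      have := hk c _ (hinv c i hi).1
      simp only [Val.size]
      omega
  exact (h0.comp hloop).snd

end Loop

/-! ### Recursion along lists -/

/-- Run through a list with a running state, and emit one output per entry. -/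
def mapAcc {S A O : Type} (f : S → A → S × O) : S → List A → S × List O
  | s, [] => (s, [])
  | s, a :: l => ((mapAcc f (f s a).1 l).1, (f s a).2 :: (mapAcc f (f s a).1 l).2)

theorem mapAcc_append {S A O : Type} (f : S → A → S × O) (s : S) (l l' : List A) :
    mapAcc f s (l ++ l') = ((mapAcc f (mapAcc f s l).1 l').1,
      (mapAcc f s l).2 ++ (mapAcc f (mapAcc f s l).1 l').2) := by
  induction l generalizing s with
  | nil => rfl
  | cons a l ih => simp [mapAcc, ih]

theorem mapAcc_take_succ {S A O : Type} (f : S → A → S × O) (s : S) (l : List A) {i : ℕ}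
    (hi : i < l.length) :
    mapAcc f s (l.take (i + 1)) = ((f (mapAcc f s (l.take i)).1 l[i]).1,
      (mapAcc f s (l.take i)).2 ++ [(f (mapAcc f s (l.take i)).1 l[i]).2]) := by
  rw [List.take_succ_eq_append_getElem hi, mapAcc_append]
  rfl

theorem mapAcc_map {S A O : Type} (f : A → O) (s : S) (l : List A) :
    mapAcc (fun s a => (s, f a)) s l = (s, l.map f) := by
  induction l with
  | nil => rfl
  | cons a l ih => simp [mapAcc, ih]

theorem mapAcc_foldl {S A O : Type} (f : S → A → S) (o : O) (s : S) (l : List A) :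
    (mapAcc (fun s a => (f s a, o)) s l).1 = l.foldl f s := by
  induction l generalizing s with
  | nil => rfl
  | cons a l ih => simp [mapAcc, ih]

theorem size_encodeList (l : List Val) :
    (encodeList l).size = 2 + (l.map fun v => 1 + v.size).sum := by
  induction l with
  | nil => rfl
  | cons v l ih => simp only [encodeList, Val.size, ih, List.map_cons, List.sum_cons]; omega

theorem size_encodeList_le {l : List Val} {B : ℕ} (h : ∀ v ∈ l, v.size ≤ B) :
    (encodeList l).size ≤ 2 + l.length * (1 + B) := by
  rw [size_encodeList]
  refine Nat.add_le_add_left ?_ 2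
  refine (List.sum_le_card_nsmul _ (1 + B) ?_).trans (by simp)
  intro x hx
  obtain ⟨v, hv, rfl⟩ := List.mem_map.1 hx
  have := h v hv
  omega

theorem length_le_size_encodeList (l : List Val) : l.length ≤ (encodeList l).size := by
  induction l with
  | nil => simp
  | cons v l ih => simp only [encodeList, Val.size, List.length_cons]; omega

theorem size_le_size_encodeList {l : List Val} {v : Val} (h : v ∈ l) :
    v.size ≤ (encodeList l).size := by
  induction l with
  | nil => simp at h
  | cons w l ih =>
    simp only [encodeList, Val.size]
    rcases List.mem_cons.1 h with rfl | h
    · omega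
    · have := ih h
      omega

theorem size_encodeList_drop_le (l : List Val) (n : ℕ) :
    (encodeList (l.drop n)).size ≤ (encodeList l).size := by
  induction l generalizing n with
  | nil => simp
  | cons w l ih =>
    cases n with
    | zero => simp
    | succ n =>
      have := ih n
      simp only [encodeList, Val.size, List.drop_succ_cons]
      omega

section Lists

variable {γ : Type} {e : γ → Val} {S A O : γ → Type}

/-- Recursion along a list with a running state. The program pushes the outputs on a stack, so that
they come out in reverse order. Only the sizes of the states have to be bounded. -/
theorem PolyTime.mapAcc_reverse (eS : ∀ c, S c → Val) (eA : ∀ c, A c → Val) (eO : ∀ c, O c → Val)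
    (f : ∀ c, S c → A c → S c × O c) {s : ∀ c, S c} {l : ∀ c, List (A c)}
    (hs : PolyTime e fun c => eS c (s c))
    (hl : PolyTime e fun c => encodeList ((l c).map (eA c)))
    (hf : PolyTime (fun p : Σ c, S c × A c => .pair (e p.1) (.pair (eS p.1 p.2.1) (eA p.1 p.2.2)))
      fun p => .pair (eS p.1 (f p.1 p.2.1 p.2.2).1) (eO p.1 (f p.1 p.2.1 p.2.2).2))
    (hb : ∃ k, ∀ c, ∀ l', l' <+: l c → (eS c (mapAcc (f c) (s c) l').1).size ≤ (e c).size ^ k) :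
    PolyTime e fun c => .pair (eS c (mapAcc (f c) (s c) (l c)).1)
      (encodeList ((mapAcc (f c) (s c) (l c)).2.reverse.map (eO c))) := by
  -- the datum after `i` rounds: the input, the running state, the stack of outputs, and the rest of
  -- the list
  let st : γ → ℕ → Val := fun c i => .pair (e c) (.pair
    (.pair (eS c (mapAcc (f c) (s c) ((l c).take i)).1)
      (encodeList ((mapAcc (f c) (s c) ((l c).take i)).2.reverse.map (eO c))))
    (encodeList (((l c).drop i).map (eA c))))
  have h0 : PolyTime e fun c => st c 0 := by
    refine (PolyTime.id e).pair ((hs.pair (.const e 0)).pair hl)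
  have hsub : ∃ k, ∀ c, ∀ i ≤ (l c).length, (st c i).size ≤ (e c).size ^ k := by
    obtain ⟨k, hk⟩ := hb
    obtain ⟨m, hm⟩ := hl.size
    obtain ⟨n, hn⟩ := hf.size
    have hE := PolyBounded.self e
    obtain ⟨r, hr⟩ := ((((PolyBounded.const e 5).add hE).add (hE.pow k)).add (hE.pow m)).add
      ((hE.pow m).mul ((PolyBounded.const e 1).add
        (((((PolyBounded.const e 2).add hE).add (hE.pow k)).add (hE.pow m)).pow n)))
    refine ⟨r, fun c i hi => le_trans ?_ (hr c)⟩
    have hk' := hk c _ (List.take_prefix i (l c))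
    have hd : (encodeList (((l c).drop i).map (eA c))).size ≤ (e c).size ^ m := by
      rw [List.map_drop]
      exact (size_encodeList_drop_le _ _).trans (hm c)
    have ho : ∀ v ∈ (mapAcc (f c) (s c) ((l c).take i)).2.reverse.map (eO c),
        v.size ≤ (2 + (e c).size + (e c).size ^ k + (e c).size ^ m) ^ n := by
      intro v hv
      simp only [List.mem_map, List.mem_reverse] at hv
      obtain ⟨o, ho, rfl⟩ := hv
      obtain ⟨j, hj, hjo⟩ : ∃ j, ∃ h : j < (l c).length,
          (f c (mapAcc (f c) (s c) ((l c).take j)).1 (l c)[j]).2 = o := by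
        clear hk' hd
        induction i with
        | zero => simp [mapAcc] at ho
        | succ i ih =>
          rw [mapAcc_take_succ _ _ _ hi] at ho
          rcases List.mem_append.1 ho with ho | ho
          · exact ih (by omega) ho
          · exact ⟨i, hi, (List.mem_singleton.1 ho).symm⟩
      have h1 := hn ⟨c, (mapAcc (f c) (s c) ((l c).take j)).1, (l c)[j]⟩
      have h2 := hk c _ (List.take_prefix j (l c))
      have h3 : (eA c (l c)[j]).size ≤ (e c).size ^ m :=
        (size_le_size_encodeList (List.mem_map.2 ⟨_, List.getElem_mem hj, rfl⟩)).trans (hm c)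
      simp only [Val.size, hjo] at h1
      refine le_trans (by omega) (h1.trans (Nat.pow_le_pow_left (by omega) n))
    have hlen : (mapAcc (f c) (s c) ((l c).take i)).2.length ≤ (e c).size ^ m := by
      have h1 : ∀ (s : S c) (l : List (A c)), (mapAcc (f c) s l).2.length = l.length := by
        intro s l
        induction l generalizing s with
        | nil => rfl
        | cons a l ih => simp [mapAcc, ih]
      rw [h1, List.length_take_of_le hi]
      refine hi.trans (le_trans ?_ (hm c))
      simpa using length_le_size_encodeList ((l c).map (eA c))
    have h4 := (size_encodeList_le ho).trans (Nat.add_le_add_left (Nat.mul_le_mul_right _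
      (by simpa using hlen)) 2)
    simp only [Val.size, st]
    omega
  have hstep : PolyTime (fun p : {p : γ × ℕ // p.2 < (l p.1).length} => st p.1.1 p.1.2)
      fun p => st p.1.1 (p.1.2 + 1) := by
    let δ := {p : γ × ℕ // p.2 < (l p.1).length}
    let s' : δ → Val := fun p => eS p.1.1 (mapAcc (f p.1.1) (s p.1.1) ((l p.1.1).take p.1.2)).1
    let os : δ → Val := fun p => encodeList
      ((mapAcc (f p.1.1) (s p.1.1) ((l p.1.1).take p.1.2)).2.reverse.map (eO p.1.1))
    let a' : δ → Val := fun p => eA p.1.1 ((l p.1.1)[p.1.2]'p.2)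
    let rest : δ → Val := fun p => encodeList (((l p.1.1).drop (p.1.2 + 1)).map (eA p.1.1))
    have hst : (fun p : δ => st p.1.1 p.1.2) = fun p => .pair (e p.1.1)
        (.pair (.pair (s' p) (os p)) (.pair (a' p) (rest p))) := by
      funext p
      simp only [st, s', os, a', rest]
      rw [List.drop_eq_getElem_cons p.2]
      rfl
    rw [hst]
    have hid := PolyTime.id (fun p : δ => Val.pair (e p.1.1)
        (.pair (.pair (s' p) (os p)) (.pair (a' p) (rest p))))
    have hf' := (hid.fst.pair (hid.snd.fst.fst.pair hid.snd.snd.fst)).comp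
      (hf.reindex fun p : δ => (⟨p.1.1, (mapAcc (f p.1.1) (s p.1.1) ((l p.1.1).take p.1.2)).1,
        ((l p.1.1)[p.1.2]'p.2)⟩ : Σ c, S c × A c))
    refine (hid.fst.pair ((hf'.fst.pair (hf'.snd.pair hid.snd.fst.snd)).pair
      hid.snd.snd.snd)).congr fun p => ?_
    simp only [st, os, rest]
    rw [mapAcc_take_succ _ _ _ p.2]
    simp [encodeList]
  have hloop : PolyTime (fun c => st c 0) fun c => st c (l c).length := by
    refine PolyTime.loop ?_ hstep ?_ ?_
    · have hid := PolyTime.id (fun p : {p : γ × ℕ // p.2 ≤ (l p.1).length} => st p.1.1 p.1.2)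
      obtain ⟨t, h1, h2⟩ := (PolyTimeTest.isInt hid.snd.snd).not
      refine ⟨t, fun p => (h1 p).trans ?_, h2⟩
      have hp := p.2
      constructor
      · intro h
        refine lt_of_le_of_ne hp fun hp' => h ⟨0, ?_⟩
        rw [List.drop_of_length_le hp'.ge]
        rfl
      · rintro h ⟨z, hz⟩
        rw [List.drop_eq_getElem_cons h] at hz
        simp only [List.map_cons, encodeList, reduceCtorEq] at hz
    · have hid := PolyTime.id (fun c => st c 0)
      refine hid.snd.snd.size.mono fun c => ?_
      simpa using length_le_size_encodeList ((l c).map (eA c))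
    · obtain ⟨k, hk⟩ := hsub
      obtain ⟨m, hm⟩ := (PolyTime.id (fun c => st c 0)).fst.bounded ((PolyBounded.self e).pow k)
      exact ⟨m, fun c i hi => (hk c i hi).trans (hm c)⟩
  refine ((h0.comp hloop).snd.fst).congr fun c => ?_
  simp only [List.take_length]

/-- Evaluation of a left fold. -/
theorem PolyTime.foldl (eS : ∀ c, S c → Val) (eA : ∀ c, A c → Val)
    (f : ∀ c, S c → A c → S c) {s : ∀ c, S c} {l : ∀ c, List (A c)}
    (hs : PolyTime e fun c => eS c (s c))
    (hl : PolyTime e fun c => encodeList ((l c).map (eA c)))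
    (hf : PolyTime (fun p : Σ c, S c × A c => .pair (e p.1) (.pair (eS p.1 p.2.1) (eA p.1 p.2.2)))
      fun p => eS p.1 (f p.1 p.2.1 p.2.2))
    (hb : ∃ k, ∀ c, ∀ l', l' <+: l c → (eS c (l'.foldl (f c) (s c))).size ≤ (e c).size ^ k) :
    PolyTime e fun c => eS c ((l c).foldl (f c) (s c)) := by
  have h := PolyTime.mapAcc_reverse (O := fun _ => Unit) eS eA (fun _ _ => .int 0)
    (fun c s a => (f c s a, ())) hs hl (hf.pair (.const _ 0))
    (by simpa only [mapAcc_foldl] using hb)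
  simpa only [mapAcc_foldl] using h.fst

/-- Reversal of a list. -/
theorem PolyTime.reverse {l : γ → List Val} (hl : PolyTime e fun c => encodeList (l c)) :
    PolyTime e fun c => encodeList (l c).reverse := by
  have h := PolyTime.mapAcc_reverse (e := e) (S := fun _ => Unit) (A := fun _ => Val)
    (O := fun _ => Val) (s := fun _ => ()) (fun _ _ => .int 0) (fun _ v => v) (fun _ v => v)
    (fun _ s a => (s, a)) (.const _ 0) (l := l) (by simpa using hl)
    ((PolyTime.id _).snd) (PolyBounded.const e 2 |>.imp fun k hk c _ _ => hk c)
  simpa [mapAcc_map (fun a : Val => a)] using h.snd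

/-- Recursion along a list with a running state, with the outputs in the order of the list. -/
theorem PolyTime.mapAcc (eS : ∀ c, S c → Val) (eA : ∀ c, A c → Val) (eO : ∀ c, O c → Val)
    (f : ∀ c, S c → A c → S c × O c) {s : ∀ c, S c} {l : ∀ c, List (A c)}
    (hs : PolyTime e fun c => eS c (s c))
    (hl : PolyTime e fun c => encodeList ((l c).map (eA c)))
    (hf : PolyTime (fun p : Σ c, S c × A c => .pair (e p.1) (.pair (eS p.1 p.2.1) (eA p.1 p.2.2)))
      fun p => .pair (eS p.1 (f p.1 p.2.1 p.2.2).1) (eO p.1 (f p.1 p.2.1 p.2.2).2))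
    (hb : ∃ k, ∀ c, ∀ l', l' <+: l c →
      (eS c (DivSys.mapAcc (f c) (s c) l').1).size ≤ (e c).size ^ k) :
    PolyTime e fun c => .pair (eS c (DivSys.mapAcc (f c) (s c) (l c)).1)
      (encodeList ((DivSys.mapAcc (f c) (s c) (l c)).2.map (eO c))) := by
  have h := PolyTime.mapAcc_reverse eS eA eO f hs hl hf hb
  refine (h.fst.pair h.snd.reverse).congr fun c => ?_
  simp

/-- Application of a function to all entries of a list. -/
theorem PolyTime.map (eA : ∀ c, A c → Val) (eO : ∀ c, O c → Val)
    (f : ∀ c, A c → O c) {l : ∀ c, List (A c)}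
    (hl : PolyTime e fun c => encodeList ((l c).map (eA c)))
    (hf : PolyTime (fun p : Σ c, A c => .pair (e p.1) (eA p.1 p.2)) fun p => eO p.1 (f p.1 p.2)) :
    PolyTime e fun c => encodeList (((l c).map (f c)).map (eO c)) := by
  have hid := PolyTime.id (fun p : Σ c, Unit × A c =>
    Val.pair (e p.1) (.pair (.int 0) (eA p.1 p.2.2)))
  have h := PolyTime.mapAcc (e := e) (S := fun _ => Unit) (s := fun _ => ()) (fun _ _ => .int 0)
    eA eO (fun c s a => (s, f c a)) (.const _ 0) hl
    (hid.snd.fst.pair ((hid.fst.pair hid.snd.snd).comp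
      (hf.reindex fun p : Σ c, Unit × A c => (⟨p.1, p.2.2⟩ : Σ c, A c))))
    (PolyBounded.const e 2 |>.imp fun k hk c _ _ => hk c)
  simpa [mapAcc_map] using h.snd

end Lists

/-! ### The extended Euclidean algorithm -/

theorem size_lt_size_of_two_mul_lt {m n : ℕ} (h : 2 * n < m) : Nat.size n < Nat.size m := by
  rw [Nat.lt_size]
  rcases Nat.eq_zero_or_pos n with rfl | hn
  · exact Nat.size_pos.2 (by omega) |>.trans_eq' (by simp) |> Nat.lt_size.1
  · obtain ⟨s, hs⟩ := Nat.exists_eq_succ_of_ne_zero (Nat.size_pos.2 hn).ne'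
    have h1 : 2 ^ s ≤ n := Nat.lt_size.1 (by omega)
    rw [hs, Nat.succ_eq_add_one, pow_succ]
    omega

/-- The round of the Euclidean algorithm that replaces `r₀, r₁` by `r₁, r₀ mod r₁`. The cofactors
`u₀, u₁` of the first of the two given numbers are reduced modulo the second one, `a`. -/
def euclidStep (a : ℤ) (s : ℤ × ℤ × ℤ × ℤ) : ℤ × ℤ × ℤ × ℤ :=
  (s.2.1, s.1 % s.2.1, s.2.2.2, (s.2.2.1 - s.1 / s.2.1 * s.2.2.2) % a)

/-- Bounds the number of rounds: the product of two consecutive remainders is halved. The other case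
can only occur in the first round. -/
def euclidMeasure (s : ℤ × ℤ × ℤ × ℤ) : ℕ :=
  if s.2.1 < s.1 then Nat.size (s.1.natAbs * s.2.1.natAbs)
  else Nat.size (s.2.1.natAbs * s.2.1.natAbs) + 1

theorem euclidMeasure_step {a : ℤ} {s : ℤ × ℤ × ℤ × ℤ} (h : 0 < s.2.1) :
    euclidMeasure (euclidStep a s) < euclidMeasure s := by
  obtain ⟨r, r', u, u'⟩ := s
  have hlt := Int.emod_lt_of_pos r h
  have h0 := Int.emod_nonneg r h.ne'
  have e1 : euclidMeasure (euclidStep a (r, r', u, u')) = Nat.size (r'.natAbs * (r % r').natAbs) :=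
    if_pos hlt
  rw [e1]
  simp only [euclidMeasure] at *
  split_ifs with hr
  · apply size_lt_size_of_two_mul_lt
    have h1 : 1 ≤ r / r' := (Int.le_ediv_iff_mul_le h).2 (by omega)
    have h2 := Int.mul_ediv_add_emod r r'
    have h3 : 2 * (r % r') < r := by nlinarith
    zify
    rw [abs_of_pos h, abs_of_pos (h.trans hr), abs_of_nonneg h0]
    nlinarith
  · refine Nat.lt_succ_of_le (Nat.size_le_size (Nat.mul_le_mul_left _ ?_))
    omega

/-- What is preserved by the Euclidean algorithm started on `p = (h, a)`: the gcd, the congruences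
between remainders and cofactors modulo `a`, and bounds for all numbers. The first remainder can be
negative only at the start, where it is `h`. -/
def EuclidInv (p : ℤ × ℤ) (s : ℤ × ℤ × ℤ × ℤ) : Prop :=
  Int.gcd s.1 s.2.1 = Int.gcd p.1 p.2 ∧ p.2 ∣ s.2.2.1 * p.1 - s.1 ∧ p.2 ∣ s.2.2.2 * p.1 - s.2.1 ∧
    0 ≤ s.2.1 ∧ s.1.natAbs ≤ p.1.natAbs + p.2.natAbs ∧ s.2.1.natAbs ≤ p.1.natAbs + p.2.natAbs ∧
    s.2.2.1.natAbs ≤ p.2.natAbs + 1 ∧ s.2.2.2.natAbs ≤ p.2.natAbs + 1 ∧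
    (0 ≤ s.1 ∨ s.1 = p.1 ∧ s.2.1 = |p.2|) ∧ (p.2 = 0 → s.2.1 = 0)

theorem EuclidInv.step {p : ℤ × ℤ} {s : ℤ × ℤ × ℤ × ℤ} (h : EuclidInv p s) (h0 : s.2.1 ≠ 0) :
    EuclidInv p (euclidStep p.2 s) := by
  obtain ⟨h, a⟩ := p
  obtain ⟨r, r', u, u'⟩ := s
  obtain ⟨h1, h2, h3, h4, h5, h6, h7, h8, h9, h10⟩ := h
  simp only [EuclidInv, euclidStep] at *
  have hpos : 0 < r' := lt_of_le_of_ne h4 (Ne.symm h0)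
  have hlt := Int.emod_lt_of_pos r hpos
  have hnn := Int.emod_nonneg r h0
  have ha : a ≠ 0 := by
    exact fun ha => h0 (h10 ha)
  refine ⟨?_, h3, ?_, hnn, h6, by omega, h8, ?_, Or.inl h4,
    fun h => absurd h ha⟩
  · rw [← h1, Int.emod_def, Int.gcd_sub_mul_left_right, Int.gcd_comm]
  · have e : u - r / r' * u' = (u - r / r' * u') % a + a * ((u - r / r' * u') / a) :=
      (Int.emod_add_mul_ediv _ _).symm
    have e2 := Int.emod_add_mul_ediv r r'
    have : (u - r / r' * u') % a * h - r % r' =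
        (u * h - r) - r / r' * (u' * h - r') - a * ((u - r / r' * u') / a * h) := by
      linear_combination (-h) * e - e2
    rw [this]
    exact ((h2.sub (h3.mul_left _)).sub (dvd_mul_right _ _))
  · have := Int.emod_lt_abs (u - r / r' * u') ha
    have := Int.emod_nonneg (u - r / r' * u') ha
    zify
    rw [abs_of_nonneg this]
    omega

/-- The extended Euclidean algorithm runs in polynomial time. For negative `h` and `a = 0` it returns
`h` instead of the gcd. -/
theorem exists_xgcd : ∃ xg : ℤ × ℤ → ℤ × ℤ,
    (∀ p, 0 ≤ p.1 ∨ p.2 ≠ 0 → (xg p).1 = Int.gcd p.1 p.2) ∧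
    (∀ p, p.2 ∣ (xg p).2 * p.1 - (xg p).1) ∧
    PolyTime (fun p : ℤ × ℤ => .pair (.int p.1) (.int p.2))
      fun p => .pair (.int (xg p).1) (.int (xg p).2) := by
  let e : ℤ × ℤ → Val := fun p => .pair (.int p.1) (.int p.2)
  have hid := PolyTime.id e
  refine (PolyTime.exists_while (e := e) (S := fun _ => ℤ × ℤ × ℤ × ℤ)
    (fun _ s => .pair (.pair (.int s.1) (.int s.2.1)) (.pair (.int s.2.2.1) (.int s.2.2.2)))
    EuclidInv (fun _ s => s.2.1 ≠ 0) (fun p s => euclidStep p.2 s) (fun _ s => euclidMeasure s)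
    (fun p => (p.1, |p.2|, 1, 0)) ?_ ?_ ?_ ?_ ?_ ?_ ?_).elim
    fun r ⟨hr, hP⟩ => ?_
  · exact ((hid.fst.pair (.ite (.le hid.snd (.const e 0)) hid.snd.neg hid.snd)).pair
      ((PolyTime.const e 1).pair (.const e 0))).congr fun p => by
        split_ifs with h
        · rw [abs_of_nonpos h]
        · rw [abs_of_nonneg (by omega)]
  · intro p
    refine ⟨?_, ?_, ?_, ?_, ?_, ?_, ?_, ?_, ?_, ?_⟩ <;> simp [Int.gcd, Int.natAbs_abs]
  · exact fun p s hs h0 => ⟨hs.step h0, euclidMeasure_step (lt_of_le_of_ne hs.2.2.2.1 h0.symm)⟩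
  · refine ((PolyBounded.self e).add (.self e)).mono fun p => ?_
    have h1 := size_mul_le p.1.natAbs p.2.natAbs
    have h2 := size_mul_le p.2.natAbs p.2.natAbs
    simp only [euclidMeasure, Int.natAbs_abs, e, Val.size]
    split_ifs <;> omega
  · obtain ⟨k, hk⟩ := ((PolyBounded.self e).const_mul 10)
    refine ⟨k, fun p s hs => le_trans ?_ (hk p)⟩
    obtain ⟨-, -, -, -, h5, h6, h7, h8, -⟩ := hs
    have h5 := (Nat.size_le_size h5).trans (size_add_le _ _)
    have h6 := (Nat.size_le_size h6).trans (size_add_le _ _)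
    have h7 := (Nat.size_le_size h7).trans (size_add_le _ _)
    have h8 := (Nat.size_le_size h8).trans (size_add_le _ _)
    simp only [Nat.size_one] at h7 h8
    simp only [e, Val.size]
    omega
  · have h := PolyTime.id fun x : Σ c, {s : ℤ × ℤ × ℤ × ℤ // EuclidInv c s} => Val.pair (e x.1)
      (.pair (.pair (.int x.2.1.1) (.int x.2.1.2.1)) (.pair (.int x.2.1.2.2.1) (.int x.2.1.2.2.2)))
    exact (PolyTimeTest.eq h.snd.fst.snd (.const _ 0)).not
  · have h := PolyTime.id fun x : Σ c, {s : ℤ × ℤ × ℤ × ℤ // EuclidInv c s} => Val.pair (e x.1)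
      (.pair (.pair (.int x.2.1.1) (.int x.2.1.2.1)) (.pair (.int x.2.1.2.2.1) (.int x.2.1.2.2.2)))
    exact (h.snd.fst.snd.pair (.mod h.snd.fst.fst h.snd.fst.snd)).pair
      (h.snd.snd.snd.pair (.mod (h.snd.snd.fst.sub (.mul (.div h.snd.fst.fst h.snd.fst.snd)
        h.snd.snd.snd)) h.fst.snd))
  · refine ⟨fun p => ((r p).1, (r p).2.2.1), fun p hp => ?_, fun p => (hr p).1.2.1,
      hP.fst.fst.pair hP.snd.fst⟩
    obtain ⟨⟨h1, -, -, -, -, -, -, -, h9, -⟩, h0⟩ := hr p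
    simp only [not_not] at h0
    rw [h0, Int.gcd_zero_right] at h1
    simp only
    rw [← h1]
    have : 0 ≤ (r p).1 := by
      rcases h9 with h9 | ⟨h9, h10⟩
      · exact h9
      · rw [h0, eq_comm, abs_eq_zero] at h10
        rcases hp with hp | hp
        · omega
        · exact absurd h10 hp
    omega

/-- The result of the extended Euclidean algorithm: for `(h, a)` with `a ≠ 0` or `0 ≤ h` the gcd `g` of `h` and
`a`, and a number `u` such that `g - u * h` is a multiple of `a`. -/
noncomputable def xgcd : ℤ × ℤ → ℤ × ℤ := exists_xgcd.choose

theorem xgcd_fst {h a : ℤ} (ha : a ≠ 0) : (xgcd (h, a)).1 = Int.gcd h a :=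
  exists_xgcd.choose_spec.1 (h, a) (.inr ha)

theorem xgcd_fst_of_nonneg {h : ℤ} (a : ℤ) (hh : 0 ≤ h) : (xgcd (h, a)).1 = Int.gcd h a :=
  exists_xgcd.choose_spec.1 (h, a) (.inl hh)

theorem dvd_xgcd (h a : ℤ) : a ∣ (xgcd (h, a)).1 - (xgcd (h, a)).2 * h :=
  (dvd_sub_comm).1 (exists_xgcd.choose_spec.2.1 (h, a))

theorem PolyTime.xgcd : PolyTime (fun p : ℤ × ℤ => .pair (.int p.1) (.int p.2))
    fun p => .pair (.int (DivSys.xgcd p).1) (.int (DivSys.xgcd p).2) :=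
  exists_xgcd.choose_spec.2.2

section Lattices

variable {d : ℕ}

/-! ### Echelon tableaux -/

/-- The columns of a coefficient matrix: one for each variable, and `none` for the constant. -/
abbrev Col (d : ℕ) : Type := Option (Fin d)

/-- The entry of a linear polynomial in a column. -/
def entry : Col d → LinPoly d →ₗ[ℤ] ℤ
  | none => LinearMap.snd ℤ _ _
  | some i => (LinearMap.proj i).comp (LinearMap.fst ℤ _ _)

@[simp] theorem entry_none (f : LinPoly d) : entry none f = f.2 := rfl

@[simp] theorem entry_some (i : Fin d) (f : LinPoly d) : entry (some i) f = f.1 i := rfl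

theorem eq_zero_of_entry {f : LinPoly d} (h : ∀ i, entry i f = 0) : f = 0 :=
  Prod.ext (funext fun i => h (some i)) (h none)

/-- A list of rows, each with the column meant for its pivot. -/
abbrev Tableau (d : ℕ) : Type := List (Col d × LinPoly d)

/-- The lattice generated by the rows. -/
def rowSpan : Tableau d → Submodule ℤ (LinPoly d)
  | [] => ⊥
  | x :: H => Submodule.span ℤ {x.2} ⊔ rowSpan H

/-- Row echelon form: all rows after a row vanish in its column, and a row is zero unless its own
entry in this column, the pivot, is positive. -/
def IsEchelon : Tableau d → Prop
  | [] => True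
  | x :: H => IsEchelon H ∧ 0 ≤ entry x.1 x.2 ∧ (entry x.1 x.2 = 0 → x.2 = 0) ∧
      ∀ y ∈ H, entry x.1 y.2 = 0

theorem mem_rowSpan_cons {x : Col d × LinPoly d} {H : Tableau d} {f : LinPoly d} :
    f ∈ rowSpan (x :: H) ↔ ∃ t : ℤ, f - t • x.2 ∈ rowSpan H := by
  rw [rowSpan, Submodule.mem_sup]
  constructor
  · rintro ⟨y, hy, z, hz, rfl⟩
    obtain ⟨t, rfl⟩ := Submodule.mem_span_singleton.1 hy
    exact ⟨t, by simpa using hz⟩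
  · rintro ⟨t, ht⟩
    exact ⟨t • x.2, Submodule.mem_span_singleton.2 ⟨t, rfl⟩, _, ht, by abel⟩

theorem mem_rowSpan {H : Tableau d} {x : Col d × LinPoly d} (h : x ∈ H) : x.2 ∈ rowSpan H := by
  induction H with
  | nil => simp at h
  | cons y H ih =>
    rcases List.mem_cons.1 h with rfl | h
    · exact mem_rowSpan_cons.2 ⟨1, by simp⟩
    · exact mem_rowSpan_cons.2 ⟨0, by simpa using ih h⟩

theorem rowSpan_le {H : Tableau d} {M : Submodule ℤ (LinPoly d)} :
    rowSpan H ≤ M ↔ ∀ x ∈ H, x.2 ∈ M := by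
  refine ⟨fun h x hx => h (mem_rowSpan hx), fun h => ?_⟩
  induction H with
  | nil => exact bot_le
  | cons y H ih =>
    exact sup_le ((Submodule.span_singleton_le_iff_mem _ _).2 (h y List.mem_cons_self))
      (ih fun x hx => h x (List.mem_cons_of_mem _ hx))

theorem entry_eq_zero_of_mem_rowSpan {H : Tableau d} {i : Col d} (h : ∀ y ∈ H, entry i y.2 = 0)
    {f : LinPoly d} (hf : f ∈ rowSpan H) : entry i f = 0 :=
  (rowSpan_le (M := LinearMap.ker (entry i))).2 h hf

/-! ### Insertion of a row -/

/-- One step of the insertion of a row into a tableau. The state consists of what is left of the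
inserted row, and of a factor; the entry of this row in the column of `x` is cleared by a unimodular
transformation of the two rows. The factor is multiplied by what the inserted row is multiplied by;
in the end it generates the ideal of all `t` for which `t` times the inserted row lies in the lattice
of the tableau. -/
noncomputable def insertStep (s : LinPoly d × ℤ) (x : Col d × LinPoly d) :
    (LinPoly d × ℤ) × (Col d × LinPoly d) :=
  if entry x.1 s.1 = 0 then (s, x) else
    let h := entry x.1 x.2
    let a := entry x.1 s.1
    let g := (xgcd (h, a)).1
    let u := (xgcd (h, a)).2
    (((h / g) • s.1 - (a / g) • x.2, s.2 * (h / g)), (x.1, u • x.2 + ((g - u * h) / a) • s.1))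

theorem insertStep_fst (s : LinPoly d × ℤ) (x : Col d × LinPoly d) :
    (insertStep s x).2.1 = x.1 := by
  unfold insertStep
  split_ifs <;> rfl

/-- The new pair of rows generates the same lattice. The last part is the step in the computation of
the ideal of all `t` with `t • s.1` in the lattice of `x` and later rows, whose lattice `M` vanishes
in the column of `x`. -/
theorem insertStep_spec (s : LinPoly d × ℤ) {x : Col d × LinPoly d} (h0 : 0 ≤ entry x.1 x.2)
    (hx : entry x.1 x.2 = 0 → x.2 = 0) :
    entry x.1 (insertStep s x).1.1 = 0 ∧ 0 ≤ entry x.1 (insertStep s x).2.2 ∧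
    (entry x.1 (insertStep s x).2.2 = 0 → (insertStep s x).2.2 = 0) ∧
    Submodule.span ℤ {(insertStep s x).2.2} ⊔ Submodule.span ℤ {(insertStep s x).1.1} =
      Submodule.span ℤ {x.2} ⊔ Submodule.span ℤ {s.1} ∧
    ∃ k : ℤ, 0 ≤ k ∧ (insertStep s x).1.2 = s.2 * k ∧
      ∀ M : Submodule ℤ (LinPoly d), (∀ f ∈ M, entry x.1 f = 0) → ∀ t : ℤ,
        ((∃ q : ℤ, t • s.1 - q • x.2 ∈ M) ↔
          ∃ t', t = t' * k ∧ t' • (insertStep s x).1.1 ∈ M) := by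
  obtain ⟨w, b⟩ := s
  obtain ⟨i, r⟩ := x
  dsimp only at *
  by_cases ha : entry i w = 0
  · simp only [insertStep, ha, if_true]
    refine ⟨trivial, h0, hx, trivial, 1, by simp, by simp, fun M hM t => ?_⟩
    constructor
    · rintro ⟨q, hq⟩
      have h1 := hM _ hq
      simp only [map_sub, map_smul, ha, smul_eq_mul, mul_zero, zero_sub, neg_eq_zero,
        mul_eq_zero] at h1
      refine ⟨t, by simp, ?_⟩
      rcases h1 with rfl | h1
      · simpa using hq
      · simpa [hx h1] using hq
    · rintro ⟨t', rfl, ht⟩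
      exact ⟨0, by simpa using ht⟩
  · obtain ⟨v, hv⟩ := dvd_xgcd (entry i r) (entry i w)
    have hg := xgcd_fst (h := entry i r) ha
    simp only [insertStep, ha, if_false]
    rw [hg] at hv ⊢
    generalize (xgcd (entry i r, entry i w)).2 = u at *
    rw [hv, Int.mul_ediv_cancel_left _ ha]
    have hgp : (0 : ℤ) < Int.gcd (entry i r) (entry i w) := by
      exact_mod_cast Int.gcd_pos_of_ne_zero_right _ ha
    obtain ⟨h', hh'⟩ := Int.gcd_dvd_left (entry i r) (entry i w)
    obtain ⟨a', ha'⟩ := Int.gcd_dvd_right (entry i r) (entry i w)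
    generalize (Int.gcd (entry i r) (entry i w) : ℤ) = g at *
    have e1 : entry i r / g = h' := by rw [hh', Int.mul_ediv_cancel_left _ hgp.ne']
    have e2 : entry i w / g = a' := by rw [ha', Int.mul_ediv_cancel_left _ hgp.ne']
    rw [e1, e2]
    have e3 : u * h' + v * a' = 1 := by
      refine mul_left_cancel₀ hgp.ne' ?_
      rw [hh', ha'] at hv
      linear_combination -hv
    have e4 : entry i (u • r + v • w) = g := by
      simp only [map_add, map_smul, smul_eq_mul]
      linear_combination -hv
    refine ⟨?_, e4 ▸ hgp.le, fun h => absurd (e4 ▸ h) hgp.ne', ?_, h', ?_, rfl, ?_⟩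
    · simp only [map_sub, map_smul, smul_eq_mul]
      rw [hh', ha']
      ring
    · have m1 : r ∈ Submodule.span ℤ {r} ⊔ Submodule.span ℤ {w} :=
        Submodule.mem_sup_left (Submodule.mem_span_singleton_self _)
      have m2 : w ∈ Submodule.span ℤ {r} ⊔ Submodule.span ℤ {w} :=
        Submodule.mem_sup_right (Submodule.mem_span_singleton_self _)
      have m3 : u • r + v • w ∈
          Submodule.span ℤ {u • r + v • w} ⊔ Submodule.span ℤ {h' • w - a' • r} :=
        Submodule.mem_sup_left (Submodule.mem_span_singleton_self _)
      have m4 : h' • w - a' • r ∈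
          Submodule.span ℤ {u • r + v • w} ⊔ Submodule.span ℤ {h' • w - a' • r} :=
        Submodule.mem_sup_right (Submodule.mem_span_singleton_self _)
      refine le_antisymm (sup_le ?_ ?_) (sup_le ?_ ?_) <;>
        rw [Submodule.span_singleton_le_iff_mem]
      · exact add_mem (Submodule.smul_mem _ _ m1) (Submodule.smul_mem _ _ m2)
      · exact sub_mem (Submodule.smul_mem _ _ m2) (Submodule.smul_mem _ _ m1)
      · have h := sub_mem (Submodule.smul_mem _ h' m3) (Submodule.smul_mem _ v m4)
        have e5 : h' • (u • r + v • w) - v • (h' • w - a' • r) = r := by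
          linear_combination (exp := 1) e3 • r
        rwa [e5] at h
      · have h := add_mem (Submodule.smul_mem _ a' m3) (Submodule.smul_mem _ u m4)
        have e5 : a' • (u • r + v • w) + u • (h' • w - a' • r) = w := by
          linear_combination (exp := 1) e3 • w
        rwa [e5] at h
    · rw [hh'] at h0
      exact nonneg_of_mul_nonneg_right h0 hgp
    · intro M hM t
      constructor
      · rintro ⟨q, hq⟩
        have h1 := hM _ hq
        simp only [map_sub, map_smul, smul_eq_mul] at h1
        have h2 : t * a' = q * h' := by
          refine mul_left_cancel₀ hgp.ne' ?_
          rw [hh', ha'] at h1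
          linear_combination h1
        have h3 : t = (u * t + v * q) * h' := by linear_combination (-t) * e3 + v * h2
        refine ⟨u * t + v * q, h3, ?_⟩
        have h4 : (u * t + v * q) • (h' • w - a' • r) = t • w - q • r := by
          have h5 : q = (u * t + v * q) * a' := by linear_combination (-q) * e3 - u * h2
          rw [smul_sub, smul_smul, smul_smul, ← h3, ← h5]
        rwa [h4]
      · rintro ⟨t', rfl, ht⟩
        refine ⟨t' * a', ?_⟩
        rwa [smul_sub, smul_smul, smul_smul] at ht

theorem map_fst_mapAcc_insertStep (s : LinPoly d × ℤ) (H : Tableau d) :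
    (mapAcc insertStep s H).2.map Prod.fst = H.map Prod.fst := by
  induction H generalizing s with
  | nil => rfl
  | cons x H ih => simp [mapAcc, ih, insertStep_fst]

/-- The running remainder and the new rows together generate the lattice of the old rows and the
inserted one, and the factor records which multiples of the inserted row lie in the old lattice. -/
theorem mapAcc_insertStep_spec {H : Tableau d} (hH : IsEchelon H) (s : LinPoly d × ℤ) :
    IsEchelon (mapAcc insertStep s H).2 ∧
    rowSpan (mapAcc insertStep s H).2 ⊔ Submodule.span ℤ {(mapAcc insertStep s H).1.1} =
      rowSpan H ⊔ Submodule.span ℤ {s.1} ∧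
    (∀ x ∈ H, entry x.1 (mapAcc insertStep s H).1.1 = 0) ∧
    ∃ k : ℤ, 0 ≤ k ∧ (mapAcc insertStep s H).1.2 = s.2 * k ∧
      ∀ t : ℤ, t • s.1 ∈ rowSpan H ↔
        ∃ t', t = t' * k ∧ t' • (mapAcc insertStep s H).1.1 = 0 := by
  induction H generalizing s with
  | nil => exact ⟨trivial, rfl, by simp, 1, by simp, by simp [mapAcc],
      fun t => by simp [mapAcc, rowSpan]⟩
  | cons x H ih =>
    obtain ⟨hH, h0, hx, hz⟩ := hH
    obtain ⟨i1, i2, i3, i4, k, hk0, hk, hk'⟩ := insertStep_spec s h0 hx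
    obtain ⟨j1, j2, j3, l, hl0, hl, hl'⟩ := ih hH (insertStep s x).1
    have hM : ∀ f ∈ rowSpan H, entry x.1 f = 0 := fun f hf => entry_eq_zero_of_mem_rowSpan hz hf
    have hvan : ∀ f ∈ rowSpan H ⊔ Submodule.span ℤ {(insertStep s x).1.1}, entry x.1 f = 0 := by
      have : rowSpan H ⊔ Submodule.span ℤ {(insertStep s x).1.1} ≤ LinearMap.ker (entry x.1) :=
        sup_le hM ((Submodule.span_singleton_le_iff_mem _ _).2 i1)
      exact this
    rw [← j2] at hvan
    refine ⟨⟨j1, ?_, ?_, fun y hy => ?_⟩, ?_, ?_,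
      k * l, mul_nonneg hk0 hl0, ?_, fun t => ?_⟩
    · simpa [insertStep_fst] using i2
    · simpa [insertStep_fst] using i3
    · rw [insertStep_fst]
      exact hvan _ (Submodule.mem_sup_left (mem_rowSpan hy))
    · simp only [mapAcc, rowSpan]
      rw [sup_assoc, j2, sup_left_comm, i4, sup_left_comm, sup_assoc]
    · intro y hy
      rcases List.mem_cons.1 hy with rfl | hy
      · exact hvan _ (Submodule.mem_sup_right (Submodule.mem_span_singleton_self _))
      · exact j3 y hy
    · simp only [mapAcc, hl, hk, mul_assoc]
    · rw [mem_rowSpan_cons, hk' _ hM]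
      simp only [mapAcc]
      constructor
      · rintro ⟨t', rfl, ht⟩
        obtain ⟨t'', rfl, ht'⟩ := (hl' t').1 ht
        exact ⟨t'', by ring, ht'⟩
      · rintro ⟨t'', rfl, ht⟩
        exact ⟨t'' * l, by ring, (hl' _).2 ⟨t'', rfl, ht⟩⟩

/-- The columns in decreasing order: the largest variable first, the constant last. -/
def columns (ord : Equiv.Perm (Fin d)) : List (Col d) :=
  (List.ofFn fun j => some (ord j)).reverse ++ [none]

theorem mem_columns (ord : Equiv.Perm (Fin d)) (i : Col d) : i ∈ columns ord := by
  cases i with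
  | none => simp [columns]
  | some i => simpa [columns] using ⟨ord.symm i, by simp⟩

/-- The tableau after the insertion of a row (not yet reduced). -/
noncomputable def insertRow (H : Tableau d) (w : LinPoly d) : Tableau d :=
  (mapAcc insertStep (w, 1) H).2

/-- The non-negative generator of the ideal of all `t` for which `t • w` lies in the lattice. -/
noncomputable def orderMod (H : Tableau d) (w : LinPoly d) : ℤ :=
  (mapAcc insertStep (w, 1) H).1.2

/-- Every column has a row, so nothing is left of the inserted row. -/
theorem mapAcc_insertStep_remainder {ord : Equiv.Perm (Fin d)} {H : Tableau d} (hH : IsEchelon H)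
    (hc : H.map Prod.fst = columns ord) (s : LinPoly d × ℤ) :
    (mapAcc insertStep s H).1.1 = 0 := by
  refine eq_zero_of_entry fun i => ?_
  have hi := mem_columns ord i
  rw [← hc] at hi
  obtain ⟨x, hx, rfl⟩ := List.mem_map.1 hi
  exact (mapAcc_insertStep_spec hH s).2.2.1 x hx

theorem map_fst_insertRow (H : Tableau d) (w : LinPoly d) :
    (insertRow H w).map Prod.fst = H.map Prod.fst :=
  map_fst_mapAcc_insertStep _ H

theorem isEchelon_insertRow {H : Tableau d} (hH : IsEchelon H) (w : LinPoly d) :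
    IsEchelon (insertRow H w) :=
  (mapAcc_insertStep_spec hH (w, 1)).1

theorem rowSpan_insertRow {ord : Equiv.Perm (Fin d)} {H : Tableau d} (hH : IsEchelon H)
    (hc : H.map Prod.fst = columns ord) (w : LinPoly d) :
    rowSpan (insertRow H w) = rowSpan H ⊔ Submodule.span ℤ {w} := by
  have h := (mapAcc_insertStep_spec hH (w, 1)).2.1
  rw [mapAcc_insertStep_remainder hH hc] at h
  simpa [insertRow] using h

theorem orderMod_nonneg {H : Tableau d} (hH : IsEchelon H) (w : LinPoly d) :
    0 ≤ orderMod H w := by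
  obtain ⟨k, h1, h2, -⟩ := (mapAcc_insertStep_spec hH (w, 1)).2.2.2
  rw [orderMod, h2]
  simpa using h1

theorem smul_mem_rowSpan_iff {ord : Equiv.Perm (Fin d)} {H : Tableau d} (hH : IsEchelon H)
    (hc : H.map Prod.fst = columns ord) (w : LinPoly d) (t : ℤ) :
    t • w ∈ rowSpan H ↔ orderMod H w ∣ t := by
  obtain ⟨k, -, h2, h3⟩ := (mapAcc_insertStep_spec hH (w, 1)).2.2.2
  rw [orderMod, h2, h3 t]
  simp only [mapAcc_insertStep_remainder hH hc, smul_zero, and_true, one_mul]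
  exact exists_congr fun t' => by rw [mul_comm]

theorem mem_rowSpan_iff_orderMod {ord : Equiv.Perm (Fin d)} {H : Tableau d} (hH : IsEchelon H)
    (hc : H.map Prod.fst = columns ord) (w : LinPoly d) : w ∈ rowSpan H ↔ orderMod H w = 1 := by
  have h := smul_mem_rowSpan_iff hH hc w 1
  rw [one_smul] at h
  rw [h]
  exact ⟨fun h => Int.eq_one_of_dvd_one (orderMod_nonneg hH w) h, fun h => h ▸ dvd_rfl⟩

/-! ### Reduction of the rows -/

/-- Reduction of a polynomial by the rows of a tableau, from the first one to the last. -/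
def reduceBy (H : Tableau d) (f : LinPoly d) : LinPoly d :=
  H.foldl (fun f x => f - (entry x.1 f / entry x.1 x.2) • x.2) f

/-- Reduction of each row by all later ones. These are used unreduced, which makes no difference to
their pivots. -/
def reduceRows : Tableau d → Tableau d
  | [] => []
  | x :: H => (x.1, reduceBy H x.2) :: reduceRows H

/-- In each column with a non-zero pivot, the entries above the pivot are remainders modulo it. -/
def IsReduced : Tableau d → Prop
  | [] => True
  | x :: H => IsReduced H ∧ ∀ y ∈ H, entry y.1 y.2 ≠ 0 →
      0 ≤ entry y.1 x.2 ∧ entry y.1 x.2 < entry y.1 y.2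

theorem reduceBy_sub_mem (H : Tableau d) (f : LinPoly d) : reduceBy H f - f ∈ rowSpan H := by
  induction H generalizing f with
  | nil => simp [reduceBy]
  | cons x H ih =>
    have h := ih (f - (entry x.1 f / entry x.1 x.2) • x.2)
    refine mem_rowSpan_cons.2 ⟨-(entry x.1 f / entry x.1 x.2), ?_⟩
    convert h using 1
    simp only [reduceBy, List.foldl_cons]
    rw [neg_smul]
    abel

/-- Once a column is reduced it stays so, as the later rows vanish in it. -/
theorem reduceBy_spec {H : Tableau d} (hH : IsEchelon H) (f : LinPoly d) :
    ∀ y ∈ H, entry y.1 y.2 ≠ 0 →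
      0 ≤ entry y.1 (reduceBy H f) ∧ entry y.1 (reduceBy H f) < entry y.1 y.2 := by
  induction H generalizing f with
  | nil => simp
  | cons x H ih =>
    obtain ⟨hH, h0, hx, hz⟩ := hH
    intro y hy hy0
    have hcons : reduceBy (x :: H) f = reduceBy H (f - (entry x.1 f / entry x.1 x.2) • x.2) := rfl
    rw [hcons]
    rcases List.mem_cons.1 hy with rfl | hy
    · have h1 := entry_eq_zero_of_mem_rowSpan hz (reduceBy_sub_mem H
        (f - (entry y.1 f / entry y.1 y.2) • y.2))
      rw [map_sub, sub_eq_zero] at h1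
      have h2 : entry y.1 f - entry y.1 f / entry y.1 y.2 * entry y.1 y.2 =
          entry y.1 f % entry y.1 y.2 := by rw [Int.emod_def, mul_comm]
      rw [h1, map_sub, map_smul, smul_eq_mul, h2]
      exact ⟨Int.emod_nonneg _ hy0, Int.emod_lt_of_pos _ (lt_of_le_of_ne h0 hy0.symm)⟩
    · exact ih hH _ y hy hy0

theorem map_fst_reduceRows (H : Tableau d) : (reduceRows H).map Prod.fst = H.map Prod.fst := by
  induction H with
  | nil => rfl
  | cons x H ih => simp [reduceRows, ih]

theorem rowSpan_reduceRows (H : Tableau d) : rowSpan (reduceRows H) = rowSpan H := by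
  induction H with
  | nil => rfl
  | cons x H ih =>
    ext f
    simp only [reduceRows, mem_rowSpan_cons, ih]
    have h := reduceBy_sub_mem H x.2
    refine exists_congr fun t => ?_
    have e : f - t • x.2 = f - t • reduceBy H x.2 + t • (reduceBy H x.2 - x.2) := by
      rw [smul_sub]; abel
    rw [e, Submodule.add_mem_iff_left _ (Submodule.smul_mem _ t h)]

theorem reduceBy_zero (H : Tableau d) : reduceBy H 0 = 0 := by
  induction H with
  | nil => rfl
  | cons x H ih => simpa [reduceBy] using ih

/-- Reduction keeps the echelon form and the pivots. -/
theorem isEchelon_reduceRows {H : Tableau d} (hH : IsEchelon H) :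
    IsEchelon (reduceRows H) ∧ IsReduced (reduceRows H) ∧
      ∀ y ∈ reduceRows H, ∃ x ∈ H, x.1 = y.1 ∧ entry x.1 x.2 = entry x.1 y.2 := by
  induction H with
  | nil => simp [reduceRows, IsEchelon, IsReduced]
  | cons x H ih =>
    obtain ⟨hH, h0, hx, hz⟩ := hH
    obtain ⟨h1, h2, h3⟩ := ih hH
    have e : entry x.1 (reduceBy H x.2) = entry x.1 x.2 := by
      have h := entry_eq_zero_of_mem_rowSpan hz (reduceBy_sub_mem H x.2)
      rwa [map_sub, sub_eq_zero] at h
    refine ⟨⟨h1, e ▸ h0, fun h => ?_, fun y hy => ?_⟩, ⟨h2, fun y hy hy0 => ?_⟩, ?_⟩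
    · rw [hx (e ▸ h)]
      exact reduceBy_zero H
    · exact entry_eq_zero_of_mem_rowSpan hz ((rowSpan_reduceRows H) ▸ mem_rowSpan hy)
    · obtain ⟨z, hz, e1, e2⟩ := h3 y hy
      rw [← e1] at hy0 ⊢
      rw [← e2] at hy0 ⊢
      exact reduceBy_spec hH x.2 z hz hy0
    · intro y hy
      rcases List.mem_cons.1 hy with rfl | hy
      · exact ⟨x, List.mem_cons_self, rfl, e.symm⟩
      · obtain ⟨z, hz, h⟩ := h3 y hy
        exact ⟨z, List.mem_cons_of_mem _ hz, h⟩

/-! ### Lattices given by echelon tableaux -/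

theorem IsEchelon.drop {H : Tableau d} (hH : IsEchelon H) (n : ℕ) : IsEchelon (H.drop n) := by
  induction n generalizing H with
  | zero => simpa using hH
  | succ n ih =>
    cases H with
    | nil => simpa using hH
    | cons x H => simpa using ih hH.1

theorem IsEchelon.eq_zero {H : Tableau d} (hH : IsEchelon H) {x : Col d × LinPoly d}
    (hx : x ∈ H) (h0 : entry x.1 x.2 = 0) : x.2 = 0 := by
  induction H with
  | nil => simp at hx
  | cons y H ih =>
    rcases List.mem_cons.1 hx with rfl | hx
    · exact hH.2.2.1 h0
    · exact ih hH.1 hx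

theorem IsEchelon.entry_take_drop {H : Tableau d} (hH : IsEchelon H) {n : ℕ}
    {x y : Col d × LinPoly d} (hx : x ∈ H.take n) (hy : y ∈ H.drop n) : entry x.1 y.2 = 0 := by
  induction n generalizing H with
  | zero => simp at hx
  | succ n ih =>
    cases H with
    | nil => simp at hx
    | cons z H =>
      rw [List.take_succ_cons] at hx
      rw [List.drop_succ_cons] at hy
      rcases List.mem_cons.1 hx with rfl | hx
      · exact hH.2.2.2 y (List.mem_of_mem_drop hy)
      · exact ih hH.1 hx hy

/-- The members of the lattice of a cons that vanish in its first column. -/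
theorem IsEchelon.mem_of_entry_eq_zero {H : Tableau d} {x : Col d × LinPoly d}
    (hH : IsEchelon (x :: H)) {f : LinPoly d} (hf : f ∈ rowSpan (x :: H)) (h0 : entry x.1 f = 0) :
    f ∈ rowSpan H := by
  obtain ⟨t, ht⟩ := mem_rowSpan_cons.1 hf
  have h1 := entry_eq_zero_of_mem_rowSpan hH.2.2.2 ht
  rw [map_sub, h0, zero_sub, neg_eq_zero, map_smul, smul_eq_mul, mul_eq_zero] at h1
  rcases h1 with rfl | h1
  · simpa using ht
  · simpa [hH.2.2.1 h1] using ht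

/-- The members of the lattice that vanish in the first columns are generated by the later rows. -/
theorem IsEchelon.mem_rowSpan_drop {H : Tableau d} (hH : IsEchelon H) (n : ℕ) {f : LinPoly d}
    (hf : f ∈ rowSpan H) (h0 : ∀ x ∈ H.take n, entry x.1 f = 0) : f ∈ rowSpan (H.drop n) := by
  induction n generalizing H with
  | zero => simpa using hf
  | succ n ih =>
    cases H with
    | nil => simpa using hf
    | cons z H =>
      rw [List.take_succ_cons] at h0
      exact ih hH.1 (hH.mem_of_entry_eq_zero hf (h0 z List.mem_cons_self))
        fun x hx => h0 x (List.mem_cons_of_mem _ hx)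

/-- The rows with a non-zero pivot. -/
def pivotRows (H : Tableau d) : Set (LinPoly d) := {g | ∃ x ∈ H, entry x.1 x.2 ≠ 0 ∧ x.2 = g}

theorem span_pivotRows {H : Tableau d} (hH : IsEchelon H) :
    Submodule.span ℤ (pivotRows H) = rowSpan H := by
  refine le_antisymm (Submodule.span_le.2 ?_) (rowSpan_le.2 fun x hx => ?_)
  · rintro g ⟨x, hx, -, rfl⟩
    exact mem_rowSpan hx
  · by_cases h0 : entry x.1 x.2 = 0
    · rw [hH.eq_zero hx h0]
      exact zero_mem _
    · exact Submodule.subset_span ⟨x, hx, h0, rfl⟩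

theorem linearIndepOn_pivotRows {H : Tableau d} (hH : IsEchelon H) :
    LinearIndepOn ℤ id (pivotRows H) := by
  induction H with
  | nil =>
    have : pivotRows ([] : Tableau d) = ∅ := by simp [pivotRows]
    rw [this]
    exact linearIndepOn_empty _ _
  | cons x H ih =>
    by_cases h0 : entry x.1 x.2 = 0
    · have : pivotRows (x :: H) = pivotRows H := by
        ext g
        simp [pivotRows, h0]
      rw [this]
      exact ih hH.1
    · have : pivotRows (x :: H) = {x.2} ∪ pivotRows H := by
        ext g
        simp [pivotRows, h0, @eq_comm _ x.2 g]
      rw [this]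
      have hx : x.2 ≠ 0 := by
        intro h
        rw [h, map_zero] at h0
        exact h0 rfl
      refine LinearIndepOn.id_union (LinearIndepOn.singleton hx) (ih hH.1) ?_
      rw [span_pivotRows hH.1, Submodule.disjoint_def]
      intro f hf hf'
      obtain ⟨t, rfl⟩ := Submodule.mem_span_singleton.1 hf
      have h := entry_eq_zero_of_mem_rowSpan hH.2.2.2 hf'
      rw [map_smul, smul_eq_mul, mul_eq_zero] at h
      rw [h.resolve_right h0, zero_smul]

/-! ### The number of steps in an ascending chain of lattices -/

/-- Decreases when the lattice grows, provided that all pivots stay below `2 ^ (Λ + 1)`. -/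
def potential (Λ : ℕ) (H : Tableau d) : ℕ :=
  (H.map fun x => if entry x.1 x.2 = 0 then Λ + 1 else Nat.log 2 (entry x.1 x.2).natAbs).sum

theorem potential_le (Λ : ℕ) (H : Tableau d)
    (h : ∀ x ∈ H, Nat.log 2 (entry x.1 x.2).natAbs ≤ Λ) :
    potential Λ H ≤ H.length * (Λ + 1) := by
  refine (List.sum_le_card_nsmul _ (Λ + 1) ?_).trans (by simp)
  intro n hn
  obtain ⟨x, hx, rfl⟩ := List.mem_map.1 hn
  have := h x hx
  split_ifs <;> omega

theorem log_two_lt_of_dvd {a b : ℕ} (h : a ∣ b) (hb : b ≠ 0) (hne : a ≠ b) :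
    Nat.log 2 a < Nat.log 2 b := by
  obtain ⟨k, rfl⟩ := h
  have ha : a ≠ 0 := by
    rintro rfl
    simp at hb
  have hk : 2 ≤ k := by
    rcases k with _ | _ | k
    · simp at hb
    · simp at hne
    · omega
  calc Nat.log 2 a < Nat.log 2 (a * 2) := by
        rw [Nat.log_mul_base one_lt_two ha]
        omega
    _ ≤ Nat.log 2 (a * k) := Nat.log_mono_right (Nat.mul_le_mul_left a hk)

/-- The pivot columns of the smaller lattice are pivot columns of the larger one, where the pivots
are divisors; if nothing changes in the pivots, then the lattices agree. -/
theorem potential_anti {Λ : ℕ} {H H' : Tableau d} (hH : IsEchelon H) (hH' : IsEchelon H')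
    (hc : H.map Prod.fst = H'.map Prod.fst) (hle : rowSpan H ≤ rowSpan H')
    (hΛ : ∀ x ∈ H', Nat.log 2 (entry x.1 x.2).natAbs ≤ Λ) :
    potential Λ H' ≤ potential Λ H ∧
      (rowSpan H' ≤ rowSpan H ∨ potential Λ H' < potential Λ H) := by
  induction H generalizing H' with
  | nil =>
    cases H' with
    | nil => exact ⟨le_rfl, .inl le_rfl⟩
    | cons x H' => simp at hc
  | cons x H ih =>
    cases H' with
    | nil => simp at hc
    | cons x' H' =>
      simp only [List.map_cons, List.cons.injEq] at hc
      obtain ⟨hc0, hc⟩ := hc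
      have hxm := hle (mem_rowSpan (List.mem_cons_self (a := x) (l := H)))
      obtain ⟨t, ht⟩ := mem_rowSpan_cons.1 hxm
      have he := entry_eq_zero_of_mem_rowSpan hH'.2.2.2 ht
      rw [map_sub, sub_eq_zero, map_smul, smul_eq_mul, ← hc0] at he
      have hle' : rowSpan H ≤ rowSpan H' := by
        intro f hf
        refine hH'.mem_of_entry_eq_zero (hle ?_) ?_
        · exact Submodule.mem_sup_right hf
        · rw [← hc0]
          exact entry_eq_zero_of_mem_rowSpan hH.2.2.2 hf
      obtain ⟨h1, h2⟩ := ih hH.1 hH'.1 hc hle' fun y hy => hΛ y (List.mem_cons_of_mem _ hy)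
      have hΛ' := hΛ x' List.mem_cons_self
      have n0 := hH.2.1
      have n1 := hH'.2.1
      rw [← hc0] at n1 hΛ'
      simp only [potential, List.map_cons, List.sum_cons] at h1 h2 ⊢
      rw [← hc0]
      by_cases a0 : entry x.1 x.2 = 0
      · rw [if_pos a0]
        by_cases a1 : entry x.1 x'.2 = 0
        · rw [if_pos a1]
          refine ⟨by omega, h2.imp (fun h2 => ?_) fun h2 => by omega⟩
          have e0 := hH.2.2.1 a0
          have e1 := hH'.2.2.1 (hc0 ▸ a1)
          simpa [rowSpan, e0, e1] using h2
        · rw [if_neg a1]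
          exact ⟨by omega, .inr (by omega)⟩
      · have a1 : entry x.1 x'.2 ≠ 0 := by
          intro a1
          rw [a1, mul_zero] at he
          exact a0 he
        rw [if_neg a0, if_neg a1]
        have hdvd : (entry x.1 x'.2).natAbs ∣ (entry x.1 x.2).natAbs :=
          Int.natAbs_dvd_natAbs.2 ⟨t, by rw [he, mul_comm]⟩
        by_cases hne : (entry x.1 x'.2).natAbs = (entry x.1 x.2).natAbs
        · rw [hne]
          refine ⟨by omega, h2.imp (fun h2 => ?_) fun h2 => by omega⟩
          have ht1 : t = 1 := by
            have : entry x.1 x'.2 = entry x.1 x.2 := by omega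
            rw [this] at he
            exact (mul_right_cancel₀ a0 (by rw [one_mul, ← he]))
          rw [ht1, one_smul] at ht
          refine sup_le ?_ (h2.trans le_sup_right)
          rw [Submodule.span_singleton_le_iff_mem]
          refine mem_rowSpan_cons.2 ⟨1, ?_⟩
          rw [one_smul, ← neg_sub]
          exact neg_mem (h2 ht)
        · have := log_two_lt_of_dvd hdvd (by simpa using a0) hne
          exact ⟨by omega, .inr (by omega)⟩

/-! ### Cramer's rule on the pivot columns -/

theorem polyNorm_le_iff {f : LinPoly d} {B : ℕ} :
    polyNorm f ≤ B ↔ ∀ i, (entry i f).natAbs ≤ B := by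
  simp only [polyNorm, max_le_iff, Finset.sup_le_iff, Finset.mem_univ, true_imp_iff]
  exact ⟨fun h i => by cases i; exacts [h.2, h.1 _], fun h => ⟨fun i => h (some i), h none⟩⟩

theorem natAbs_entry_le (i : Col d) (f : LinPoly d) : (entry i f).natAbs ≤ polyNorm f :=
  polyNorm_le_iff.1 le_rfl i

theorem natAbs_det_le {n : Type} [Fintype n] [DecidableEq n] {A : Matrix n n ℤ} {B : ℕ}
    (h : ∀ i j, (A i j).natAbs ≤ B) :
    A.det.natAbs ≤ (Fintype.card n).factorial * B ^ Fintype.card n := by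
  have h1 := Matrix.det_le (A := A) (abv := AbsoluteValue.abs) (x := (B : ℤ)) fun i j => by
    rw [AbsoluteValue.abs_apply, Int.abs_eq_natAbs]
    exact_mod_cast h i j
  rw [AbsoluteValue.abs_apply, Int.abs_eq_natAbs, nsmul_eq_mul] at h1
  exact_mod_cast h1

/-- A member of the lattice is determined by its entries in the pivot columns. -/
theorem IsEchelon.eq_zero_of_pivots {H : Tableau d} (hH : IsEchelon H) {f : LinPoly d}
    (hf : f ∈ rowSpan H) (h0 : ∀ x ∈ H, entry x.1 x.2 ≠ 0 → entry x.1 f = 0) : f = 0 := by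
  induction H with
  | nil => simpa [rowSpan] using hf
  | cons x H ih =>
    refine ih hH.1 ?_ fun y hy => h0 y (List.mem_cons_of_mem _ hy)
    by_cases hx : entry x.1 x.2 = 0
    · simpa [rowSpan, hH.2.2.1 hx] using hf
    · exact hH.mem_of_entry_eq_zero hf (h0 x List.mem_cons_self hx)

/-- The columns with a non-zero pivot. -/
def IsPivot (H : Tableau d) (i : Col d) : Prop := ∃ x ∈ H, x.1 = i ∧ entry x.1 x.2 ≠ 0

/-- The lattice has full rank in the pivot columns. -/
theorem IsEchelon.functional_eq_zero {H : Tableau d} (hH : IsEchelon H) (c : Col d → ℚ)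
    (hc : ∀ i, c i ≠ 0 → IsPivot H i)
    (h0 : ∀ f ∈ rowSpan H, ∑ i, c i * (entry i f : ℚ) = 0) : c = 0 := by
  induction H generalizing c with
  | nil =>
    funext i
    by_contra hi
    obtain ⟨x, hx, -⟩ := hc i hi
    simp at hx
  | cons x H ih =>
    have h1 : Function.update c x.1 0 = 0 := by
      refine ih hH.1 _ (fun i hi => ?_) fun f hf => ?_
      · have hne : i ≠ x.1 := by
          rintro rfl
          simp at hi
        rw [Function.update_of_ne hne] at hi
        obtain ⟨y, hy, rfl, hy0⟩ := hc i hi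
        rcases List.mem_cons.1 hy with rfl | hy
        · exact absurd rfl hne
        · exact ⟨y, hy, rfl, hy0⟩
      · rw [← h0 f (Submodule.mem_sup_right hf)]
        refine Finset.sum_congr rfl fun i _ => ?_
        by_cases hi : i = x.1
        · rw [hi, entry_eq_zero_of_mem_rowSpan hH.2.2.2 hf]
          simp
        · rw [Function.update_of_ne hi]
    have h2 : ∀ i, i ≠ x.1 → c i = 0 := fun i hi => by
      rw [← Function.update_of_ne hi 0 c, h1]
      rfl
    funext i
    by_cases hi : i = x.1
    · by_contra hci
      obtain ⟨y, hy, hyi, hy0⟩ := hc i hci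
      have h3 := h0 x.2 (mem_rowSpan List.mem_cons_self)
      rw [Finset.sum_eq_single x.1 (fun j _ hj => by rw [h2 j hj, zero_mul]) (by simp), ← hi]
        at h3
      rcases List.mem_cons.1 hy with rfl | hy
      · rw [hyi] at hy0
        simp only [mul_eq_zero, Int.cast_eq_zero] at h3
        rcases h3 with h3 | h3
        · exact hci h3
        · exact hy0 h3
      · rw [hyi, hi] at hy0
        exact hy0 (hH.2.2.2 y hy)
    · exact h2 i hi

/-- Cramer's rule: up to the common denominator `Δ`, the entries in the pivot columns can be
prescribed, by a combination of the generators with bounded coefficients. -/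
theorem exists_cramer {H : Tableau d} (hH : IsEchelon H) {ι : Type} [Fintype ι]
    {a : ι → LinPoly d} (ha : rowSpan H = Submodule.span ℤ (Set.range a)) {B : ℕ}
    (hB : ∀ k, polyNorm (a k) ≤ B) :
    ∃ r ≤ Fintype.card ι, r ≤ d + 1 ∧ ∃ Δ : ℕ, 0 < Δ ∧ Δ ≤ r.factorial * B ^ r ∧
      ∀ (b : Col d → ℤ) (B' : ℕ), (∀ i, IsPivot H i → (b i).natAbs ≤ B') →
        ∃ w ∈ rowSpan H, (∀ i, IsPivot H i → entry i w = Δ * b i) ∧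
          polyNorm w ≤ r * (r.factorial * (max B B') ^ r * B) := by
  classical
  let P := {i : Col d // IsPivot H i}
  let row : ι → P → ℚ := fun k i => (entry i.1 (a k) : ℚ)
  -- the generators, restricted to the pivot columns, have full column rank
  have hspan : Submodule.span ℚ (Set.range row) = ⊤ := by
    by_contra hne
    obtain ⟨φ, hφ0, hφ⟩ := Submodule.exists_le_ker_of_lt_top _ (lt_top_iff_ne_top.2 hne)
    refine hφ0 ?_
    let c : Col d → ℚ := fun i => if h : IsPivot H i then φ (Pi.single ⟨i, h⟩ 1) else 0
    have hφc : ∀ v : P → ℚ, φ v = ∑ i : P, c i.1 * v i := by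
      intro v
      conv_lhs => rw [← Finset.univ_sum_single v]
      rw [map_sum]
      refine Finset.sum_congr rfl fun i _ => ?_
      have : Pi.single i (v i) = v i • (Pi.single i 1 : P → ℚ) := by
        rw [← Pi.single_smul, smul_eq_mul, mul_one]
      rw [this, map_smul, smul_eq_mul, mul_comm]
      simp only [c, dif_pos i.2]
      rfl
    have hsum : ∀ f : LinPoly d, ∑ i, c i * (entry i f : ℚ) =
        ∑ i : P, c i.1 * (entry i.1 f : ℚ) := by
      intro f
      rw [← Finset.sum_subtype (Finset.univ.filter (IsPivot H)) (by simp)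
        (fun i => c i * (entry i f : ℚ))]
      refine (Finset.sum_filter_of_ne fun i _ hi => ?_).symm
      by_contra h
      have h0 : c i = 0 := dif_neg h
      exact hi (by rw [h0, zero_mul])
    have hc : c = 0 := by
      refine hH.functional_eq_zero c (fun i hi => ?_) fun f hf => ?_
      · by_contra h
        exact hi (dif_neg h)
      · rw [ha] at hf
        induction hf using Submodule.span_induction with
        | mem f hf =>
          obtain ⟨k, rfl⟩ := hf
          rw [hsum]
          have := hφ (Submodule.subset_span ⟨k, rfl⟩)
          rw [LinearMap.mem_ker, hφc] at this
          exact this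
        | zero => simp
        | add f g _ _ h1 h2 => simp only [map_add, Int.cast_add, mul_add, Finset.sum_add_distrib,
            h1, h2, add_zero]
        | smul t f _ h =>
          simp only [map_smul, smul_eq_mul, Int.cast_mul, mul_left_comm _ (t : ℚ),
            ← Finset.mul_sum, h, mul_zero]
    ext i
    simp [hφc, hc]
  -- so some of them form an invertible square matrix there, to which Cramer's rule applies
  obtain ⟨b, hbs, hbspan, hli⟩ := exists_linearIndependent ℚ (Set.range row)
  have : Fintype b := hli.setFinite.fintype
  have hcard : Fintype.card P = Fintype.card b := by
    rw [← Module.finrank_eq_card_basis (Module.Basis.mk hli (by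
      rw [Subtype.range_coe_subtype, Set.ofPred_mem_eq, hbspan, hspan])), Module.finrank_fintype_fun_eq_card]
  let σ : P ≃ b := Fintype.equivOfCardEq hcard
  choose sel hsel using fun v : b => hbs v.2
  have hselinj : Function.Injective sel := fun v v' h => Subtype.ext (by rw [← hsel, ← hsel, h])
  let A : Matrix P P ℤ := fun p q => entry q.1 (a (sel (σ p)))
  have hA : A.det ≠ 0 := by
    have h1 : LinearIndependent ℚ (A.map fun x : ℤ => (x : ℚ)).row := by
      have h2 := hli.comp σ σ.injective
      have h3 : (A.map fun x : ℤ => (x : ℚ)).row = Subtype.val ∘ σ :=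
        funext fun p => hsel (σ p)
      rw [h3]
      exact h2
    have h2 := ((Matrix.isUnit_iff_isUnit_det _).1
      (Matrix.linearIndependent_rows_iff_isUnit.1 h1)).ne_zero
    rw [← Int.cast_det] at h2
    exact_mod_cast h2
  have hAB : ∀ p q, (A p q).natAbs ≤ B := fun p q => (natAbs_entry_le _ _).trans (hB _)
  refine ⟨Fintype.card P, ?_, ?_, A.det.natAbs, Int.natAbs_pos.2 hA, natAbs_det_le hAB, ?_⟩
  · rw [hcard]
    exact Fintype.card_le_of_injective sel hselinj
  · exact (Fintype.card_subtype_le _).trans (by simp)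
  · intro c B' hc
    let y : P → ℤ := A.transpose.cramer fun i => c i.1
    have hy : ∀ p, (y p).natAbs ≤ (Fintype.card P).factorial * (max B B') ^ Fintype.card P := by
      intro p
      simp only [y, Matrix.cramer_apply]
      refine natAbs_det_le fun i j => ?_
      rw [Matrix.updateCol_apply]
      split_ifs
      · exact (hc i.1 i.2).trans (le_max_right _ _)
      · exact (hAB j i).trans (le_max_left _ _)
    have hdet : ∀ q : P, ∑ p, A p q * y p = A.det * c q.1 := by
      intro q
      have h1 := congrFun (Matrix.mulVec_cramer A.transpose fun i : P => c i.1) q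
      rw [Matrix.det_transpose] at h1
      exact h1
    refine ⟨A.det.sign • ∑ p, y p • a (sel (σ p)), ?_, fun i hi => ?_, ?_⟩
    · rw [ha]
      exact Submodule.smul_mem _ _ (Submodule.sum_mem _ fun p _ =>
        Submodule.smul_mem _ _ (Submodule.subset_span ⟨_, rfl⟩))
    · have h1 := hdet ⟨i, hi⟩
      rw [map_smul, map_sum, smul_eq_mul, ← Int.sign_mul_self_eq_natAbs, mul_assoc, ← h1]
      congr 1
      refine Finset.sum_congr rfl fun p _ => ?_
      rw [map_smul, smul_eq_mul, mul_comm]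
    · rw [polyNorm_le_iff]
      intro i
      rw [map_smul, map_sum, smul_eq_mul, Int.natAbs_mul, Int.natAbs_sign_of_ne_zero hA, one_mul]
      refine (Int.natAbs_sum_le _ _).trans ?_
      refine (Finset.sum_le_card_nsmul _ _ _ fun p _ => ?_).trans (by
        rw [Finset.card_univ, smul_eq_mul])
      rw [map_smul, smul_eq_mul, Int.natAbs_mul]
      exact Nat.mul_le_mul (hy p) ((natAbs_entry_le _ _).trans (hB _))

/-! ### The size of a reduced echelon basis -/

/-- The pivot in a column divides the entry of every member of the lattice that vanishes in all other
pivot columns. -/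
theorem IsEchelon.pivot_dvd {H : Tableau d} (hH : IsEchelon H) {f : LinPoly d}
    (hf : f ∈ rowSpan H) {x : Col d × LinPoly d} (hx : x ∈ H) (hx0 : entry x.1 x.2 ≠ 0)
    (h0 : ∀ i, IsPivot H i → i ≠ x.1 → entry i f = 0) : entry x.1 x.2 ∣ entry x.1 f := by
  induction H with
  | nil => simp at hx
  | cons y H ih =>
    rcases List.mem_cons.1 hx with rfl | hx
    · obtain ⟨t, ht⟩ := mem_rowSpan_cons.1 hf
      have h := entry_eq_zero_of_mem_rowSpan hH.2.2.2 ht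
      rw [map_sub, sub_eq_zero, map_smul, smul_eq_mul] at h
      exact ⟨t, by rw [h, mul_comm]⟩
    · refine ih hH.1 ?_ hx fun i ⟨z, hz, hzi, hz0⟩ hi =>
        h0 i ⟨z, List.mem_cons_of_mem _ hz, hzi, hz0⟩ hi
      by_cases hy : entry y.1 y.2 = 0
      · simpa [rowSpan, hH.2.2.1 hy] using hf
      · refine hH.mem_of_entry_eq_zero hf (h0 y.1 ⟨y, List.mem_cons_self, rfl, hy⟩ ?_)
        intro h
        rw [← h] at hx0
        exact hx0 (hH.2.2.2 x hx)

theorem IsReduced.natAbs_entry_le {H : Tableau d} (hR : IsReduced H) (hH : IsEchelon H)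
    {x y : Col d × LinPoly d} (hx : x ∈ H) (hy : y ∈ H) (hy0 : entry y.1 y.2 ≠ 0) :
    (entry y.1 x.2).natAbs ≤ (entry y.1 y.2).natAbs := by
  induction H with
  | nil => simp at hx
  | cons z H ih =>
    rcases List.mem_cons.1 hx with rfl | hx' <;> rcases List.mem_cons.1 hy with rfl | hy'
    · exact le_rfl
    · have := hR.2 y hy' hy0
      omega
    · rw [hH.2.2.2 x hx']
      simp
    · exact ih hR.1 hH.1 hx' hy'

/-- The rows of a reduced tableau are bounded in terms of arbitrary generators of its lattice: the
pivots divide the common denominator of Cramer's rule and bound the other entries in the pivot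
columns, and these entries determine the row. -/
theorem polyNorm_le_of_isReduced {H : Tableau d} (hH : IsEchelon H) (hR : IsReduced H)
    {ι : Type} [Fintype ι] {a : ι → LinPoly d}
    (ha : rowSpan H = Submodule.span ℤ (Set.range a)) {B T : ℕ} (hB : ∀ k, polyNorm (a k) ≤ B)
    (hB1 : 1 ≤ B) (hT : Fintype.card ι ≤ T) {x : Col d × LinPoly d} (hx : x ∈ H) :
    polyNorm x.2 ≤ (T * B) ^ (1 + Fintype.card ι + Fintype.card ι ^ 2) := by
  obtain ⟨r, hr, -, Δ, hΔ, hΔle, hC⟩ := exists_cramer hH ha hB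
  have hpiv : ∀ y ∈ H, entry y.1 y.2 ≠ 0 → (entry y.1 y.2).natAbs ≤ Δ := by
    intro y hy hy0
    obtain ⟨w, hw, hwe, -⟩ := hC (Pi.single y.1 1) 1 fun i _ => by
      by_cases hi : i = y.1
      · subst hi; simp
      · simp [hi]
    have h1 := hH.pivot_dvd hw hy hy0 fun i hi hne => by rw [hwe i hi]; simp [hne]
    rw [hwe y.1 ⟨y, hy, rfl, hy0⟩, Pi.single_eq_same, mul_one] at h1
    exact Nat.le_of_dvd hΔ (by simpa using Int.natAbs_dvd_natAbs.2 h1)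
  obtain ⟨w, hw, hwe, hwn⟩ := hC (fun i => entry i x.2) Δ fun i ⟨y, hy, hyi, hy0⟩ => by
    rw [← hyi]
    exact (hR.natAbs_entry_le hH hx hy hy0).trans (hpiv y hy hy0)
  have hwx : w = (Δ : ℤ) • x.2 := by
    rw [← sub_eq_zero]
    refine hH.eq_zero_of_pivots (sub_mem hw (Submodule.smul_mem _ _ (mem_rowSpan hx)))
      fun y hy hy0 => ?_
    rw [map_sub, hwe y.1 ⟨y, hy, rfl, hy0⟩, map_smul, smul_eq_mul, sub_self]
  have h1 : polyNorm x.2 ≤ polyNorm w := by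
    rw [polyNorm_le_iff]
    intro i
    refine le_trans ?_ (natAbs_entry_le i w)
    rw [hwx, map_smul, smul_eq_mul, Int.natAbs_mul, Int.natAbs_natCast]
    exact Nat.le_mul_of_pos_left _ hΔ
  refine h1.trans (hwn.trans ?_)
  rcases Nat.eq_zero_or_pos r with rfl | hr0
  · simp
  have hT1 : 1 ≤ T := (Nat.succ_le_of_lt hr0).trans (hr.trans hT)
  have hTB : 1 ≤ T * B := Nat.mul_pos hT1 hB1
  have hfac : r.factorial ≤ T ^ r :=
    (Nat.factorial_le_pow r).trans (Nat.pow_le_pow_left (hr.trans hT) r)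
  have hΔ2 : Δ ≤ (T * B) ^ r := by
    rw [mul_pow]
    exact hΔle.trans (Nat.mul_le_mul_right _ hfac)
  have hBle : B ≤ (T * B) ^ r :=
    (Nat.le_mul_of_pos_left B hT1).trans (Nat.le_self_pow hr0.ne' _)
  calc r * (r.factorial * max B Δ ^ r * B)
      ≤ T * ((T * B) ^ r * ((T * B) ^ r) ^ r * B) := by
        refine Nat.mul_le_mul (hr.trans hT) (Nat.mul_le_mul_right _ (Nat.mul_le_mul ?_
          (Nat.pow_le_pow_left (max_le hBle hΔ2) r)))
        exact hfac.trans (Nat.pow_le_pow_left (Nat.le_mul_of_pos_right T hB1) r)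
    _ = (T * B) ^ (1 + r + r ^ 2) := by
        rw [← pow_mul, pow_add, pow_add, pow_one, sq]
        ring
    _ ≤ _ := by
        refine Nat.pow_le_pow_right hTB ?_
        have := Nat.pow_le_pow_left hr 2
        omega

/-! ### Multiples that lie in a lattice -/

theorem isEchelon_zero (l : List (Col d)) :
    IsEchelon (l.map fun i => (i, (0 : LinPoly d))) ∧
      rowSpan (l.map fun i => (i, (0 : LinPoly d))) = ⊥ := by
  induction l with
  | nil => exact ⟨trivial, rfl⟩
  | cons i l ih =>
    refine ⟨⟨ih.1, by simp, by simp, by simp⟩, ?_⟩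
    simp only [List.map_cons, rowSpan, ih.2, Submodule.span_zero_singleton, bot_sup_eq]

theorem exists_isEchelon (ord : Equiv.Perm (Fin d)) {S : Set (LinPoly d)} (hS : S.Finite) :
    ∃ H : Tableau d, IsEchelon H ∧ H.map Prod.fst = columns ord ∧
      rowSpan H = Submodule.span ℤ S := by
  induction S, hS using Set.Finite.induction_on with
  | empty =>
    refine ⟨_, (isEchelon_zero (columns ord)).1, by simp [Function.comp_def], ?_⟩
    rw [(isEchelon_zero (columns ord)).2, Submodule.span_empty]
  | @insert f S _ _ ih =>
    obtain ⟨H, h1, h2, h3⟩ := ih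
    refine ⟨insertRow H f, isEchelon_insertRow h1 f, (map_fst_insertRow H f).trans h2, ?_⟩
    rw [rowSpan_insertRow h1 h2, h3, Submodule.span_insert, sup_comm]

/-- If some non-zero multiple of `g` lies in the lattice, then so does a small one. -/
theorem exists_small_multiple {ι : Type} [Fintype ι] {a : ι → LinPoly d} {B T : ℕ}
    (hB : ∀ k, polyNorm (a k) ≤ B) (hB1 : 1 ≤ B) (hT : Fintype.card ι ≤ T) (hT1 : 1 ≤ T)
    {g : LinPoly d} {t : ℤ} (ht : t ≠ 0) (hg : t • g ∈ Submodule.span ℤ (Set.range a)) :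
    ∃ Δ : ℕ, 0 < Δ ∧ Δ ≤ (T * B) ^ (d + 1) ∧
      (Δ : ℤ) • g ∈ Submodule.span ℤ (Set.range a) := by
  obtain ⟨H, hH, -, hspan⟩ := exists_isEchelon (1 : Equiv.Perm (Fin d)) (Set.finite_range a)
  obtain ⟨r, hr, hrd, Δ, hΔ, hΔle, hC⟩ := exists_cramer hH hspan hB
  refine ⟨Δ, hΔ, hΔle.trans ?_, ?_⟩
  · calc r.factorial * B ^ r ≤ T ^ r * B ^ r := Nat.mul_le_mul_right _
          ((Nat.factorial_le_pow r).trans (Nat.pow_le_pow_left (hr.trans hT) r))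
      _ = (T * B) ^ r := (mul_pow _ _ _).symm
      _ ≤ _ := Nat.pow_le_pow_right (Nat.mul_pos hT1 hB1) hrd
  · obtain ⟨w, hw, hwe, -⟩ := hC (fun i => entry i g) (polyNorm g) fun i _ => natAbs_entry_le i g
    rw [← hspan] at hg ⊢
    have h0 : t • (w - (Δ : ℤ) • g) = 0 := by
      refine hH.eq_zero_of_pivots ?_ fun y hy hy0 => ?_
      · rw [smul_sub, smul_comm]
        exact sub_mem (Submodule.smul_mem _ _ hw) (Submodule.smul_mem _ _ hg)
      · rw [map_smul, map_sub, hwe y.1 ⟨y, hy, rfl, hy0⟩, map_smul, smul_eq_mul, smul_eq_mul,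
          sub_self, mul_zero]
    rw [smul_eq_zero_iff_right ht, sub_eq_zero] at h0
    rwa [← h0]

/-! ### The lattices between `ℤ f` and the divisibility module -/

/-- The number in which the norm bounds are expressed. It bounds the norms of `Φ` as well as the
number `m + 1` of generators of the lattices. -/
def sizeBase (Φ : DivSystem d) : ℕ := Φ.length + sysNorm Φ + 2

/-- The lattice is generated by `f` and by multiples of the right-hand sides. The factors `v i` that
are not zero divide the product of the numbers `β i`, where `β i` is the cost of making `v i`
non-zero. Later changes of `v i` only replace it by a divisor, so the product stays bounded. -/
def IsTame (Φ : DivSystem d) (f : LinPoly d) (L : Submodule ℤ (LinPoly d)) : Prop :=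
  ∃ (v : Fin Φ.length → ℤ) (β : Fin Φ.length → ℕ),
    (∀ i, 0 < β i ∧ β i ≤ sizeBase Φ ^ (2 * (d + 1))) ∧ (∀ i, v i = 0 → β i = 1) ∧
    (∀ i, v i ≠ 0 → v i ∣ ((∏ j, β j : ℕ) : ℤ)) ∧
    L = Submodule.span ℤ (Set.range fun o : Option (Fin Φ.length) =>
      o.elim f fun i => v i • (Φ.get i).rhs)

theorem le_foldr_max {l : List ℕ} {n : ℕ} (h : n ∈ l) : n ≤ l.foldr max 0 := by
  induction l with
  | nil => simp at h
  | cons a l ih =>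
    rcases List.mem_cons.1 h with rfl | h
    · exact le_max_left _ _
    · exact (ih h).trans (le_max_right _ _)

theorem foldr_max_le {l : List ℕ} {B : ℕ} (h : ∀ n ∈ l, n ≤ B) : l.foldr max 0 ≤ B := by
  induction l with
  | nil => simp
  | cons a l ih =>
    exact max_le (h a List.mem_cons_self) (ih fun n hn => h n (List.mem_cons_of_mem _ hn))

theorem polyNorm_le_sysNorm {Φ : DivSystem d} {c : DivConstraint d} (hc : c ∈ Φ) :
    polyNorm c.lhs ≤ sysNorm Φ ∧ polyNorm c.rhs ≤ sysNorm Φ :=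
  max_le_iff.1 (le_foldr_max (List.mem_map.2 ⟨c, hc, rfl⟩))

theorem sysNorm_le {Φ : DivSystem d} {B : ℕ}
    (h : ∀ c ∈ Φ, polyNorm c.lhs ≤ B ∧ polyNorm c.rhs ≤ B) : sysNorm Φ ≤ B := by
  refine foldr_max_le fun n hn => ?_
  obtain ⟨c, hc, rfl⟩ := List.mem_map.1 hn
  exact max_le (h c hc).1 (h c hc).2

theorem polyNorm_smul (t : ℤ) (f : LinPoly d) : polyNorm (t • f) ≤ t.natAbs * polyNorm f := by
  rw [polyNorm_le_iff]
  intro i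
  rw [map_smul, smul_eq_mul, Int.natAbs_mul]
  exact Nat.mul_le_mul_left _ (natAbs_entry_le i f)

theorem isTame_span_singleton (Φ : DivSystem d) (f : LinPoly d) :
    IsTame Φ f (Submodule.span ℤ {f}) := by
  refine ⟨0, 1, fun i => ⟨one_pos, Nat.one_le_pow _ _ (by simp [sizeBase])⟩, by simp, by simp, ?_⟩
  refine le_antisymm ((Submodule.span_singleton_le_iff_mem _ _).2
    (Submodule.subset_span ⟨none, rfl⟩)) (Submodule.span_le.2 ?_)
  rintro _ ⟨_ | i, rfl⟩
  · exact Submodule.mem_span_singleton_self f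
  · simp

theorem IsTame.mem {Φ : DivSystem d} {f : LinPoly d} {L : Submodule ℤ (LinPoly d)}
    (h : IsTame Φ f L) : f ∈ L := by
  obtain ⟨v, β, -, -, -, rfl⟩ := h
  exact Submodule.subset_span ⟨none, rfl⟩

/-- Bounded generators of the lattice. -/
theorem IsTame.exists_generators {Φ : DivSystem d} {f : LinPoly d}
    {L : Submodule ℤ (LinPoly d)} (h : IsTame Φ f L) (hf : polyNorm f ≤ sysNorm Φ) :
    ∃ a : Option (Fin Φ.length) → LinPoly d, L = Submodule.span ℤ (Set.range a) ∧
      ∀ k, polyNorm (a k) ≤ sizeBase Φ ^ (2 * (d + 1) * Φ.length + 1) := by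
  obtain ⟨v, β, h1, -, h3, rfl⟩ := h
  refine ⟨_, rfl, ?_⟩
  have hT : sysNorm Φ ≤ sizeBase Φ := by simp only [sizeBase]; omega
  have hT1 : 0 < sizeBase Φ := by simp only [sizeBase]; omega
  have hβ : ∏ j, β j ≤ sizeBase Φ ^ (2 * (d + 1) * Φ.length) := by
    rw [pow_mul]
    refine (Finset.prod_le_pow_card _ _ _ fun j _ => (h1 j).2).trans ?_
    rw [Finset.card_univ, Fintype.card_fin]
  rintro (_ | i)
  · exact hf.trans (hT.trans (Nat.le_self_pow (by omega) _))
  · refine (polyNorm_smul _ _).trans ?_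
    rw [pow_succ]
    refine Nat.mul_le_mul ?_ ((polyNorm_le_sysNorm (List.get_mem Φ i)).2.trans hT)
    by_cases hv : v i = 0
    · simp [hv]
    · refine le_trans (Nat.le_of_dvd (Finset.prod_pos fun j _ => (h1 j).1) ?_) hβ
      exact Int.natAbs_dvd_natAbs.2 (h3 i hv)

/-- Tameness is preserved by closure under one constraint: if `b` generates the ideal of all `t` with
`t • lhs` in the lattice, then `b • rhs` may be added, which replaces the factor of `rhs` by its gcd
with `b`. -/
theorem IsTame.sup {Φ : DivSystem d} {f : LinPoly d} {L : Submodule ℤ (LinPoly d)}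
    (h : IsTame Φ f L) (hf : polyNorm f ≤ sysNorm Φ) (i : Fin Φ.length) {b : ℤ} (hb0 : b ≠ 0)
    (hb : ∀ t : ℤ, t • (Φ.get i).lhs ∈ L ↔ b ∣ t) :
    IsTame Φ f (L ⊔ Submodule.span ℤ {b • (Φ.get i).rhs}) := by
  obtain ⟨v, β, h1, h2, h3, hL⟩ := h
  have hspan : ∀ g : ℤ, g = Int.gcd (v i) b →
      L ⊔ Submodule.span ℤ {b • (Φ.get i).rhs} = Submodule.span ℤ (Set.range
        fun o : Option (Fin Φ.length) => o.elim f fun j => Function.update v i g j •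
          (Φ.get j).rhs) := by
    rintro g rfl
    set L' := Submodule.span ℤ (Set.range fun o : Option (Fin Φ.length) => o.elim f fun j =>
      Function.update v i (Int.gcd (v i) b : ℤ) j • (Φ.get j).rhs) with hL'
    have hgen : ∀ t : ℤ, (Int.gcd (v i) b : ℤ) ∣ t → t • (Φ.get i).rhs ∈ L' := by
      rintro _ ⟨t, rfl⟩
      rw [mul_comm, mul_smul]
      exact Submodule.smul_mem _ _ (Submodule.subset_span ⟨some i, by simp⟩)
    refine le_antisymm (sup_le ?_ ?_) (Submodule.span_le.2 ?_)
    · rw [hL, Submodule.span_le]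
      rintro _ ⟨_ | j, rfl⟩
      · exact Submodule.subset_span ⟨none, rfl⟩
      · by_cases hj : j = i
        · subst hj
          exact hgen _ (Int.gcd_dvd_left _ _)
        · exact Submodule.subset_span ⟨some j, by simp [hj]⟩
    · rw [Submodule.span_singleton_le_iff_mem]
      exact hgen _ (Int.gcd_dvd_right _ _)
    · rintro _ ⟨_ | j, rfl⟩
      · exact Submodule.mem_sup_left (hL ▸ Submodule.subset_span ⟨none, rfl⟩)
      · by_cases hj : j = i
        · subst hj
          have e1 := Int.gcd_eq_gcd_ab (v j) b
          have m1 : v j • (Φ.get j).rhs ∈ L := hL ▸ Submodule.subset_span ⟨some j, rfl⟩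
          simp only [Option.elim_some, Function.update_self, SetLike.mem_coe]
          rw [e1, add_smul, mul_comm, mul_smul, mul_comm b, mul_smul]
          exact add_mem (Submodule.mem_sup_left (Submodule.smul_mem _ _ m1))
            (Submodule.mem_sup_right (Submodule.smul_mem _ _ (Submodule.mem_span_singleton_self _)))
        · simp only [Option.elim_some, Function.update_of_ne hj]
          exact Submodule.mem_sup_left (hL ▸ Submodule.subset_span ⟨some j, rfl⟩)
  by_cases hv : v i = 0
  · -- `b` divides `K * Δ`, where `K` is the old product and `Δ • lhs` lies in the lattice of the
    -- `a j`, in which all non-zero factors are set to one; `K` maps this lattice into `L`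
    have hKpos : 0 < ∏ j, β j := Finset.prod_pos fun j _ => (h1 j).1
    let a : Option (Fin Φ.length) → LinPoly d :=
      fun o => o.elim f fun j => if v j = 0 then 0 else (Φ.get j).rhs
    have hT2 : 2 ≤ sizeBase Φ := by simp only [sizeBase]; omega
    have hTn : sysNorm Φ ≤ sizeBase Φ := by simp only [sizeBase]; omega
    have haB : ∀ k, polyNorm (a k) ≤ sizeBase Φ := by
      rintro (_ | j)
      · exact hf.trans hTn
      · simp only [a, Option.elim_some]
        split_ifs
        · exact polyNorm_le_iff.2 fun i => by simp
        · exact (polyNorm_le_sysNorm (List.get_mem Φ j)).2.trans hTn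
    have hle : L ≤ Submodule.span ℤ (Set.range a) := by
      rw [hL, Submodule.span_le]
      rintro _ ⟨_ | j, rfl⟩
      · exact Submodule.subset_span ⟨none, rfl⟩
      · by_cases hj : v j = 0
        · simp [hj]
        · exact Submodule.smul_mem _ _ (Submodule.subset_span ⟨some j, by simp [a, hj]⟩)
    obtain ⟨Δ, hΔ, hΔle, hΔm⟩ := exists_small_multiple haB (by omega) (T := sizeBase Φ)
      (by simp only [Fintype.card_option, Fintype.card_fin, sizeBase]; omega) (by omega) hb0
      (hle ((hb b).2 dvd_rfl))
    rw [← sq, ← pow_mul] at hΔle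
    have hK : ∀ w ∈ Submodule.span ℤ (Set.range a), ((∏ j, β j : ℕ) : ℤ) • w ∈ L := by
      intro w hw
      have : Submodule.span ℤ (Set.range a) ≤
          L.comap (LinearMap.lsmul ℤ (LinPoly d) ((∏ j, β j : ℕ) : ℤ)) := by
        rw [Submodule.span_le]
        rintro _ ⟨_ | j, rfl⟩
        · exact Submodule.smul_mem _ _ (hL ▸ Submodule.subset_span ⟨none, rfl⟩)
        · by_cases hj : v j = 0
          · simp [a, hj]
          · obtain ⟨k, hk⟩ := h3 j hj
            simp only [a, Option.elim_some, if_neg hj]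
            show ((∏ j, β j : ℕ) : ℤ) • (Φ.get j).rhs ∈ L
            rw [hk, mul_comm, mul_smul]
            exact Submodule.smul_mem _ _ (hL ▸ Submodule.subset_span ⟨some j, rfl⟩)
      exact this hw
    have hdvd : b ∣ ((∏ j, β j : ℕ) : ℤ) * Δ := by
      rw [← hb, mul_smul]
      exact hK _ hΔm
    have hprod : ∏ j, Function.update β i Δ j = (∏ j, β j) * Δ := by
      rw [Finset.prod_update_of_mem (Finset.mem_univ i), mul_comm,
        ← Finset.mul_prod_erase Finset.univ β (Finset.mem_univ i), h2 i hv, one_mul,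
        Finset.sdiff_singleton_eq_erase]
    refine ⟨Function.update v i (Int.gcd (v i) b), Function.update β i Δ, fun j => ?_,
      fun j hj => ?_, fun j hj => ?_, hspan _ rfl⟩
    · by_cases hj : j = i
      · subst hj
        simpa using ⟨hΔ, hΔle⟩
      · simpa [hj] using h1 j
    · by_cases hji : j = i
      · subst hji
        simp [hb0] at hj
      · simp only [Function.update_of_ne hji] at hj ⊢
        exact h2 j hj
    · rw [hprod]
      push_cast
      by_cases hji : j = i
      · subst hji
        rw [Function.update_self, hv, Int.gcd_zero_left, Int.natAbs_dvd]
        exact_mod_cast hdvd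
      · rw [Function.update_of_ne hji] at hj ⊢
        exact (by exact_mod_cast h3 j hj : v j ∣ ∏ j, (β j : ℤ)).mul_right _
  · refine ⟨Function.update v i (Int.gcd (v i) b), β, h1, fun j hj => ?_, fun j hj => ?_,
      hspan _ rfl⟩
    · by_cases hji : j = i
      · subst hji
        simp [hb0] at hj
      · rw [Function.update_of_ne hji] at hj
        exact h2 j hj
    · by_cases hji : j = i
      · subst hji
        rw [Function.update_self]
        exact (Int.gcd_dvd_left _ _).trans (h3 j hv)
      · rw [Function.update_of_ne hji] at hj ⊢
        exact h3 j hj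

/-! ### The closure of a lattice under the constraints -/

theorem mem_divModule_self (Φ : DivSystem d) (f : LinPoly d) : f ∈ divModule Φ f := by
  simp only [divModule, Submodule.mem_sInf]
  exact fun M hM => hM.1

theorem smul_rhs_mem_divModule {Φ : DivSystem d} {f : LinPoly d} {c : DivConstraint d}
    (hc : c ∈ Φ) {b : ℤ} (hb : b • c.lhs ∈ divModule Φ f) : b • c.rhs ∈ divModule Φ f := by
  simp only [divModule, Submodule.mem_sInf] at hb ⊢
  exact fun M hM => hM.2 c hc b (hb M hM)

theorem divModule_le {Φ : DivSystem d} {f : LinPoly d} {M : Submodule ℤ (LinPoly d)} (hf : f ∈ M)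
    (h : ∀ c ∈ Φ, ∀ b : ℤ, b • c.lhs ∈ M → b • c.rhs ∈ M) : divModule Φ f ≤ M :=
  sInf_le ⟨hf, h⟩

/-- A multiple of a right-hand side that the divisibility module has to contain, but that is not yet
in the lattice; `none` if there is none. -/
noncomputable def findNew (Φ : DivSystem d) (H : Tableau d) : Option (LinPoly d) :=
  Φ.foldl (fun s c => if orderMod H (orderMod H c.lhs • c.rhs) = 1 then s
    else some (orderMod H c.lhs • c.rhs)) none

/-- One round of the closure. -/
noncomputable def closeStep (Φ : DivSystem d) (H : Tableau d) : Tableau d :=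
  (findNew Φ H).elim H fun w => reduceRows (insertRow H w)

theorem findNew_spec {ord : Equiv.Perm (Fin d)} {H : Tableau d} (hH : IsEchelon H)
    (hc : H.map Prod.fst = columns ord) (Φ : DivSystem d) :
    (findNew Φ H = none → ∀ c ∈ Φ, orderMod H c.lhs • c.rhs ∈ rowSpan H) ∧
    (∀ w, findNew Φ H = some w → w ∉ rowSpan H ∧ ∃ c ∈ Φ, w = orderMod H c.lhs • c.rhs) := by
  induction Φ using List.reverseRecOn with
  | nil => simp [findNew]
  | append_singleton Φ c ih =>
    have e : findNew (Φ ++ [c]) H = if orderMod H (orderMod H c.lhs • c.rhs) = 1 then findNew Φ H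
        else some (orderMod H c.lhs • c.rhs) := by
      simp [findNew]
    rw [e]
    split_ifs with h
    · rw [← mem_rowSpan_iff_orderMod hH hc] at h
      refine ⟨fun h0 c' hc' => ?_, fun w hw => ?_⟩
      · rcases List.mem_append.1 hc' with hc' | hc'
        · exact ih.1 h0 c' hc'
        · rwa [List.mem_singleton.1 hc']
      · obtain ⟨h1, c', hc', h2⟩ := ih.2 w hw
        exact ⟨h1, c', List.mem_append_left _ hc', h2⟩
    · rw [← mem_rowSpan_iff_orderMod hH hc] at h
      refine ⟨fun h0 => by simp at h0, fun w hw => ?_⟩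
      rw [Option.some_inj] at hw
      subst hw
      exact ⟨h, c, by simp, rfl⟩

/-- The invariant of the closure loop. -/
def CloseInv (Φ : DivSystem d) (ord : Equiv.Perm (Fin d)) (f : LinPoly d) (H : Tableau d) : Prop :=
  H.map Prod.fst = columns ord ∧ IsEchelon H ∧ IsReduced H ∧ IsTame Φ f (rowSpan H) ∧
    rowSpan H ≤ divModule Φ f

/-- A bound for the rows of all tableaux in the closure loop: it comes from `m + 1` generators of norm
at most `sizeBase Φ ^ (2 * (d + 1) * m + 1)`. -/
def rowBound (Φ : DivSystem d) : ℕ :=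
  sizeBase Φ ^ ((2 * (d + 1) * Φ.length + 2) * (1 + (Φ.length + 1) + (Φ.length + 1) ^ 2))

theorem CloseInv.polyNorm_le {Φ : DivSystem d} {ord : Equiv.Perm (Fin d)} {f : LinPoly d}
    {H : Tableau d} (h : CloseInv Φ ord f H) (hf : polyNorm f ≤ sysNorm Φ)
    {x : Col d × LinPoly d} (hx : x ∈ H) : polyNorm x.2 ≤ rowBound Φ := by
  obtain ⟨-, h2, h3, h4, -⟩ := h
  obtain ⟨a, ha, hB⟩ := h4.exists_generators hf
  have h := polyNorm_le_of_isReduced h2 h3 ha hB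
    (Nat.one_le_pow _ _ (by simp only [sizeBase]; omega)) (T := sizeBase Φ)
    (by simp only [Fintype.card_option, Fintype.card_fin, sizeBase]; omega) hx
  rw [← pow_succ', ← pow_mul, Fintype.card_option, Fintype.card_fin] at h
  exact h

theorem closeInv_init (Φ : DivSystem d) (ord : Equiv.Perm (Fin d)) (f : LinPoly d) :
    CloseInv Φ ord f (reduceRows (insertRow ((columns ord).map fun i => (i, 0)) f)) := by
  have h0 := isEchelon_zero (d := d) (columns ord)
  have hc : ((columns ord).map fun i => (i, (0 : LinPoly d))).map Prod.fst = columns ord := by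
    simp [Function.comp_def]
  have h1 := isEchelon_insertRow h0.1 f
  have hs : rowSpan (reduceRows (insertRow ((columns ord).map fun i => (i, 0)) f)) =
      Submodule.span ℤ {f} := by
    rw [rowSpan_reduceRows, rowSpan_insertRow h0.1 hc, h0.2, bot_sup_eq]
  refine ⟨?_, (isEchelon_reduceRows h1).1, (isEchelon_reduceRows h1).2.1, ?_, ?_⟩
  · rw [map_fst_reduceRows, map_fst_insertRow, hc]
  · rw [hs]
    exact isTame_span_singleton Φ f
  · rw [hs, Submodule.span_singleton_le_iff_mem]
    exact mem_divModule_self Φ f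

theorem CloseInv.step {Φ : DivSystem d} {ord : Equiv.Perm (Fin d)} {f : LinPoly d}
    {H : Tableau d} (h : CloseInv Φ ord f H) (hf : polyNorm f ≤ sysNorm Φ)
    (hne : findNew Φ H ≠ none) :
    CloseInv Φ ord f (closeStep Φ H) ∧ rowSpan H ≤ rowSpan (closeStep Φ H) ∧
      ¬ rowSpan (closeStep Φ H) ≤ rowSpan H := by
  obtain ⟨h1, h2, h3, h4, h5⟩ := h
  obtain ⟨w, hw⟩ := Option.ne_none_iff_exists'.1 hne
  obtain ⟨hwm, c, hc, hwc⟩ := (findNew_spec h2 h1 Φ).2 w hw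
  have h6 := isEchelon_insertRow h2 w
  have hs : rowSpan (closeStep Φ H) = rowSpan H ⊔ Submodule.span ℤ {w} := by
    simp only [closeStep, hw, Option.elim_some]
    rw [rowSpan_reduceRows, rowSpan_insertRow h2 h1]
  refine ⟨⟨?_, ?_, ?_, ?_, ?_⟩, ?_, ?_⟩
  · simp only [closeStep, hw, Option.elim_some]
    rw [map_fst_reduceRows, map_fst_insertRow, h1]
  · simp only [closeStep, hw, Option.elim_some]
    exact (isEchelon_reduceRows h6).1
  · simp only [closeStep, hw, Option.elim_some]
    exact (isEchelon_reduceRows h6).2.1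
  · obtain ⟨i, rfl⟩ := List.get_of_mem hc
    rw [hs, hwc]
    refine h4.sup hf i ?_ fun t => smul_mem_rowSpan_iff h2 h1 _ t
    intro h0
    rw [hwc, h0, zero_smul] at hwm
    exact hwm (zero_mem _)
  · rw [hs]
    refine sup_le h5 ?_
    rw [Submodule.span_singleton_le_iff_mem, hwc]
    exact smul_rhs_mem_divModule hc (h5 ((smul_mem_rowSpan_iff h2 h1 _ _).2 dvd_rfl))
  · rw [hs]
    exact le_sup_left
  · rw [hs]
    exact fun hle => hwm (hle (Submodule.mem_sup_right (Submodule.mem_span_singleton_self w)))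

/-- If there is nothing to add, then the lattice is closed under all constraints. -/
theorem CloseInv.rowSpan_eq {Φ : DivSystem d} {ord : Equiv.Perm (Fin d)} {f : LinPoly d}
    {H : Tableau d} (h : CloseInv Φ ord f H) (hn : findNew Φ H = none) :
    rowSpan H = divModule Φ f := by
  obtain ⟨h1, h2, h3, h4, h5⟩ := h
  refine le_antisymm h5 (divModule_le h4.mem fun c hc b hb => ?_)
  obtain ⟨t, rfl⟩ := (smul_mem_rowSpan_iff h2 h1 _ _).1 hb
  rw [mul_comm, mul_smul]
  exact Submodule.smul_mem _ _ ((findNew_spec h2 h1 Φ).1 hn c hc)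

/-- The measure of the closure loop. -/
theorem CloseInv.potential_lt {Φ : DivSystem d} {ord : Equiv.Perm (Fin d)} {f : LinPoly d}
    {H : Tableau d} (h : CloseInv Φ ord f H) (hf : polyNorm f ≤ sysNorm Φ)
    (hne : findNew Φ H ≠ none) :
    potential (Nat.log 2 (rowBound Φ)) (closeStep Φ H) < potential (Nat.log 2 (rowBound Φ)) H := by
  obtain ⟨h1, h2, h3⟩ := h.step hf hne
  refine (potential_anti h.2.1 h1.2.1 (h.1.trans h1.1.symm) h2 fun x hx => ?_).2.resolve_left h3
  exact Nat.log_mono_right ((natAbs_entry_le _ _).trans (h1.polyNorm_le hf hx))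

/-! ### Primitive parts -/

theorem dvd_content_iff {k : ℤ} {f : LinPoly d} :
    k ∣ (content f : ℤ) ↔ ∀ i, k ∣ entry i f := by
  rw [content, Int.dvd_coe_gcd_iff, Finset.dvd_gcd_iff]
  exact ⟨fun h i => by cases i; exacts [h.2, h.1 _ (Finset.mem_univ _)],
    fun h => ⟨fun i _ => h (some i), h none⟩⟩

theorem content_pos {f : LinPoly d} (hf : f ≠ 0) : 0 < content f := by
  refine Nat.pos_of_ne_zero fun h => hf (eq_zero_of_entry fun i => ?_)
  have := dvd_content_iff.1 (dvd_refl (content f : ℤ)) i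
  rw [h] at this
  simpa using this

/-- The primitive part, for `f ≠ 0`; it is `0` for `f = 0`. -/
def primPart (f : LinPoly d) : LinPoly d := (fun i => f.1 i / content f, f.2 / content f)

theorem content_smul_primPart (f : LinPoly d) : (content f : ℤ) • primPart f = f := by
  have h := dvd_content_iff.1 (dvd_refl (content f : ℤ))
  exact Prod.ext (funext fun i => Int.mul_ediv_cancel' (h (some i))) (Int.mul_ediv_cancel' (h none))

theorem primPart_ne_zero {f : LinPoly d} (hf : f ≠ 0) : primPart f ≠ 0 := by
  intro h
  rw [← content_smul_primPart f, h, smul_zero] at hf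
  exact hf rfl

theorem isPrimitivePart_primPart {f : LinPoly d} (hf : f ≠ 0) :
    IsPrimitivePart (primPart f) f := by
  refine ⟨⟨primPart_ne_zero hf, ?_⟩, (content_smul_primPart f).symm⟩
  have hc : (content f : ℤ) ≠ 0 := by exact_mod_cast (content_pos hf).ne'
  have h : (content f : ℤ) * content (primPart f) ∣ content f * 1 := by
    rw [mul_one, dvd_content_iff]
    intro i
    conv_rhs => rw [← content_smul_primPart f]
    rw [map_smul, smul_eq_mul]
    exact mul_dvd_mul_left _ (dvd_content_iff.1 dvd_rfl i)
  have := Int.eq_one_of_dvd_one (by positivity) ((mul_dvd_mul_iff_left hc).1 h)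
  exact_mod_cast this

theorem IsPrimitivePart.eq {f g : LinPoly d} (hg : g ≠ 0) (h : IsPrimitivePart f g) :
    f = primPart g := by
  have hc : (content g : ℤ) ≠ 0 := by exact_mod_cast (content_pos hg).ne'
  exact smul_right_injective _ hc (h.2.symm.trans (content_smul_primPart g).symm)

theorem primPart_of_isPrimitive {f : LinPoly d} (hf : IsPrimitive f) : primPart f = f := by
  have h := content_smul_primPart f
  rwa [hf.2, Nat.cast_one, one_smul] at h

theorem polyNorm_primPart_le (f : LinPoly d) : polyNorm (primPart f) ≤ polyNorm f := by
  rw [polyNorm_le_iff]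
  intro i
  refine le_trans ?_ (natAbs_entry_le i f)
  cases i
  · exact natAbs_ediv_le _ _
  · exact natAbs_ediv_le _ _

/-! ### The resulting system -/

/-- The constraints `f ∣ g` for the non-zero rows `g` of a tableau, on top of a given list. -/
def pushRows {f : LinPoly d} (hf : f ≠ 0) (out : DivSystem d) (H : Tableau d) : DivSystem d :=
  H.foldl (fun out x => if entry x.1 x.2 = 0 then out else ⟨f, x.2, hf⟩ :: out) out

/-- The constraints that come from one constraint of the given system: those given by a basis of
the divisibility module of the primitive part of its left-hand side, and the constraint itself, unless
this left-hand side is primitive. -/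
def pushConstraint (tab : LinPoly d → Tableau d) (out : DivSystem d) (c : DivConstraint d) :
    DivSystem d :=
  pushRows (primPart_ne_zero c.lhs_ne_zero) (if content c.lhs = 1 then out else c :: out)
    (tab (primPart c.lhs))

/-- The system in which the constraints with a primitive left-hand side are replaced by those given
by bases of divisibility modules. -/
def elimSystem (tab : LinPoly d → Tableau d) (Φ : DivSystem d) : DivSystem d :=
  Φ.foldl (pushConstraint tab) []

theorem mem_pushRows {f : LinPoly d} (hf : f ≠ 0) (out : DivSystem d) (H : Tableau d)
    (c : DivConstraint d) :
    c ∈ pushRows hf out H ↔ c ∈ out ∨ c.lhs = f ∧ c.rhs ∈ pivotRows H := by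
  obtain ⟨l, r, hl⟩ := c
  induction H generalizing out with
  | nil => simp [pushRows, pivotRows]
  | cons x H ih =>
    have e : pushRows hf out (x :: H) =
        pushRows hf (if entry x.1 x.2 = 0 then out else ⟨f, x.2, hf⟩ :: out) H := rfl
    rw [e, ih]
    by_cases h0 : entry x.1 x.2 = 0
    · simp [h0, pivotRows]
    · simp only [h0, if_false, List.mem_cons, DivConstraint.mk.injEq, pivotRows, Set.mem_ofPred_eq,
        exists_eq_or_imp, ne_eq, not_false_eq_true, true_and, @eq_comm _ r]
      tauto

theorem length_pushRows_le {f : LinPoly d} (hf : f ≠ 0) (out : DivSystem d) (H : Tableau d) :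
    (pushRows hf out H).length ≤ out.length + H.length := by
  induction H generalizing out with
  | nil => simp [pushRows]
  | cons x H ih =>
    have e : pushRows hf out (x :: H) =
        pushRows hf (if entry x.1 x.2 = 0 then out else ⟨f, x.2, hf⟩ :: out) H := rfl
    rw [e]
    refine (ih _).trans ?_
    split_ifs <;> (try simp only [List.length_cons]) <;> omega

theorem content_eq_one_iff (c : DivConstraint d) : content c.lhs = 1 ↔ IsPrimitive c.lhs :=
  ⟨fun h => ⟨c.lhs_ne_zero, h⟩, fun h => h.2⟩

theorem mem_elimSystem {tab : LinPoly d → Tableau d} {Φ : DivSystem d} {c : DivConstraint d} :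
    c ∈ elimSystem tab Φ ↔ (c ∈ Φ ∧ ¬ IsPrimitive c.lhs) ∨
      ∃ c' ∈ Φ, c.lhs = primPart c'.lhs ∧ c.rhs ∈ pivotRows (tab (primPart c'.lhs)) := by
  induction Φ using List.reverseRecOn with
  | nil => simp [elimSystem]
  | append_singleton Φ c' ih =>
    have e : elimSystem tab (Φ ++ [c']) = pushConstraint tab (elimSystem tab Φ) c' := by
      simp [elimSystem]
    rw [e, pushConstraint, mem_pushRows]
    have h1 : c ∈ (if content c'.lhs = 1 then elimSystem tab Φ else c' :: elimSystem tab Φ) ↔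
        c ∈ elimSystem tab Φ ∨ c = c' ∧ ¬ IsPrimitive c.lhs := by
      split_ifs with h <;> rw [content_eq_one_iff] at h
      · refine ⟨.inl, fun h' => h'.resolve_right ?_⟩
        rintro ⟨rfl, hn⟩
        exact hn h
      · rw [List.mem_cons, or_comm]
        refine or_congr_right ⟨?_, And.left⟩
        rintro rfl
        exact ⟨rfl, h⟩
    rw [h1, ih]
    constructor
    · rintro (((⟨h, h'⟩ | ⟨e, he, h⟩) | ⟨rfl, h⟩) | h)
      · exact .inl ⟨List.mem_append_left _ h, h'⟩
      · exact .inr ⟨e, List.mem_append_left _ he, h⟩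
      · exact .inl ⟨by simp, h⟩
      · exact .inr ⟨c', by simp, h⟩
    · rintro (⟨h, h'⟩ | ⟨e, he, h⟩)
      · rcases List.mem_append.1 h with h | h
        · exact .inl (.inl (.inl ⟨h, h'⟩))
        · exact .inl (.inr ⟨List.mem_singleton.1 h, h'⟩)
      · rcases List.mem_append.1 he with he | he
        · exact .inl (.inl (.inr ⟨e, he, h⟩))
        · rw [List.mem_singleton.1 he] at h
          exact .inr h

theorem length_elimSystem_le {tab : LinPoly d → Tableau d} {Φ : DivSystem d}
    (h : ∀ c ∈ Φ, (tab (primPart c.lhs)).length = d + 1) :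
    (elimSystem tab Φ).length ≤ Φ.length * (d + 2) := by
  induction Φ using List.reverseRecOn with
  | nil => simp [elimSystem]
  | append_singleton Φ c' ih =>
    have e : elimSystem tab (Φ ++ [c']) = pushConstraint tab (elimSystem tab Φ) c' := by
      simp [elimSystem]
    have ih := ih fun c hc => h c (List.mem_append_left _ hc)
    rw [e, pushConstraint]
    refine (length_pushRows_le _ _ _).trans ?_
    rw [h c' (by simp), List.length_append, List.length_singleton, Nat.succ_mul]
    split_ifs <;> (try simp only [List.length_cons]) <;> omega

/-- The tableaux hold reduced echelon bases of the divisibility modules of the primitive parts of all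
left-hand sides, as computed by the closure loop. -/
def IsClosure (Φ : DivSystem d) (ord : Equiv.Perm (Fin d)) (tab : LinPoly d → Tableau d) : Prop :=
  ∀ c ∈ Φ, CloseInv Φ ord (primPart c.lhs) (tab (primPart c.lhs)) ∧
    rowSpan (tab (primPart c.lhs)) = divModule Φ (primPart c.lhs)

section Properties

variable {Φ : DivSystem d} {ord : Equiv.Perm (Fin d)} {tab : LinPoly d → Tableau d}

theorem IsClosure.span_pivotRows (h : IsClosure Φ ord tab) {c : DivConstraint d} (hc : c ∈ Φ) :
    Submodule.span ℤ (pivotRows (tab (primPart c.lhs))) = divModule Φ (primPart c.lhs) :=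
  (DivSys.span_pivotRows (h c hc).1.2.1).trans (h c hc).2

/-- Multiplication by `b` maps `M_g` into `M_f` if `b • g` lies in `M_f`. -/
theorem smul_mem_divModule {f g h : LinPoly d} {b : ℤ} (hg : b • g ∈ divModule Φ f)
    (hh : h ∈ divModule Φ g) : b • h ∈ divModule Φ f := by
  have : divModule Φ g ≤ (divModule Φ f).comap (LinearMap.lsmul ℤ (LinPoly d) b) := by
    refine divModule_le hg fun c hc t ht => ?_
    change b • t • c.lhs ∈ divModule Φ f at ht
    change b • t • c.rhs ∈ divModule Φ f
    rw [smul_smul] at ht ⊢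
    exact smul_rhs_mem_divModule hc ht
  exact this hh

theorem divModule_elimSystem (h : IsClosure Φ ord tab) (f : LinPoly d) :
    divModule Φ f = divModule (elimSystem tab Φ) f := by
  refine le_antisymm (divModule_le (mem_divModule_self _ _) fun c hc b hb => ?_)
    (divModule_le (mem_divModule_self _ _) fun c hc b hb => ?_)
  · by_cases hp : IsPrimitive c.lhs
    · have h1 := h.span_pivotRows hc
      have h2 : c.rhs ∈ divModule Φ (primPart c.lhs) := by
        have := smul_rhs_mem_divModule (f := primPart c.lhs) hc (b := 1) (by
          rw [one_smul, primPart_of_isPrimitive hp]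
          exact mem_divModule_self _ _)
        rwa [one_smul] at this
      rw [← h1] at h2
      have h3 : Submodule.span ℤ (pivotRows (tab (primPart c.lhs))) ≤
          (divModule (elimSystem tab Φ) f).comap (LinearMap.lsmul ℤ (LinPoly d) b) := by
        refine Submodule.span_le.2 fun g hg => ?_
        refine smul_rhs_mem_divModule (c := ⟨c.lhs, g, c.lhs_ne_zero⟩)
          (mem_elimSystem.2 (.inr ⟨c, hc, ?_, hg⟩)) hb
        exact (primPart_of_isPrimitive hp).symm
      exact h3 h2
    · exact smul_rhs_mem_divModule (mem_elimSystem.2 (.inl ⟨hc, hp⟩)) hb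
  · rcases mem_elimSystem.1 hc with ⟨hc, -⟩ | ⟨c', hc', h1, h2⟩
    · exact smul_rhs_mem_divModule hc hb
    · rw [h1] at hb
      refine smul_mem_divModule hb ?_
      rw [← h.span_pivotRows hc']
      exact Submodule.subset_span h2

theorem leadingRank_le_iff {f : LinPoly d} {k : ℕ} :
    leadingRank ord f ≤ k ↔ f ∈ firstVars ord k := by
  simp only [leadingRank, Finset.sup_le_iff, Finset.mem_univ, true_imp_iff]
  refine forall_congr' fun j => ?_
  split_ifs with h
  · simp [h]
  · simp only [h, imp_false]
    omega

theorem mem_take_columns {k : ℕ} (hk : k ≤ d) {i : Col d} :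
    i ∈ (columns ord).take (d - k) ↔ ∃ j : Fin d, k ≤ j ∧ i = some (ord j) := by
  rw [columns, List.take_append_of_le_length (by simp), List.take_reverse, List.mem_reverse,
    List.length_ofFn, Nat.sub_sub_self hk, List.mem_drop_iff_getElem]
  simp only [List.length_ofFn, List.getElem_ofFn]
  constructor
  · rintro ⟨j, hj, rfl⟩
    exact ⟨⟨j + k, by omega⟩, by simp, by simp [add_comm]⟩
  · rintro ⟨j, hj, rfl⟩
    exact ⟨j - k, by omega, by simp [Nat.add_sub_cancel' hj]⟩

/-- The rows of an echelon tableau that use only the first variables generate the part of the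
lattice that uses only these variables. -/
theorem span_pivotRows_inter {H : Tableau d} (hH : IsEchelon H)
    (hc : H.map Prod.fst = columns ord) {k : ℕ} (hk : k ≤ d) :
    Submodule.span ℤ {g | leadingRank ord g ≤ k ∧ g ∈ pivotRows H} =
      rowSpan H ⊓ firstVars ord k := by
  have hcol : ∀ f : LinPoly d,
      f ∈ firstVars ord k ↔ ∀ x ∈ H.take (d - k), entry x.1 f = 0 := by
    intro f
    have : (∀ x ∈ H.take (d - k), entry x.1 f = 0) ↔
        ∀ i ∈ (columns ord).take (d - k), entry i f = 0 := by
      rw [← hc, ← List.map_take]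
      simp only [List.mem_map, forall_exists_index, and_imp, forall_apply_eq_imp_iff₂]
    rw [this]
    constructor
    · intro hf i hi
      obtain ⟨j, hj, rfl⟩ := (mem_take_columns hk).1 hi
      exact hf j hj
    · exact fun hf j hj => hf (some (ord j)) ((mem_take_columns hk).2 ⟨j, hj, rfl⟩)
  refine le_antisymm (Submodule.span_le.2 ?_) ?_
  · rintro g ⟨hg, x, hx, -, rfl⟩
    exact ⟨mem_rowSpan hx, leadingRank_le_iff.1 hg⟩
  · rintro f ⟨hf, hfk⟩
    have h1 := hH.mem_rowSpan_drop (d - k) hf ((hcol f).1 hfk)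
    rw [← span_pivotRows (hH.drop _)] at h1
    refine Submodule.span_mono ?_ h1
    rintro g ⟨x, hx, hx0, rfl⟩
    refine ⟨leadingRank_le_iff.2 ((hcol _).2 fun y hy => ?_), x, List.mem_of_mem_drop hx, hx0, rfl⟩
    exact hH.entry_take_drop hy hx

theorem occurs_elimSystem_iff {f g : LinPoly d} (hf : IsPrimitive f) :
    Occurs (elimSystem tab Φ) f g ↔ ∃ c ∈ Φ, f = primPart c.lhs ∧ g ∈ pivotRows (tab f) := by
  constructor
  · rintro ⟨c, hc, rfl, rfl⟩
    rcases mem_elimSystem.1 hc with ⟨-, h⟩ | ⟨c', hc', h1, h2⟩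
    · exact absurd hf h
    · exact ⟨c', hc', h1, h1 ▸ h2⟩
  · rintro ⟨c, hc, rfl, hg⟩
    exact ⟨⟨_, g, hf.1⟩, mem_elimSystem.2 (.inr ⟨c, hc, rfl, hg⟩), rfl, rfl⟩

theorem hasElimination_elimSystem (h : IsClosure Φ ord tab) :
    HasElimination ord (elimSystem tab Φ) := by
  intro c hc f hf k hk
  obtain ⟨c', hc', rfl⟩ : ∃ c' ∈ Φ, f = primPart c'.lhs := by
    have h1 := hf.eq c.lhs_ne_zero
    rcases mem_elimSystem.1 hc with ⟨hc, -⟩ | ⟨c', hc', h2, -⟩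
    · exact ⟨c, hc, h1⟩
    · refine ⟨c', hc', ?_⟩
      rw [h1, h2, primPart_of_isPrimitive (isPrimitivePart_primPart c'.lhs_ne_zero).1]
  obtain ⟨⟨h1, h2, -⟩, h3⟩ := h c' hc'
  have hset : {g | leadingRank ord g ≤ k ∧ Occurs (elimSystem tab Φ) (primPart c'.lhs) g} =
      {g | leadingRank ord g ≤ k ∧ g ∈ pivotRows (tab (primPart c'.lhs))} := by
    ext g
    simp only [Set.mem_ofPred_eq, occurs_elimSystem_iff hf.1]
    exact and_congr_right fun _ => ⟨fun ⟨_, _, _, h⟩ => h, fun h => ⟨c', hc', rfl, h⟩⟩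
  rw [hset, ← divModule_elimSystem h, ← h3]
  exact ⟨(linearIndepOn_pivotRows h2).mono fun g hg => hg.2, span_pivotRows_inter h2 h1 hk⟩

theorem occurs_elimSystem_of_not_isPrimitive {f g : LinPoly d} (hf : ¬ IsPrimitive f) :
    Occurs Φ f g ↔ Occurs (elimSystem tab Φ) f g := by
  constructor
  · rintro ⟨c, hc, rfl, rfl⟩
    exact ⟨c, mem_elimSystem.2 (.inl ⟨hc, hf⟩), rfl, rfl⟩
  · rintro ⟨c, hc, rfl, rfl⟩
    rcases mem_elimSystem.1 hc with ⟨hc, -⟩ | ⟨c', -, h1, -⟩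
    · exact ⟨c, hc, rfl, rfl⟩
    · rw [h1] at hf
      exact absurd (isPrimitivePart_primPart c'.lhs_ne_zero).1 hf

theorem exists_isPrimitivePart_of_mem_elimSystem {c : DivConstraint d}
    (hc : c ∈ elimSystem tab Φ) (hp : IsPrimitive c.lhs) :
    ∃ c' ∈ Φ, IsPrimitivePart c.lhs c'.lhs := by
  rcases mem_elimSystem.1 hc with ⟨-, h⟩ | ⟨c', hc', h1, -⟩
  · exact absurd hp h
  · exact ⟨c', hc', h1 ▸ isPrimitivePart_primPart c'.lhs_ne_zero⟩

/-! ### Solutions -/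

theorem evalAt_add (f g : LinPoly d) (x : Fin d → ℤ) :
    evalAt (f + g) x = evalAt f x + evalAt g x := by
  simp only [evalAt, Prod.fst_add, Prod.snd_add, Pi.add_apply, add_mul, Finset.sum_add_distrib]
  ring

theorem evalAt_smul (t : ℤ) (f : LinPoly d) (x : Fin d → ℤ) :
    evalAt (t • f) x = t * evalAt f x := by
  simp only [evalAt, Prod.smul_fst, Prod.smul_snd, Pi.smul_apply, smul_eq_mul, mul_assoc,
    ← Finset.mul_sum]
  ring

theorem evalAt_zero (x : Fin d → ℤ) : evalAt (0 : LinPoly d) x = 0 := by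
  simp [evalAt]

/-- The equivalence of the two systems for an abstract divisibility relation, which covers both
divisibility of integers and comparison of valuations. -/
theorem forall_elimSystem_iff (h : IsClosure Φ ord tab) (R : ℤ → ℤ → Prop) (hrefl : ∀ a, R a a)
    (hzero : ∀ a, R a 0) (hadd : ∀ a b b', R a b → R a b' → R a (b + b'))
    (hmul : ∀ a b t, R a b → R a (t * b)) (htrans : ∀ a b c, R a b → R b c → R a c)
    (hmul' : ∀ a b t, R a b → R (t * a) (t * b)) (x : Fin d → ℤ) :
    (∀ c ∈ Φ, evalAt c.lhs x ≠ 0 ∧ R (evalAt c.lhs x) (evalAt c.rhs x)) ↔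
      ∀ c ∈ elimSystem tab Φ, evalAt c.lhs x ≠ 0 ∧ R (evalAt c.lhs x) (evalAt c.rhs x) := by
  let M : ℤ → Submodule ℤ (LinPoly d) := fun a =>
    { carrier := {g | R a (evalAt g x)}
      add_mem' := fun {g g'} hg hg' => by
        rw [Set.mem_ofPred_eq, evalAt_add]
        exact hadd _ _ _ hg hg'
      zero_mem' := by
        rw [Set.mem_ofPred_eq, evalAt_zero]
        exact hzero _
      smul_mem' := fun t g hg => by
        rw [Set.mem_ofPred_eq, evalAt_smul]
        exact hmul _ _ _ hg }
  have hM : ∀ a g, g ∈ M a ↔ R a (evalAt g x) := fun a g => Iff.rfl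
  constructor
  · intro hx c hc
    rcases mem_elimSystem.1 hc with ⟨hc, -⟩ | ⟨c', hc', h1, h2⟩
    · exact hx c hc
    · refine ⟨fun h0 => (hx c' hc').1 ?_, ?_⟩
      · rw [← content_smul_primPart c'.lhs, evalAt_smul, ← h1, h0, mul_zero]
      · have h3 : divModule Φ c.lhs ≤ M (evalAt c.lhs x) := by
          refine divModule_le (hrefl _) fun e he b hb => ?_
          rw [hM, evalAt_smul] at hb ⊢
          exact htrans _ _ _ hb (hmul' _ _ _ (hx e he).2)
        refine h3 ?_
        rw [h1, ← h.span_pivotRows hc']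
        exact Submodule.subset_span h2
  · intro hx c hc
    by_cases hp : IsPrimitive c.lhs
    · have hpp := primPart_of_isPrimitive hp
      have h1 : ∀ g ∈ pivotRows (tab (primPart c.lhs)),
          evalAt c.lhs x ≠ 0 ∧ R (evalAt c.lhs x) (evalAt g x) := fun g hg =>
        hx ⟨c.lhs, g, c.lhs_ne_zero⟩ (mem_elimSystem.2 (.inr ⟨c, hc, hpp.symm, hg⟩))
      have h2 := h.span_pivotRows hc
      constructor
      · have hne : (pivotRows (tab (primPart c.lhs))).Nonempty := by
          rw [Set.nonempty_iff_ne_empty]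
          intro h0
          rw [h0, Submodule.span_empty] at h2
          have h3 := mem_divModule_self Φ (primPart c.lhs)
          rw [← h2, Submodule.mem_bot, hpp] at h3
          exact c.lhs_ne_zero h3
        obtain ⟨g, hg⟩ := hne
        exact (h1 g hg).1
      · have h3 : divModule Φ (primPart c.lhs) ≤ M (evalAt c.lhs x) := by
          rw [← h2, Submodule.span_le]
          exact fun g hg => (h1 g hg).2
        have h4 := smul_rhs_mem_divModule (f := primPart c.lhs) hc (b := 1) (by
          rw [one_smul, hpp]
          exact mem_divModule_self _ _)
        rw [one_smul] at h4
        exact h3 h4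
    · exact hx c (mem_elimSystem.2 (.inl ⟨hc, hp⟩))

theorem uDvd_iff {a b : ℤ} : UDvd a b ↔ a ≠ 0 ∧ a ∣ b := by
  constructor
  · rintro ⟨q, hq, huniq⟩
    refine ⟨?_, q, by rw [hq, mul_comm]⟩
    rintro rfl
    have := huniq (q + 1) (by simpa using hq)
    omega
  · rintro ⟨ha, q, rfl⟩
    exact ⟨q, mul_comm _ _, fun q' hq' => mul_right_cancel₀ ha (by rw [← hq', mul_comm])⟩

theorem isSolution_elimSystem_iff (h : IsClosure Φ ord tab) (x : Fin d → ℤ) :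
    IsSolution Φ x ↔ IsSolution (elimSystem tab Φ) x := by
  simp only [IsSolution, uDvd_iff]
  exact forall_elimSystem_iff h _ dvd_refl dvd_zero (fun _ _ _ => dvd_add)
    (fun _ _ t h => h.mul_left t) (fun _ _ _ => dvd_trans) (fun _ _ t h => mul_dvd_mul_left t h) x

theorem isSolutionMod_elimSystem_iff (h : IsClosure Φ ord tab) {p : ℕ} (hp : p.Prime)
    (x : Fin d → ℤ) : IsSolutionMod p Φ x ↔ IsSolutionMod p (elimSystem tab Φ) x := by
  have hp' : Prime (p : ℤ) := Nat.prime_iff_prime_int.1 hp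
  refine forall_elimSystem_iff h (fun a b => emultiplicity (p : ℤ) a ≤ emultiplicity (p : ℤ) b)
    (fun _ => le_rfl) (fun a => by simp)
    (fun a b b' h h' => (le_min h h').trans min_le_emultiplicity_add) (fun a b t h => ?_)
    (fun _ _ _ => le_trans) (fun a b t h => ?_) x
  · rw [emultiplicity_mul hp']
    exact h.trans le_add_self
  · rw [emultiplicity_mul hp', emultiplicity_mul hp']
    gcongr

/-! ### Size bounds -/

theorem length_columns (ord : Equiv.Perm (Fin d)) : (columns ord).length = d + 1 := by
  simp [columns]

theorem length_elimSystem_le' (h : IsClosure Φ ord tab) :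
    (elimSystem tab Φ).length ≤ Φ.length * (d + 2) :=
  length_elimSystem_le fun c hc => by
    rw [← length_columns ord, ← (h c hc).1.1, List.length_map]

theorem polyNorm_primPart_le_sysNorm {c : DivConstraint d} (hc : c ∈ Φ) :
    polyNorm (primPart c.lhs) ≤ sysNorm Φ :=
  (polyNorm_primPart_le _).trans (polyNorm_le_sysNorm hc).1

theorem sizeBase_le_rowBound (Φ : DivSystem d) : sizeBase Φ ≤ rowBound Φ :=
  Nat.le_self_pow (by positivity) _

theorem polyNorm_le_of_mem_elimSystem (h : IsClosure Φ ord tab) {c : DivConstraint d}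
    (hc : c ∈ elimSystem tab Φ) : polyNorm c.lhs ≤ rowBound Φ ∧ polyNorm c.rhs ≤ rowBound Φ := by
  have hN : sysNorm Φ ≤ rowBound Φ :=
    le_trans (by simp only [sizeBase]; omega) (sizeBase_le_rowBound Φ)
  rcases mem_elimSystem.1 hc with ⟨hc, -⟩ | ⟨c', hc', h1, x, hx, -, h2⟩
  · exact ⟨(polyNorm_le_sysNorm hc).1.trans hN, (polyNorm_le_sysNorm hc).2.trans hN⟩
  · have h3 := polyNorm_primPart_le_sysNorm hc'
    rw [h1, ← h2]
    exact ⟨h3.trans hN, (h c' hc').1.polyNorm_le h3 hx⟩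

/-- Without variables the divisibility module of a primitive polynomial is everything, and the
bound does not depend on the number of constraints. -/
theorem polyNorm_le_one_of_isEmpty {Φ : DivSystem 0} {ord : Equiv.Perm (Fin 0)}
    {f : LinPoly 0} (hf : IsPrimitive f) {H : Tableau 0} (h : CloseInv Φ ord f H)
    {x : Col 0 × LinPoly 0} (hx : x ∈ H) : polyNorm x.2 ≤ 1 := by
  obtain ⟨y, rfl⟩ : ∃ y, H = [y] := by
    rw [← List.length_eq_one_iff, ← List.length_map Prod.fst, h.1]
    simp [columns]
  obtain rfl := List.mem_singleton.1 hx
  obtain ⟨t, ht⟩ := mem_rowSpan_cons.1 h.2.2.2.1.mem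
  rw [rowSpan, Submodule.mem_bot, sub_eq_zero] at ht
  have h1 : (x.2.2 : ℤ) ∣ (content f : ℤ) := by
    rw [dvd_content_iff]
    intro i
    cases i with
    | none => exact ⟨t, by rw [ht, map_smul, smul_eq_mul, mul_comm]; rfl⟩
    | some i => exact i.elim0
  rw [hf.2] at h1
  have h2 := Int.natAbs_dvd_natAbs.2 h1
  rw [polyNorm_le_iff]
  intro i
  cases i with
  | none => exact Nat.le_of_dvd one_pos (by simpa using h2)
  | some i => exact i.elim0

/-- The exponent of `rowBound Φ` is at most `6 * m * d * (7 * m ^ 2)` for `m, d ≥ 1`. -/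
theorem sysNorm_elimSystem_le (h : IsClosure Φ ord tab) :
    sysNorm (elimSystem tab Φ) ≤ (Φ.length + sysNorm Φ + 2) ^ (42 * max 1 (Φ.length ^ 3 * d)) := by
  have hT1 : 0 < Φ.length + sysNorm Φ + 2 := by omega
  rcases Nat.eq_zero_or_pos d with rfl | hd
  · refine sysNorm_le fun c hc => ?_
    have hN : sysNorm Φ ≤ (Φ.length + sysNorm Φ + 2) ^ (42 * max 1 (Φ.length ^ 3 * 0)) :=
      le_trans (by omega) (Nat.le_self_pow (by simp) (Φ.length + sysNorm Φ + 2))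
    rcases mem_elimSystem.1 hc with ⟨hc, -⟩ | ⟨c', hc', h1, x, hx, -, h2⟩
    · exact ⟨(polyNorm_le_sysNorm hc).1.trans hN, (polyNorm_le_sysNorm hc).2.trans hN⟩
    · rw [h1, ← h2]
      refine ⟨(polyNorm_primPart_le_sysNorm hc').trans hN, ?_⟩
      exact (polyNorm_le_one_of_isEmpty (isPrimitivePart_primPart c'.lhs_ne_zero).1
        (h c' hc').1 hx).trans (Nat.one_le_pow _ _ hT1)
  · rcases Nat.eq_zero_or_pos Φ.length with hm | hm
    · rw [List.length_eq_zero_iff] at hm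
      subst hm
      simp [elimSystem, sysNorm]
    · refine (sysNorm_le fun c hc => polyNorm_le_of_mem_elimSystem h hc).trans ?_
      refine Nat.pow_le_pow_right hT1 ?_
      have h1 : 2 * (d + 1) * Φ.length + 2 ≤ 6 * (Φ.length * d) := by nlinarith
      have h2 : 1 + (Φ.length + 1) + (Φ.length + 1) ^ 2 ≤ 7 * Φ.length ^ 2 := by nlinarith
      calc _ ≤ 6 * (Φ.length * d) * (7 * Φ.length ^ 2) := Nat.mul_le_mul h1 h2
        _ = 42 * (Φ.length ^ 3 * d) := by ring
        _ ≤ _ := Nat.mul_le_mul_left _ (le_max_right _ _)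

end Properties

end Lattices

/-! ### Sizes of encoded polynomials -/

theorem size_encodePoly (d : ℕ) (f : LinPoly d) : (encodePoly f).size =
    1 + (2 + (List.ofFn fun i => 3 + Nat.size (f.1 i).natAbs).sum) +
      (2 + Nat.size f.2.natAbs) := by
  have h : ((List.ofFn fun i => Val.int (f.1 i)).map fun v => 1 + v.size) =
      List.ofFn fun i => 3 + Nat.size (f.1 i).natAbs := by
    rw [List.map_ofFn]
    congr 1
    funext i
    simp only [Function.comp, Val.size]
    omega
  simp only [encodePoly, Val.size, size_encodeList, h]

theorem size_encodePoly_le {d : ℕ} {f : LinPoly d} {s : ℕ} (h : Nat.size (polyNorm f) ≤ s) :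
    (encodePoly f).size ≤ 5 + s + d * (3 + s) := by
  have h1 : ∀ i, Nat.size (entry i f).natAbs ≤ s := fun i =>
    (Nat.size_le_size (natAbs_entry_le i f)).trans h
  have h2 : (List.ofFn fun i => 3 + Nat.size (f.1 i).natAbs).sum ≤ d * (3 + s) := by
    refine (List.sum_le_card_nsmul _ (3 + s) ?_).trans (by simp)
    intro n hn
    obtain ⟨i, rfl⟩ := List.mem_ofFn.1 hn
    exact Nat.add_le_add_left (h1 (some i)) 3
  have h3 : Nat.size f.2.natAbs ≤ s := h1 none
  rw [size_encodePoly]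
  omega

theorem size_entry_le {d : ℕ} (i : Col d) (f : LinPoly d) :
    Nat.size (entry i f).natAbs + 3 ≤ (encodePoly f).size := by
  rw [size_encodePoly]
  cases i with
  | none => simp only [entry_none]; omega
  | some i =>
    have : 3 + Nat.size (f.1 i).natAbs ≤ (List.ofFn fun i => 3 + Nat.size (f.1 i).natAbs).sum :=
      List.single_le_sum (fun _ _ => Nat.zero_le _) _ (List.mem_ofFn.2 ⟨i, rfl⟩)
    simp only [entry_some]
    omega

theorem size_polyNorm_le {d : ℕ} (f : LinPoly d) :
    Nat.size (polyNorm f) + 3 ≤ (encodePoly f).size := by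
  obtain ⟨i, hi⟩ : ∃ i, polyNorm f = (entry i f).natAbs := by
    by_contra! h
    have h1 : ∀ i, (entry i f).natAbs < polyNorm f := fun i =>
      lt_of_le_of_ne (natAbs_entry_le i f) (h i).symm
    have h2 : polyNorm f ≤ polyNorm f - 1 := polyNorm_le_iff.2 fun i => by
      have := h1 i
      omega
    have := h1 none
    omega
  rw [hi]
  exact size_entry_le i f

theorem dim_le_size_encodePoly {d : ℕ} (f : LinPoly d) : d ≤ (encodePoly f).size := by
  have := length_le_size_encodeList (List.ofFn fun i => Val.int (f.1 i))
  rw [List.length_ofFn] at this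
  simp only [encodePoly, Val.size]
  omega

theorem size_polyNorm_comb_le {d : ℕ} (a b : ℤ) (f g : LinPoly d) :
    Nat.size (polyNorm (a • f + b • g)) ≤ max (Nat.size a.natAbs + Nat.size (polyNorm f))
      (Nat.size b.natAbs + Nat.size (polyNorm g)) + 1 := by
  have h : polyNorm (a • f + b • g) ≤ a.natAbs * polyNorm f + b.natAbs * polyNorm g := by
    rw [polyNorm_le_iff]
    intro i
    rw [map_add, map_smul, map_smul, smul_eq_mul, smul_eq_mul]
    refine (Int.natAbs_add_le _ _).trans ?_
    rw [Int.natAbs_mul, Int.natAbs_mul]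
    exact add_le_add (Nat.mul_le_mul_left _ (natAbs_entry_le i f))
      (Nat.mul_le_mul_left _ (natAbs_entry_le i g))
  have h1 := (Nat.size_le_size h).trans (size_add_le _ _)
  have h2 := size_mul_le a.natAbs (polyNorm f)
  have h3 := size_mul_le b.natAbs (polyNorm g)
  omega

/-! ### Elementary programs for linear polynomials -/

section Programs

variable {γ : Type} {e : γ → Val}

/-- Lookup in a list, by counting down; the default is returned if the index is negative. -/
def lookup (s : ℤ × ℤ) (l : List ℤ) : ℤ × ℤ :=
  l.foldl (fun s a => (s.1 - 1, if s.1 = 0 then a else s.2)) s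

theorem lookup_fst (s : ℤ × ℤ) (l : List ℤ) : (lookup s l).1 = s.1 - l.length := by
  induction l generalizing s with
  | nil => simp [lookup]
  | cons a l ih =>
    have := ih (s.1 - 1, if s.1 = 0 then a else s.2)
    simp only [lookup, List.foldl_cons, List.length_cons] at *
    rw [this]
    push_cast
    ring

theorem lookup_snd_mem (s : ℤ × ℤ) (l : List ℤ) : (lookup s l).2 = s.2 ∨ (lookup s l).2 ∈ l := by
  induction l generalizing s with
  | nil => simp [lookup]
  | cons a l ih =>
    have := ih (s.1 - 1, if s.1 = 0 then a else s.2)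
    simp only [lookup, List.foldl_cons, List.mem_cons] at *
    rcases this with h | h
    · rw [h]
      split_ifs <;> simp
    · exact .inr (.inr h)

theorem lookup_of_neg {s : ℤ × ℤ} (hs : s.1 < 0) (l : List ℤ) : (lookup s l).2 = s.2 := by
  induction l generalizing s with
  | nil => simp [lookup]
  | cons a l ih =>
    have := ih (s := (s.1 - 1, if s.1 = 0 then a else s.2)) (by simp only; omega)
    simp only [lookup, List.foldl_cons] at *
    rw [this, if_neg hs.ne]

theorem lookup_getElem {l : List ℤ} {n : ℕ} (hn : n < l.length) (v : ℤ) :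
    (lookup (n, v) l).2 = l[n] := by
  induction l generalizing n v with
  | nil => simp at hn
  | cons a l ih =>
    cases n with
    | zero =>
      have := lookup_of_neg (s := (-1, a)) (by simp) l
      simpa [lookup] using this
    | succ n =>
      have := ih (n := n) (by simpa using hn) v
      simp only [lookup, List.foldl_cons, List.getElem_cons_succ] at *
      rw [← this, if_neg (by push_cast; omega)]
      push_cast
      rw [add_sub_cancel_right]

theorem PolyTime.lookup {i v : γ → ℤ} {l : γ → List ℤ} (hi : PolyTime e fun c => .int (i c))
    (hv : PolyTime e fun c => .int (v c))
    (hl : PolyTime e fun c => encodeList ((l c).map .int)) :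
    PolyTime e fun c => .int (DivSys.lookup (i c, v c) (l c)).2 := by
  have h := PolyTime.foldl (e := e) (S := fun _ => ℤ × ℤ) (A := fun _ => ℤ)
    (s := fun c => (i c, v c)) (l := l) (fun _ s => .pair (.int s.1) (.int s.2))
    (fun _ a => .int a) (fun _ s a => (s.1 - 1, if s.1 = 0 then a else s.2)) (hi.pair hv) hl ?_ ?_
  · exact h.snd
  · have hid := PolyTime.id fun p : (_ : γ) × (ℤ × ℤ) × ℤ => Val.pair (e p.1)
      (.pair (.pair (.int p.2.1.1) (.int p.2.1.2)) (.int p.2.2))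
    refine (hid.snd.fst.fst.sub (.const _ 1)).pair ?_
    refine (PolyTime.ite (.eq hid.snd.fst.fst (.const _ 0)) hid.snd.snd hid.snd.fst.snd).congr
      fun p => ?_
    dsimp only
    split_ifs <;> rfl
  · obtain ⟨k, hk⟩ := ((((PolyBounded.const e 8).add hi.size).add hl.size).add hv.size).add
      (hl.size.add hl.size)
    refine ⟨k, fun c l' hl' => le_trans ?_ (hk c)⟩
    have h1 := lookup_fst (i c, v c) l'
    have h2 := lookup_snd_mem (i c, v c) l'
    have h3 : l'.length ≤ (encodeList ((l c).map .int)).size := by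
      refine hl'.length_le.trans ?_
      simpa using length_le_size_encodeList ((l c).map Val.int)
    have h4 : Nat.size (DivSys.lookup (i c, v c) l').2.natAbs ≤
        (Val.int (v c)).size + (encodeList ((l c).map .int)).size := by
      rcases h2 with h2 | h2
      · rw [h2]
        simp only [Val.size]
        omega
      · have := size_le_size_encodeList (List.mem_map.2 ⟨_, hl'.subset h2, rfl⟩ :
          Val.int (DivSys.lookup (i c, v c) l').2 ∈ (l c).map Val.int)
        simp only [Val.size] at this ⊢
        omega
    have h5 : Nat.size (DivSys.lookup (i c, v c) l').1.natAbs ≤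
        Nat.size (i c).natAbs + Nat.size l'.length + 1 := by
      rw [h1]
      have := (Nat.size_le_size (Int.natAbs_sub_le (i c) l'.length)).trans (size_add_le _ _)
      rw [Int.natAbs_natCast] at this
      simp only
      omega
    have h6 : Nat.size l'.length ≤ l'.length := Nat.size_le.2 Nat.lt_two_pow_self
    have h7 : (Val.pair (.int (DivSys.lookup (i c, v c) l').1)
        (.int (DivSys.lookup (i c, v c) l').2)).size =
        1 + (2 + Nat.size (DivSys.lookup (i c, v c) l').1.natAbs) +
        (2 + Nat.size (DivSys.lookup (i c, v c) l').2.natAbs) := rfl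
    have h8 : (Val.int (i c)).size = 2 + Nat.size (i c).natAbs := rfl
    refine le_trans h7.le ?_
    beta_reduce
    omega

variable {D : γ → ℕ}

/-- Columns are encoded by the numbers of their variables, and by `-1` for the constants. -/
def encodeCol {d : ℕ} : Col d → Val
  | none => .int (-1)
  | some i => .int ((i : ℕ) : ℤ)

theorem PolyTime.coeffs {f : ∀ c, LinPoly (D c)} (hf : PolyTime e fun c => encodePoly (f c)) :
    PolyTime e fun c => encodeList ((List.ofFn (f c).1).map .int) :=
  hf.fst.congr fun c => by
    rw [List.map_ofFn]
    rfl

theorem PolyTime.poly {f : ∀ c, LinPoly (D c)}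
    (h1 : PolyTime e fun c => encodeList ((List.ofFn (f c).1).map .int))
    (h2 : PolyTime e fun c => .int (f c).2) : PolyTime e fun c => encodePoly (f c) :=
  (h1.pair h2).congr fun c => by
    rw [List.map_ofFn]
    rfl

theorem PolyTime.entry {i : ∀ c, Col (D c)} {f : ∀ c, LinPoly (D c)}
    (hi : PolyTime e fun c => encodeCol (i c)) (hf : PolyTime e fun c => encodePoly (f c)) :
    PolyTime e fun c => .int (entry (i c) (f c)) := by
  have hi' : PolyTime e fun c => .int ((i c).elim (-1) fun j => ((j : ℕ) : ℤ)) :=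
    hi.congr fun c => by cases i c <;> rfl
  refine (PolyTime.lookup hi' hf.snd hf.coeffs).congr fun c => ?_
  cases i c with
  | none =>
    rw [lookup_of_neg (by simp)]
    rfl
  | some j =>
    simp only [Option.elim_some]
    rw [lookup_getElem (by simp)]
    simp

/-- One step of the pointwise linear combination of two lists; the state is what is left of the second
one. -/
def combStep (a b : ℤ) (s : List ℤ) (x : ℤ) : List ℤ × ℤ := (s.tail, a * x + b * s.headD 0)

theorem mapAcc_combStep (a b : ℤ) {d : ℕ} (f g : Fin d → ℤ) :
    (mapAcc (combStep a b) (List.ofFn g) (List.ofFn f)).2 = List.ofFn (a • f + b • g) := by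
  induction d with
  | zero => simp [mapAcc]
  | succ d ih =>
    have := ih (fun i => f i.succ) (fun i => g i.succ)
    simp only [List.ofFn_succ, mapAcc, combStep, List.tail_cons, List.headD_cons] at this ⊢
    rw [this]
    rfl

theorem mapAcc_combStep_fst (a b : ℤ) (s l : List ℤ) :
    (mapAcc (combStep a b) s l).1 = s.drop l.length := by
  induction l generalizing s with
  | nil => rfl
  | cons x l ih => simp [mapAcc, ih, combStep]

theorem PolyTime.comb {a b : γ → ℤ} {f g : ∀ c, LinPoly (D c)}
    (ha : PolyTime e fun c => .int (a c)) (hb : PolyTime e fun c => .int (b c))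
    (hf : PolyTime e fun c => encodePoly (f c)) (hg : PolyTime e fun c => encodePoly (g c)) :
    PolyTime e fun c => encodePoly (a c • f c + b c • g c) := by
  refine .poly ?_ ((ha.mul hf.snd).add (hb.mul hg.snd))
  have h := PolyTime.mapAcc (e := e) (S := fun _ => List ℤ) (A := fun _ => ℤ) (O := fun _ => ℤ)
    (s := fun c => List.ofFn (g c).1) (l := fun c => List.ofFn (f c).1)
    (fun _ s => encodeList (s.map .int)) (fun _ a => .int a) (fun _ a => .int a)
    (fun c => combStep (a c) (b c)) hg.coeffs hf.coeffs ?_ ?_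
  · refine h.snd.congr fun c => ?_
    rw [mapAcc_combStep]
    rfl
  · let E : (_ : γ) × List ℤ × ℤ → Val := fun p =>
      .pair (e p.1) (.pair (encodeList (p.2.1.map .int)) (.int p.2.2))
    have hid := PolyTime.id E
    have ht : PolyTime (fun p : (_ : γ) × List ℤ × ℤ => encodeList (p.2.1.map .int))
        fun p => encodeList (p.2.1.tail.map .int) := by
      have h0 : ∀ l : List ℤ, Op.eval .snd (encodeList (l.map .int)) =
          encodeList (l.tail.map .int) := fun l => by cases l <;> rfl
      refine (PolyTime.op .snd ?_).congr fun p => h0 _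
      refine (PolyBounded.self _).mono fun p => ?_
      rw [h0, List.map_tail, ← List.drop_one]
      exact size_encodeList_drop_le _ _
    have hh : PolyTime (fun p : (_ : γ) × List ℤ × ℤ => encodeList (p.2.1.map .int))
        fun p => .int (p.2.1.headD 0) := by
      have h0 : ∀ l : List ℤ, Op.eval .fst (encodeList (l.map .int)) = .int (l.headD 0) :=
        fun l => by cases l <;> rfl
      refine (PolyTime.op .fst ?_).congr fun p => h0 _
      refine (PolyBounded.self _).mono fun p => ?_
      rw [h0]
      cases p.2.1 with
      | nil => rfl
      | cons x l => exact size_le_size_encodeList (by simp)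
    refine (hid.snd.fst.comp ht).pair (.add (.mul ?_ hid.snd.snd) (.mul ?_ (hid.snd.fst.comp hh)))
    · exact ha.weaken (fun p : (_ : γ) × List ℤ × ℤ => p.1) _
    · exact hb.weaken (fun p : (_ : γ) × List ℤ × ℤ => p.1) _
  · obtain ⟨k, hk⟩ := hg.coeffs.size
    refine ⟨k, fun c l' _ => le_trans ?_ (hk c)⟩
    rw [mapAcc_combStep_fst, List.map_drop]
    exact size_encodeList_drop_le _ _

theorem PolyTime.smul {a : γ → ℤ} {f : ∀ c, LinPoly (D c)} (ha : PolyTime e fun c => .int (a c))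
    (hf : PolyTime e fun c => encodePoly (f c)) : PolyTime e fun c => encodePoly (a c • f c) :=
  (PolyTime.comb ha (.const e 0) hf hf).congr fun c => by rw [zero_smul, add_zero]

theorem PolyTime.gcd {a b : γ → ℤ} (ha : PolyTime e fun c => .int (a c))
    (hb : PolyTime e fun c => .int (b c)) :
    PolyTime e fun c => .pair (.int (DivSys.xgcd (a c, b c)).1) (.int (DivSys.xgcd (a c, b c)).2) :=
  (ha.pair hb).comp (PolyTime.xgcd.reindex fun c => (a c, b c))

/-- The gcd of the entries of a list, computed by Euclid's algorithm. -/
noncomputable def listGcd (l : List ℤ) : ℤ := l.foldl (fun g a => (xgcd (g, a)).1) 0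

theorem listGcd_append (l : List ℤ) (a : ℤ) :
    listGcd (l ++ [a]) = (xgcd (listGcd l, a)).1 := by
  simp [listGcd]

theorem listGcd_nonneg (l : List ℤ) : 0 ≤ listGcd l := by
  induction l using List.reverseRecOn with
  | nil => simp [listGcd]
  | append_singleton l a ih =>
    rw [listGcd_append, xgcd_fst_of_nonneg a ih]
    positivity

theorem dvd_listGcd_iff {k : ℤ} {l : List ℤ} : k ∣ listGcd l ↔ ∀ a ∈ l, k ∣ a := by
  induction l using List.reverseRecOn with
  | nil => simp [listGcd]
  | append_singleton l a ih =>
    rw [listGcd_append, xgcd_fst_of_nonneg a (listGcd_nonneg l), Int.dvd_coe_gcd_iff, ih]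
    simp only [List.mem_append, List.mem_singleton, or_imp, forall_and, forall_eq]

theorem exists_natAbs_listGcd_le (l : List ℤ) :
    listGcd l = 0 ∨ ∃ a ∈ l, (listGcd l).natAbs ≤ a.natAbs := by
  by_contra! h
  refine h.1 ?_
  have h1 : ∀ a ∈ l, a = 0 := fun a ha => by
    by_contra ha0
    have h2 := dvd_listGcd_iff.1 (dvd_refl (listGcd l)) a ha
    have h3 := Nat.le_of_dvd (Int.natAbs_pos.2 ha0) (Int.natAbs_dvd_natAbs.2 h2)
    have := h.2 a ha
    omega
  exact zero_dvd_iff.1 (dvd_listGcd_iff.2 fun a ha => by rw [h1 a ha])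

theorem PolyTime.listGcd {l : γ → List ℤ} (hl : PolyTime e fun c => encodeList ((l c).map .int)) :
    PolyTime e fun c => .int (DivSys.listGcd (l c)) := by
  refine PolyTime.foldl (e := e) (S := fun _ => ℤ) (A := fun _ => ℤ)
    (s := fun _ => 0) (l := l) (fun _ s => .int s) (fun _ a => .int a)
    (fun _ g a => (DivSys.xgcd (g, a)).1) (.const e 0) hl ?_ ?_
  · have hid := PolyTime.id fun p : (_ : γ) × ℤ × ℤ => Val.pair (e p.1)
      (.pair (.int p.2.1) (.int p.2.2))
    exact (PolyTime.gcd hid.snd.fst hid.snd.snd).fst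
  · obtain ⟨k, hk⟩ := hl.size
    refine ⟨k, fun c l' hl' => le_trans ?_ (hk c)⟩
    rcases exists_natAbs_listGcd_le l' with h | ⟨a, ha, h⟩
    · rw [DivSys.listGcd] at h
      rw [h]
      exact Val.two_le_size _
    · exact (Val.size_int_le h).trans (size_le_size_encodeList
        (List.mem_map.2 ⟨a, hl'.subset ha, rfl⟩))

theorem xgcd_listGcd_eq_content {d : ℕ} (f : LinPoly d) :
    (xgcd (listGcd (List.ofFn f.1), f.2)).1 = content f := by
  have h0 := listGcd_nonneg (List.ofFn f.1)
  rw [xgcd_fst_of_nonneg _ h0]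
  have h : ∀ k : ℤ, k ∣ (Int.gcd (listGcd (List.ofFn f.1)) f.2 : ℤ) ↔ k ∣ (content f : ℤ) := by
    intro k
    rw [Int.dvd_coe_gcd_iff, dvd_listGcd_iff, dvd_content_iff]
    constructor
    · rintro ⟨h1, h2⟩ (_ | i)
      · exact h2
      · exact h1 _ (List.mem_ofFn.2 ⟨i, rfl⟩)
    · intro h
      refine ⟨fun a ha => ?_, h none⟩
      obtain ⟨i, rfl⟩ := List.mem_ofFn.1 ha
      exact h (some i)
  exact Int.dvd_antisymm (by positivity) (by positivity) ((h _).1 dvd_rfl) ((h _).2 dvd_rfl)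

theorem PolyTime.content {f : ∀ c, LinPoly (D c)} (hf : PolyTime e fun c => encodePoly (f c)) :
    PolyTime e fun c => .int (DivSys.content (f c) : ℤ) :=
  (PolyTime.gcd (.listGcd hf.coeffs) hf.snd).fst.congr fun c => by rw [xgcd_listGcd_eq_content]

theorem PolyTime.primPart {f : ∀ c, LinPoly (D c)} (hf : PolyTime e fun c => encodePoly (f c)) :
    PolyTime e fun c => encodePoly (DivSys.primPart (f c)) := by
  have hc := PolyTime.content hf
  refine .poly ?_ (hf.snd.div hc)
  have h := PolyTime.map (e := e) (A := fun _ => ℤ) (O := fun _ => ℤ)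
    (l := fun c => List.ofFn (f c).1) (fun _ a => .int a) (fun _ a => .int a)
    (fun c x => x / DivSys.content (f c)) hf.coeffs ?_
  · refine h.congr fun c => ?_
    simp only [List.map_ofFn]
    rfl
  · have hid := PolyTime.id fun p : (_ : γ) × ℤ => Val.pair (e p.1) (.int p.2)
    exact hid.snd.div (hc.weaken (fun p : (_ : γ) × ℤ => p.1) _)

end Programs

/-! ### Programs for tableaux -/

theorem sum_size_prefix_le {A : Type} (enc : A → Val) {l' l : List A} (h : l' <+: l) :
    (l'.map fun a => (enc a).size).sum ≤ (encodeList (l.map enc)).size := by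
  obtain ⟨t, rfl⟩ := h
  rw [size_encodeList, List.map_map, List.map_append, List.sum_append]
  have : (l'.map fun a => (enc a).size).sum ≤
      (l'.map ((fun v => 1 + v.size) ∘ enc)).sum :=
    List.sum_le_sum fun a _ => by simp only [Function.comp]; omega
  omega

/-- If each step of a recursion adds at most the size of the list entry to a measure of the state,
then the measure stays bounded by the size of the list. -/
theorem mapAcc_measure_le {S A O : Type} (enc : A → Val) {f : S → A → S × O} (μ : S → ℕ)
    (hf : ∀ s a, μ (f s a).1 ≤ μ s + (enc a).size) (s : S) {l' l : List A} (h : l' <+: l) :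
    μ (mapAcc f s l').1 ≤ μ s + (encodeList (l.map enc)).size := by
  refine le_trans ?_ (Nat.add_le_add_left (sum_size_prefix_le enc h) _)
  clear h
  induction l' generalizing s with
  | nil => simp [mapAcc]
  | cons a l' ih =>
    have h1 := ih (f s a).1
    have h2 := hf s a
    simp only [mapAcc, List.map_cons, List.sum_cons]
    omega

/-- The encoding of a row of a tableau as the pair of its column and its polynomial. -/
def encodeRow {d : ℕ} (x : Col d × LinPoly d) : Val := .pair (encodeCol x.1) (encodePoly x.2)

/-- The encoding of a tableau as the list of its rows. -/
def encodeTableau {d : ℕ} (H : Tableau d) : Val := encodeList (H.map encodeRow)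

section Programs

variable {γ : Type} {e : γ → Val} {D : γ → ℕ}

/-- The bit length of the inserted row grows by at most the size of the row it meets, so it stays
polynomial along the tableau. The reason is that the cofactor `(h / g)` is bounded by an entry of this
row, while `(a / g)` is multiplied with this row and not with the inserted one. -/
theorem size_polyNorm_insertStep_le {d : ℕ} (s : LinPoly d × ℤ) (x : Col d × LinPoly d) :
    Nat.size (polyNorm (insertStep s x).1.1) ≤ Nat.size (polyNorm s.1) + (encodeRow x).size := by
  unfold insertStep
  split_ifs
  · exact Nat.le_add_right _ _
  · have h1 := size_polyNorm_comb_le (entry x.1 x.2 / (xgcd (entry x.1 x.2, entry x.1 s.1)).1)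
      (-(entry x.1 s.1 / (xgcd (entry x.1 x.2, entry x.1 s.1)).1)) s.1 x.2
    rw [neg_smul, ← sub_eq_add_neg, Int.natAbs_neg] at h1
    have h2 := Nat.size_le_size ((natAbs_ediv_le (entry x.1 x.2)
      (xgcd (entry x.1 x.2, entry x.1 s.1)).1).trans (natAbs_entry_le _ _))
    have h3 := Nat.size_le_size ((natAbs_ediv_le (entry x.1 s.1)
      (xgcd (entry x.1 x.2, entry x.1 s.1)).1).trans (natAbs_entry_le _ _))
    have h4 := size_polyNorm_le x.2
    simp only [encodeRow, Val.size]
    omega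

theorem size_insertStep_snd_le {d : ℕ} (s : LinPoly d × ℤ) (x : Col d × LinPoly d) :
    Nat.size (insertStep s x).1.2.natAbs ≤ Nat.size s.2.natAbs + (encodeRow x).size := by
  unfold insertStep
  split_ifs
  · exact Nat.le_add_right _ _
  · have h1 := size_mul_le s.2.natAbs
      (entry x.1 x.2 / (xgcd (entry x.1 x.2, entry x.1 s.1)).1).natAbs
    have h2 := Nat.size_le_size (natAbs_ediv_le (entry x.1 x.2)
      (xgcd (entry x.1 x.2, entry x.1 s.1)).1)
    have h4 := size_entry_le x.1 x.2
    simp only [encodeRow, Val.size, Int.natAbs_mul]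
    omega

theorem PolyTime.insertStep {s : ∀ c, LinPoly (D c) × ℤ} {x : ∀ c, Col (D c) × LinPoly (D c)}
    (hw : PolyTime e fun c => encodePoly (s c).1) (hb : PolyTime e fun c => .int (s c).2)
    (hx : PolyTime e fun c => encodeRow (x c)) :
    PolyTime e fun c => .pair (.pair (encodePoly (DivSys.insertStep (s c) (x c)).1.1)
      (.int (DivSys.insertStep (s c) (x c)).1.2)) (encodeRow (DivSys.insertStep (s c) (x c)).2) := by
  have hi : PolyTime e fun c => encodeCol (x c).1 := hx.fst
  have hr : PolyTime e fun c => encodePoly (x c).2 := hx.snd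
  have hh := PolyTime.entry hi hr
  have ha := PolyTime.entry hi hw
  have hg := (PolyTime.gcd hh ha).fst
  have hu := (PolyTime.gcd hh ha).snd
  have h1 := hh.div hg
  have h2 := ha.div hg
  have h3 := (hg.sub (hu.mul hh)).div ha
  refine (PolyTime.ite (.eq ha (.const e 0)) ((hw.pair hb).pair hx)
    (((PolyTime.comb h1 h2.neg hw hr).pair (hb.mul h1)).pair
      (hi.pair (PolyTime.comb hu h3 hr hw)))).congr fun c => ?_
  by_cases h0 : DivSys.entry (x c).1 (s c).1 = 0
  · simp only [DivSys.insertStep, if_pos h0]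
  · simp only [DivSys.insertStep, if_neg h0, encodeRow, neg_smul, sub_eq_add_neg]

theorem size_state_le {d : ℕ} {w : LinPoly d} {b : ℤ} {s : ℕ} (hw : Nat.size (polyNorm w) ≤ s)
    (hb : Nat.size b.natAbs ≤ s) :
    (Val.pair (encodePoly w) (.int b)).size ≤ 8 + 2 * s + d * (3 + s) := by
  have := size_encodePoly_le hw
  simp only [Val.size]
  omega

/-- The whole insertion. The new rows come out in reverse order. -/
theorem PolyTime.insert {H : ∀ c, Tableau (D c)} {w : ∀ c, LinPoly (D c)}
    (hH : PolyTime e fun c => encodeTableau (H c)) (hw : PolyTime e fun c => encodePoly (w c)) :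
    PolyTime e fun c => .pair (.int (orderMod (H c) (w c)))
      (encodeTableau (insertRow (H c) (w c)).reverse) := by
  have h := PolyTime.mapAcc_reverse (e := e) (S := fun c => LinPoly (D c) × ℤ)
    (A := fun c => Col (D c) × LinPoly (D c)) (O := fun c => Col (D c) × LinPoly (D c))
    (s := fun c => (w c, 1)) (l := H) (fun _ s => .pair (encodePoly s.1) (.int s.2))
    (fun _ x => encodeRow x) (fun _ x => encodeRow x) (fun _ s x => DivSys.insertStep s x)
    (hw.pair (.const e 1)) hH ?_ ?_
  · exact h.fst.snd.pair h.snd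
  · have hid := PolyTime.id fun p : Σ c, (LinPoly (D c) × ℤ) × (Col (D c) × LinPoly (D c)) =>
      Val.pair (e p.1) (.pair (.pair (encodePoly p.2.1.1) (.int p.2.1.2)) (encodeRow p.2.2))
    exact PolyTime.insertStep (D := fun p : Σ c, (LinPoly (D c) × ℤ) × (Col (D c) × LinPoly (D c)) =>
      D p.1) (s := fun p => p.2.1) (x := fun p => p.2.2) hid.snd.fst.fst hid.snd.fst.snd hid.snd.snd
  · have hs := hw.size.add hH.size
    obtain ⟨k, hk⟩ := ((PolyBounded.const e 8).add (hs.const_mul 2)).add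
      (hw.size.mul ((PolyBounded.const e 3).add hs))
    refine ⟨k, fun c l' hl' => le_trans ?_ (hk c)⟩
    have h1 := mapAcc_measure_le encodeRow (fun s : LinPoly (D c) × ℤ => Nat.size (polyNorm s.1))
      size_polyNorm_insertStep_le (w c, 1) hl'
    have h2 := mapAcc_measure_le encodeRow (fun s : LinPoly (D c) × ℤ => Nat.size s.2.natAbs)
      size_insertStep_snd_le (w c, 1) hl'
    have h3 := size_polyNorm_le (w c)
    have h4 := dim_le_size_encodePoly (w c)
    beta_reduce at h1 h2
    rw [Int.natAbs_one, Nat.size_one] at h2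
    refine (size_state_le (s := (encodePoly (w c)).size + (encodeTableau (H c)).size) ?_ ?_).trans ?_
    · exact h1.trans (by simp only [encodeTableau]; omega)
    · exact h2.trans (by simp only [encodeTableau]; omega)
    · exact Nat.add_le_add_left (Nat.mul_le_mul_right _ h4) _

theorem PolyTime.orderMod {H : ∀ c, Tableau (D c)} {w : ∀ c, LinPoly (D c)}
    (hH : PolyTime e fun c => encodeTableau (H c)) (hw : PolyTime e fun c => encodePoly (w c)) :
    PolyTime e fun c => .int (DivSys.orderMod (H c) (w c)) :=
  (PolyTime.insert hH hw).fst

theorem size_polyNorm_reduce_le {d : ℕ} (f : LinPoly d) (x : Col d × LinPoly d) :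
    Nat.size (polyNorm (f - (entry x.1 f / entry x.1 x.2) • x.2)) ≤
      Nat.size (polyNorm f) + (encodeRow x).size := by
  have h1 := size_polyNorm_comb_le 1 (-(entry x.1 f / entry x.1 x.2)) f x.2
  rw [one_smul, neg_smul, ← sub_eq_add_neg, Int.natAbs_neg, Int.natAbs_one, Nat.size_one] at h1
  have h2 := Nat.size_le_size ((natAbs_ediv_le (entry x.1 f) (entry x.1 x.2)).trans
    (natAbs_entry_le _ _))
  have h4 := size_polyNorm_le x.2
  simp only [encodeRow, Val.size]
  omega

theorem PolyTime.reduceBy {H : ∀ c, Tableau (D c)} {f : ∀ c, LinPoly (D c)}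
    (hH : PolyTime e fun c => encodeTableau (H c)) (hf : PolyTime e fun c => encodePoly (f c)) :
    PolyTime e fun c => encodePoly (DivSys.reduceBy (H c) (f c)) := by
  refine PolyTime.foldl (e := e) (S := fun c => LinPoly (D c))
    (A := fun c => Col (D c) × LinPoly (D c)) (s := f) (l := H) (fun _ s => encodePoly s)
    (fun _ x => encodeRow x) (fun _ f x => f - (DivSys.entry x.1 f / DivSys.entry x.1 x.2) • x.2)
    hf hH ?_ ?_
  · have hid := PolyTime.id fun p : Σ c, LinPoly (D c) × (Col (D c) × LinPoly (D c)) =>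
      Val.pair (e p.1) (.pair (encodePoly p.2.1) (.pair (encodeCol p.2.2.1) (encodePoly p.2.2.2)))
    have hw := hid.snd.fst
    have hi := hid.snd.snd.fst
    have hr := hid.snd.snd.snd
    exact (PolyTime.comb (D := fun p : Σ c, LinPoly (D c) × (Col (D c) × LinPoly (D c)) => D p.1)
      (.const _ 1) (.neg (.div (.entry hi hw) (.entry hi hr))) hw hr).congr fun p => by
        rw [one_smul, neg_smul, ← sub_eq_add_neg]
  · have hs := hf.size.add hH.size
    obtain ⟨k, hk⟩ := ((PolyBounded.const e 5).add hs).add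
      (hf.size.mul ((PolyBounded.const e 3).add hs))
    refine ⟨k, fun c l' hl' => le_trans ?_ (hk c)⟩
    have h1 := mapAcc_measure_le (O := Unit) encodeRow (fun s : LinPoly (D c) => Nat.size (polyNorm s))
      (f := fun f x => (f - (DivSys.entry x.1 f / DivSys.entry x.1 x.2) • x.2, ()))
      size_polyNorm_reduce_le (f c) hl'
    rw [mapAcc_foldl] at h1
    have h3 := size_polyNorm_le (f c)
    have h4 := dim_le_size_encodePoly (f c)
    refine (size_encodePoly_le (s := (encodePoly (f c)).size + (encodeTableau (H c)).size)
      ?_).trans ?_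
    · exact h1.trans (by simp only [encodeTableau]; omega)
    · exact Nat.add_le_add le_rfl (Nat.mul_le_mul_right _ h4)

/-- Reduction of the rows, run from the last row to the first: the state consists of the unreduced
later rows. -/
theorem mapAcc_reduceRows {d : ℕ} (l T : Tableau d) :
    (mapAcc (fun T (x : Col d × LinPoly d) => (x :: T, (x.1, reduceBy T x.2))) T l).1 =
        l.reverse ++ T ∧
      reduceRows (l.reverse ++ T) =
        (mapAcc (fun T (x : Col d × LinPoly d) => (x :: T, (x.1, reduceBy T x.2))) T l).2.reverse ++
          reduceRows T := by
  induction l generalizing T with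
  | nil => simp [mapAcc]
  | cons x l ih =>
    obtain ⟨h1, h2⟩ := ih (x :: T)
    simp only [mapAcc, List.reverse_cons, List.append_assoc, List.singleton_append]
    exact ⟨h1, by rw [h2]; rfl⟩

theorem PolyTime.reduceRows {H : ∀ c, Tableau (D c)}
    (hH : PolyTime e fun c => encodeTableau (H c).reverse) :
    PolyTime e fun c => encodeTableau (DivSys.reduceRows (H c)) := by
  have h := PolyTime.mapAcc_reverse (e := e) (S := fun c => Tableau (D c))
    (A := fun c => Col (D c) × LinPoly (D c)) (O := fun c => Col (D c) × LinPoly (D c))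
    (s := fun c => []) (l := fun c => (H c).reverse) (fun _ T => encodeTableau T)
    (fun _ x => encodeRow x) (fun _ x => encodeRow x)
    (fun c T x => (x :: T, (x.1, DivSys.reduceBy T x.2))) (.const e 0) hH ?_ ?_
  · refine h.snd.congr fun c => ?_
    have h2 := (mapAcc_reduceRows (H c).reverse []).2
    rw [List.reverse_reverse, List.append_nil] at h2
    rw [h2]
    simp [encodeTableau, DivSys.reduceRows]
  · have hid := PolyTime.id fun p : Σ c, Tableau (D c) × (Col (D c) × LinPoly (D c)) =>
      Val.pair (e p.1) (.pair (encodeTableau p.2.1)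
        (.pair (encodeCol p.2.2.1) (encodePoly p.2.2.2)))
    exact (hid.snd.snd.pair hid.snd.fst).pair (hid.snd.snd.fst.pair
      (PolyTime.reduceBy (D := fun p : Σ c, Tableau (D c) × (Col (D c) × LinPoly (D c)) => D p.1)
        hid.snd.fst hid.snd.snd.snd))
  · have hr : PolyTime e fun c => encodeTableau (H c) :=
      (PolyTime.reverse hH).congr fun c => by simp [encodeTableau]
    obtain ⟨k, hk⟩ := hr.size
    refine ⟨k, fun c l' hl' => le_trans ?_ (hk c)⟩
    rw [(mapAcc_reduceRows l' []).1, List.append_nil]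
    obtain ⟨t, ht⟩ := hl'
    have : H c = t.reverse ++ l'.reverse := by
      rw [← List.reverse_append, ht, List.reverse_reverse]
    beta_reduce
    rw [this]
    have := size_encodeList_drop_le ((t.reverse ++ l'.reverse).map encodeRow) t.reverse.length
    rwa [← List.map_drop, List.drop_left] at this

/-- The encoding of a constraint as a pair of polynomials. -/
def encodeConstraint {d : ℕ} (c : DivConstraint d) : Val :=
  .pair (encodePoly c.lhs) (encodePoly c.rhs)

/-- The encoding of an optional polynomial: an integer leaf stands for `none`. -/
def encodeOption {d : ℕ} : Option (LinPoly d) → Val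
  | none => .int 0
  | some w => encodePoly w

theorem findNew_eq {d : ℕ} (Φ : DivSystem d) (H : Tableau d) : findNew Φ H = none ∨
    ∃ c ∈ Φ, findNew Φ H = some (orderMod H c.lhs • c.rhs) := by
  induction Φ using List.reverseRecOn with
  | nil => simp [findNew]
  | append_singleton Φ c ih =>
    have e : findNew (Φ ++ [c]) H = if orderMod H (orderMod H c.lhs • c.rhs) = 1 then findNew Φ H
        else some (orderMod H c.lhs • c.rhs) := by
      simp [findNew]
    rw [e]
    split_ifs
    · exact ih.imp_right fun ⟨c', hc', h⟩ => ⟨c', List.mem_append_left _ hc', h⟩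
    · exact .inr ⟨c, by simp, rfl⟩

theorem PolyTime.findNew {Φ : ∀ c, DivSystem (D c)} {H : ∀ c, Tableau (D c)}
    (hΦ : PolyTime e fun c => encodeSystem (Φ c)) (hH : PolyTime e fun c => encodeTableau (H c)) :
    PolyTime e fun c => encodeOption (DivSys.findNew (Φ c) (H c)) := by
  have hx : PolyTime (fun p : Σ c, Option (LinPoly (D c)) × DivConstraint (D c) =>
      .pair (e p.1) (.pair (encodeOption p.2.1) (encodeConstraint p.2.2)))
      fun p => .pair (encodePoly (DivSys.orderMod (H p.1) p.2.2.lhs • p.2.2.rhs))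
        (.pair (.int (DivSys.orderMod (H p.1) (DivSys.orderMod (H p.1) p.2.2.lhs • p.2.2.rhs)))
          (encodeOption p.2.1)) := by
    have hid := PolyTime.id fun p : Σ c, Option (LinPoly (D c)) × DivConstraint (D c) =>
      Val.pair (e p.1) (.pair (encodeOption p.2.1)
        (.pair (encodePoly p.2.2.lhs) (encodePoly p.2.2.rhs)))
    have hH' := hH.weaken (fun p : Σ c, Option (LinPoly (D c)) × DivConstraint (D c) => p.1)
      fun p => .pair (encodeOption p.2.1) (encodeConstraint p.2.2)
    have h1 := PolyTime.orderMod
      (D := fun p : Σ c, Option (LinPoly (D c)) × DivConstraint (D c) => D p.1) hH' hid.snd.snd.fst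
    have h2 := PolyTime.smul
      (D := fun p : Σ c, Option (LinPoly (D c)) × DivConstraint (D c) => D p.1) h1 hid.snd.snd.snd
    exact h2.pair ((PolyTime.orderMod
      (D := fun p : Σ c, Option (LinPoly (D c)) × DivConstraint (D c) => D p.1) hH' h2).pair
      hid.snd.fst)
  refine PolyTime.foldl (e := e) (S := fun c => Option (LinPoly (D c)))
    (A := fun c => DivConstraint (D c)) (s := fun _ => none) (l := Φ) (fun _ s => encodeOption s)
    (fun _ x => encodeConstraint x)
    (fun c s x => if DivSys.orderMod (H c) (DivSys.orderMod (H c) x.lhs • x.rhs) = 1 then s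
      else some (DivSys.orderMod (H c) x.lhs • x.rhs)) (.const e 0) hΦ ?_ ?_
  · refine (PolyTime.ite (.eq hx.snd.fst (.const _ 1)) hx.snd.snd hx.fst).congr fun p => ?_
    split_ifs <;> rfl
  · obtain ⟨k, hk⟩ := hx.size
    obtain ⟨l, hl⟩ := ((PolyBounded.const e 2).add
      ((((PolyBounded.const e 4).add (.self e)).add hΦ.size).pow k))
    refine ⟨l, fun c l' hl' => le_trans ?_ (hl c)⟩
    have : (encodeOption (DivSys.findNew l' (H c))).size ≤
        2 + (4 + (e c).size + (encodeSystem (Φ c)).size) ^ k := by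
      rcases findNew_eq l' (H c) with h | ⟨x, hxl, h⟩
      · rw [h]
        exact Nat.le_add_right 2 _
      · rw [h]
        have h1 := hk ⟨c, none, x⟩
        have h2 : (encodeConstraint x).size ≤ (encodeSystem (Φ c)).size :=
          size_le_size_encodeList (List.mem_map.2 ⟨x, hl'.subset hxl, rfl⟩)
        simp only [encodeOption, Val.size, Int.natAbs_zero, Nat.size_zero] at h1 ⊢
        have h3 := Nat.pow_le_pow_left (m := 4 + (e c).size + (encodeSystem (Φ c)).size)
          (n := 1 + (e c).size + (1 + (2 + 0) + (encodeConstraint x).size)) (by omega) k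
        omega
    exact this

theorem encodePoly_ne_int {d : ℕ} (f : LinPoly d) (z : ℤ) : encodePoly f ≠ .int z :=
  nofun

theorem PolyTimeTest.findNew {Φ : ∀ c, DivSystem (D c)} {H : ∀ c, Tableau (D c)}
    (hΦ : PolyTime e fun c => encodeSystem (Φ c)) (hH : PolyTime e fun c => encodeTableau (H c)) :
    PolyTimeTest e fun c => DivSys.findNew (Φ c) (H c) ≠ none := by
  obtain ⟨t, h1, h2⟩ := (PolyTimeTest.isInt (PolyTime.findNew hΦ hH)).not
  refine ⟨t, fun c => (h1 c).trans ?_, h2⟩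
  beta_reduce
  generalize DivSys.findNew (Φ c) (H c) = o
  cases o with
  | none => simp [encodeOption]
  | some w => simp [encodeOption, encodePoly_ne_int]

theorem PolyTime.reduceInsert {H : ∀ c, Tableau (D c)} {w : ∀ c, LinPoly (D c)}
    (hH : PolyTime e fun c => encodeTableau (H c)) (hw : PolyTime e fun c => encodePoly (w c)) :
    PolyTime e fun c => encodeTableau (DivSys.reduceRows (insertRow (H c) (w c))) :=
  PolyTime.reduceRows (PolyTime.insert hH hw).snd

theorem PolyTime.closeStep {Φ : ∀ c, DivSystem (D c)} {H : ∀ c, Tableau (D c)}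
    (hΦ : PolyTime e fun c => encodeSystem (Φ c)) (hH : PolyTime e fun c => encodeTableau (H c)) :
    PolyTime e fun c => encodeTableau (closeStep (Φ c) (H c)) := by
  classical
  have h1 : PolyTime (fun c : {c // DivSys.findNew (Φ c) (H c) ≠ none} => e c)
      fun c => encodePoly ((DivSys.findNew (Φ c) (H c)).getD 0) := by
    refine ((PolyTime.findNew hΦ hH).reindex Subtype.val).congr fun c => ?_
    obtain ⟨w, hw⟩ := Option.ne_none_iff_exists'.1 c.2
    rw [hw]
    rfl
  refine (PolyTime.ite' (PolyTimeTest.findNew hΦ hH)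
    (f := fun c => encodeTableau (DivSys.reduceRows
      (insertRow (H c) ((DivSys.findNew (Φ c) (H c)).getD 0))))
    (g := fun c => encodeTableau (H c)) (PolyTime.reduceInsert (hH.reindex Subtype.val) h1)
    (hH.reindex Subtype.val)).congr fun c => ?_
  simp only [DivSys.closeStep]
  generalize DivSys.findNew (Φ c) (H c) = o
  cases o <;> simp

end Programs

/-! ### Programs for closures and for the resulting system -/

theorem size_pow_le (b k : ℕ) : Nat.size (b ^ k) ≤ 1 + k * Nat.size b := by
  induction k with
  | zero => simp
  | succ k ih =>
    have := size_mul_le (b ^ k) b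
    rw [pow_succ, Nat.succ_mul]
    omega

theorem size_sysNorm_le {d : ℕ} (Φ : DivSystem d) :
    Nat.size (sysNorm Φ) ≤ (encodeSystem Φ).size := by
  rw [Nat.size_le, ← Nat.le_sub_one_iff_lt (by positivity)]
  refine sysNorm_le fun c hc => ?_
  have h : (encodeConstraint c).size ≤ (encodeSystem Φ).size :=
    size_le_size_encodeList (List.mem_map.2 ⟨c, hc, rfl⟩)
  have h1 := size_polyNorm_le c.lhs
  have h2 := size_polyNorm_le c.rhs
  simp only [encodeConstraint, Val.size] at h
  rw [Nat.le_sub_one_iff_lt (by positivity), Nat.le_sub_one_iff_lt (by positivity),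
    ← Nat.size_le, ← Nat.size_le]
  omega

theorem dim_le_size_encodeOrder {d : ℕ} (ord : Equiv.Perm (Fin d)) : d ≤ (encodeOrder ord).size :=
  le_of_eq_of_le (by simp) (length_le_size_encodeList (List.ofFn fun j => .int ((ord j : ℕ) : ℤ)))

theorem length_le_size_encodeSystem {d : ℕ} (Φ : DivSystem d) :
    Φ.length ≤ (encodeSystem Φ).size :=
  le_of_eq_of_le (by simp) (length_le_size_encodeList (Φ.map encodeConstraint))

theorem size_encodeCol_le {d : ℕ} (i : Col d) : (encodeCol i).size ≤ 3 + d := by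
  cases i with
  | none => simp [encodeCol, Val.size]
  | some i =>
    have h : Nat.size (i : ℕ) ≤ d := Nat.size_le.2 (i.2.trans Nat.lt_two_pow_self)
    simp only [encodeCol, Val.size, Int.natAbs_natCast]
    omega

section Programs

variable {γ : Type} {e : γ → Val} {D : γ → ℕ} {Φ : ∀ c, DivSystem (D c)}
  {ord : ∀ c, Equiv.Perm (Fin (D c))} {f : ∀ c, LinPoly (D c)}

theorem polyBounded_dim (hord : PolyTime e fun c => encodeOrder (ord c)) : PolyBounded e D :=
  hord.size.mono fun c => dim_le_size_encodeOrder (ord c)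

/-- The bit length of the numbers in the closure loop is polynomially bounded. -/
theorem polyBounded_size_rowBound (hΦ : PolyTime e fun c => encodeSystem (Φ c))
    (hord : PolyTime e fun c => encodeOrder (ord c)) :
    PolyBounded e fun c => Nat.size (rowBound (Φ c)) := by
  have hd := polyBounded_dim hord
  have hm : PolyBounded e fun c => (Φ c).length :=
    hΦ.size.mono fun c => length_le_size_encodeSystem (Φ c)
  have hm1 := hm.add (.const e 1)
  have hs : PolyBounded e fun c => Nat.size (sizeBase (Φ c)) := by
    refine (((hΦ.size.const_mul 2).add (.const e 4))).mono fun c => ?_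
    have h1 := size_add_le ((Φ c).length + sysNorm (Φ c)) 2
    have h2 := size_add_le (Φ c).length (sysNorm (Φ c))
    have h3 : Nat.size (Φ c).length ≤ (Φ c).length := Nat.size_le.2 Nat.lt_two_pow_self
    have h4 := length_le_size_encodeSystem (Φ c)
    have h5 := size_sysNorm_le (Φ c)
    have h6 : Nat.size 2 ≤ 2 := Nat.size_le.2 (by norm_num)
    simp only [sizeBase]
    omega
  exact ((PolyBounded.const e 1).add ((((((hd.add (.const e 1)).const_mul 2).mul hm).add
    (.const e 2)).mul (((PolyBounded.const e 1).add hm1).add (hm1.pow 2))).mul hs)).mono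
      fun c => size_pow_le _ _

theorem PolyTime.zeroTableau (hord : PolyTime e fun c => encodeOrder (ord c))
    (hf : PolyTime e fun c => encodePoly (f c)) :
    PolyTime e fun c => encodeTableau ((columns (ord c)).map fun i => (i, 0)) := by
  have h0 : PolyTime e fun c => encodePoly (0 : LinPoly (D c)) :=
    (PolyTime.smul (.const e 0) hf).congr fun c => by rw [zero_smul]
  have hl : PolyTime e fun c => encodeList ((List.ofFn (ord c)).map fun i : Fin (D c) => .int ((i : ℕ) : ℤ)) :=
    hord.congr fun c => by
      rw [List.map_ofFn]
      rfl
  have hid := PolyTime.id fun p : Σ c, Fin (D c) => Val.pair (e p.1) (.int ((p.2 : ℕ) : ℤ))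
  have hr := PolyTime.map (e := e) (A := fun c => Fin (D c)) (O := fun c => Col (D c) × LinPoly (D c))
    (fun _ i => .int ((i : ℕ) : ℤ)) (fun _ x => encodeRow x) (fun _ i => (some i, 0)) hl
    (hid.snd.pair (h0.weaken (fun p : Σ c, Fin (D c) => p.1) _))
  refine (PolyTime.reverse (l := fun c => encodeRow (none, 0) ::
    ((List.ofFn (ord c)).map fun i => (some i, 0)).map encodeRow)
    (((PolyTime.const e (-1)).pair h0).pair hr)).congr fun c => ?_
  simp [encodeTableau, columns, Function.comp_def]

theorem size_encodeTableau_le {d : ℕ} {H : Tableau d} {s : ℕ}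
    (h : ∀ x ∈ H, Nat.size (polyNorm x.2) ≤ s) :
    (encodeTableau H).size ≤ 2 + H.length * (10 + d + s + d * (3 + s)) := by
  have h := size_encodeList_le (l := H.map encodeRow) (B := 9 + d + s + d * (3 + s)) fun v hv => ?_
  · rw [List.length_map] at h
    refine h.trans (Nat.add_le_add_left (Nat.mul_le_mul_left _ ?_) _)
    omega
  · obtain ⟨x, hx, rfl⟩ := List.mem_map.1 hv
    have h1 := size_encodePoly_le (h x hx)
    have h2 := size_encodeCol_le x.1
    simp only [encodeRow, Val.size]
    omega

/-- The closure loop computes a reduced echelon basis of the divisibility module in polynomial time. -/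
theorem PolyTime.exists_closure (hΦ : PolyTime e fun c => encodeSystem (Φ c))
    (hord : PolyTime e fun c => encodeOrder (ord c)) (hf : PolyTime e fun c => encodePoly (f c))
    (hn : ∀ c, polyNorm (f c) ≤ sysNorm (Φ c)) :
    ∃ H : ∀ c, Tableau (D c), (∀ c, CloseInv (Φ c) (ord c) (f c) (H c) ∧
        rowSpan (H c) = divModule (Φ c) (f c)) ∧
      PolyTime e fun c => encodeTableau (H c) := by
  have hlen : ∀ c H, CloseInv (Φ c) (ord c) (f c) H → H.length = D c + 1 := fun c H h => by
    rw [← length_columns (ord c), ← h.1, List.length_map]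
  have hinit := PolyTime.reduceInsert (PolyTime.zeroTableau hord hf) hf
  have hB := polyBounded_size_rowBound hΦ hord
  have hd := polyBounded_dim hord
  have hw := hΦ.weaken (fun p : Σ c, {H : Tableau (D c) // CloseInv (Φ c) (ord c) (f c) H} => p.1)
    fun p => encodeTableau p.2.1
  have hid := (PolyTime.id fun p : Σ c, {H : Tableau (D c) // CloseInv (Φ c) (ord c) (f c) H} =>
    Val.pair (e p.1) (encodeTableau p.2.1)).snd
  refine (PolyTime.exists_while (fun _ H => encodeTableau H)
    (fun c H => CloseInv (Φ c) (ord c) (f c) H) (fun c H => DivSys.findNew (Φ c) H ≠ none)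
    (fun c H => DivSys.closeStep (Φ c) H)
    (fun c H => potential (Nat.log 2 (rowBound (Φ c))) H) _ hinit
    (fun c => closeInv_init (Φ c) (ord c) (f c))
    (fun c H h hne => ⟨(h.step (hn c) hne).1, h.potential_lt (hn c) hne⟩) ?_ ?_
    (PolyTimeTest.findNew
      (D := fun p : Σ c, {H : Tableau (D c) // CloseInv (Φ c) (ord c) (f c) H} => D p.1) hw hid)
    (PolyTime.closeStep
      (D := fun p : Σ c, {H : Tableau (D c) // CloseInv (Φ c) (ord c) (f c) H} => D p.1) hw hid)).imp
    fun H h => ⟨fun c => ⟨(h.1 c).1, (h.1 c).1.rowSpan_eq (not_not.1 (h.1 c).2)⟩, h.2⟩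
  · refine ((hd.add (.const e 1)).mul (hB.add (.const e 1))).mono fun c => ?_
    have hi := closeInv_init (Φ c) (ord c) (f c)
    refine (potential_le _ _ fun x hx => Nat.log_mono_right
      ((natAbs_entry_le _ _).trans (hi.polyNorm_le (hn c) hx))).trans ?_
    rw [hlen c _ hi]
    refine Nat.mul_le_mul_left _ (Nat.add_le_add_right ?_ 1)
    rcases Nat.eq_zero_or_pos (rowBound (Φ c)) with h | h
    · simp [h]
    · exact ((Nat.pow_lt_pow_iff_right Nat.one_lt_two).1
        ((Nat.pow_log_le_self 2 h.ne').trans_lt (Nat.lt_size_self _))).le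
  · obtain ⟨k, hk⟩ := (PolyBounded.const e 2).add ((hd.add (.const e 1)).mul
      ((((PolyBounded.const e 10).add hd).add hB).add
        (hd.mul ((PolyBounded.const e 3).add hB))))
    refine ⟨k, fun c H h => le_trans ?_ (hk c)⟩
    beta_reduce
    rw [← hlen c H h]
    exact size_encodeTableau_le fun x hx => Nat.size_le_size (h.polyNorm_le (hn c) hx)

theorem size_pushRows_le {d : ℕ} {f : LinPoly d} (hf : f ≠ 0) (out : DivSystem d) (H : Tableau d) :
    (encodeSystem (pushRows hf out H)).size ≤ (encodeSystem out).size +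
      H.length * (1 + (encodePoly f).size) + (H.map fun x => (encodeRow x).size).sum := by
  induction H generalizing out with
  | nil => simp [pushRows]
  | cons x H ih =>
    have e : pushRows hf out (x :: H) =
        pushRows hf (if entry x.1 x.2 = 0 then out else ⟨f, x.2, hf⟩ :: out) H := rfl
    have h : (encodeSystem (if entry x.1 x.2 = 0 then out else ⟨f, x.2, hf⟩ :: out)).size ≤
        (encodeSystem out).size + (1 + (encodePoly f).size) + (encodeRow x).size := by
      split_ifs
      · omega
      · simp only [encodeSystem, List.map_cons, encodeList, Val.size, encodeRow]
        omega
    have h1 := ih (if entry x.1 x.2 = 0 then out else ⟨f, x.2, hf⟩ :: out)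
    rw [e, List.length_cons, List.map_cons, List.sum_cons, Nat.succ_mul]
    omega

theorem PolyTime.pushRows (hf0 : ∀ c, f c ≠ 0) {out : ∀ c, DivSystem (D c)}
    {H : ∀ c, Tableau (D c)} (hf : PolyTime e fun c => encodePoly (f c))
    (hout : PolyTime e fun c => encodeSystem (out c))
    (hH : PolyTime e fun c => encodeTableau (H c)) :
    PolyTime e fun c => encodeSystem (DivSys.pushRows (hf0 c) (out c) (H c)) := by
  refine PolyTime.foldl (e := e) (S := fun c => DivSystem (D c))
    (A := fun c => Col (D c) × LinPoly (D c)) (fun _ s => encodeSystem s) (fun _ x => encodeRow x)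
    (fun c out x => if DivSys.entry x.1 x.2 = 0 then out else ⟨f c, x.2, hf0 c⟩ :: out)
    hout hH ?_ ?_
  · have hid := PolyTime.id fun p : Σ c, DivSystem (D c) × (Col (D c) × LinPoly (D c)) =>
      Val.pair (e p.1) (.pair (encodeSystem p.2.1)
        (.pair (encodeCol p.2.2.1) (encodePoly p.2.2.2)))
    have hw := hf.weaken (fun p : Σ c, DivSystem (D c) × (Col (D c) × LinPoly (D c)) => p.1)
      fun p => .pair (encodeSystem p.2.1) (.pair (encodeCol p.2.2.1) (encodePoly p.2.2.2))
    refine (PolyTime.ite (.eq (.entry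
      (D := fun p : Σ c, DivSystem (D c) × (Col (D c) × LinPoly (D c)) => D p.1)
      hid.snd.snd.fst hid.snd.snd.snd) (.const _ 0)) hid.snd.fst
      ((hw.pair hid.snd.snd.snd).pair hid.snd.fst)).congr fun p => ?_
    split_ifs <;> rfl
  · obtain ⟨k, hk⟩ := ((hout.size.add (hH.size.mul ((PolyBounded.const e 1).add hf.size))).add
      hH.size)
    refine ⟨k, fun c l' hl' => le_trans (size_pushRows_le (hf0 c) _ _) (le_trans ?_ (hk c))⟩
    refine Nat.add_le_add (Nat.add_le_add_left (Nat.mul_le_mul_right _ ?_) _)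
      (sum_size_prefix_le encodeRow hl')
    exact hl'.length_le.trans
      (le_of_eq_of_le (by simp) (length_le_size_encodeList ((H c).map encodeRow)))

theorem size_encodeSystem_le {d : ℕ} {Φ : DivSystem d} {s : ℕ}
    (h : ∀ c ∈ Φ, Nat.size (polyNorm c.lhs) ≤ s ∧ Nat.size (polyNorm c.rhs) ≤ s) :
    (encodeSystem Φ).size ≤ 2 + Φ.length * (12 + 2 * s + 2 * (d * (3 + s))) := by
  have h := size_encodeList_le (l := Φ.map encodeConstraint)
    (B := 11 + 2 * s + 2 * (d * (3 + s))) fun v hv => ?_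
  · rw [List.length_map] at h
    refine h.trans (Nat.add_le_add_left (Nat.mul_le_mul_left _ ?_) _)
    omega
  · obtain ⟨x, hx, rfl⟩ := List.mem_map.1 hv
    have h1 := size_encodePoly_le (h x hx).1
    have h2 := size_encodePoly_le (h x hx).2
    simp only [encodeConstraint, Val.size]
    omega

theorem elimSystem_subset {d : ℕ} {tab : LinPoly d → Tableau d} {Φ Φ' : DivSystem d} (h : Φ' ⊆ Φ) :
    elimSystem tab Φ' ⊆ elimSystem tab Φ := fun _ hc =>
  mem_elimSystem.2 ((mem_elimSystem.1 hc).imp (fun h' => ⟨h h'.1, h'.2⟩)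
    fun ⟨c', hc', h'⟩ => ⟨c', h hc', h'⟩)

/-- The resulting system is computed in polynomial time. -/
theorem PolyTime.exists_elimSystem (hΦ : PolyTime e fun c => encodeSystem (Φ c))
    (hord : PolyTime e fun c => encodeOrder (ord c)) :
    ∃ tab : ∀ c, LinPoly (D c) → Tableau (D c), (∀ c, IsClosure (Φ c) (ord c) (tab c)) ∧
      PolyTime e fun c => encodeSystem (elimSystem (tab c) (Φ c)) := by
  obtain ⟨T, hT, hTP⟩ := PolyTime.exists_closure
    (e := fun p : Σ c, {f : LinPoly (D c) // polyNorm f ≤ sysNorm (Φ c)} =>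
      .pair (e p.1) (encodePoly p.2.1))
    (D := fun p => D p.1) (Φ := fun p => Φ p.1) (ord := fun p => ord p.1) (f := fun p => p.2.1)
    (hΦ.weaken Sigma.fst _) (hord.weaken Sigma.fst _)
    (PolyTime.id fun p : Σ c, {f : LinPoly (D c) // polyNorm f ≤ sysNorm (Φ c)} =>
      Val.pair (e p.1) (encodePoly p.2.1)).snd fun p => p.2.2
  -- the closure program only has to work for small `f`; the tableau is irrelevant for other ones
  let tab : ∀ c, LinPoly (D c) → Tableau (D c) := fun c f =>
    if h : polyNorm f ≤ sysNorm (Φ c) then T ⟨c, f, h⟩ else []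
  have htab : ∀ c (x : {x // x ∈ Φ c}), tab c (DivSys.primPart x.1.lhs) =
      T ⟨c, DivSys.primPart x.1.lhs, polyNorm_primPart_le_sysNorm x.2⟩ := fun c x =>
    dif_pos (polyNorm_primPart_le_sysNorm x.2)
  have hcl : ∀ c, IsClosure (Φ c) (ord c) (tab c) := fun c x hx => by
    rw [htab c ⟨x, hx⟩]
    exact hT ⟨c, DivSys.primPart x.lhs, polyNorm_primPart_le_sysNorm hx⟩
  refine ⟨tab, hcl, ?_⟩
  have h := PolyTime.foldl (e := e) (S := fun c => DivSystem (D c)) (A := fun c => {x // x ∈ Φ c})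
    (s := fun _ => []) (l := fun c => (Φ c).attach) (fun _ s => encodeSystem s)
    (fun _ x => encodeConstraint x.1) (fun c out x => pushConstraint (tab c) out x.1)
    (.const e 0) (hΦ.congr fun c => ?_) ?_ ?_
  · refine h.congr fun c => ?_
    rw [elimSystem, List.foldl_attach]
  · rw [List.map_attach_eq_pmap, List.pmap_eq_map]
    rfl
  · have hid := PolyTime.id fun p : Σ c, DivSystem (D c) × {x // x ∈ Φ c} =>
      Val.pair (e p.1) (.pair (encodeSystem p.2.1)
        (.pair (encodePoly p.2.2.1.lhs) (encodePoly p.2.2.1.rhs)))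
    have hl := hid.snd.snd.fst
    have hq := PolyTime.primPart
      (D := fun p : Σ c, DivSystem (D c) × {x // x ∈ Φ c} => D p.1) hl
    have ht := ((hid.fst.pair hq).comp (hTP.reindex
      fun p : Σ c, DivSystem (D c) × {x // x ∈ Φ c} =>
        ⟨p.1, DivSys.primPart p.2.2.1.lhs, polyNorm_primPart_le_sysNorm p.2.2.2⟩)).congr
      fun p => congrArg encodeTableau (htab p.1 p.2.2).symm
    have hout := PolyTime.ite (.eq (PolyTime.content
      (D := fun p : Σ c, DivSystem (D c) × {x // x ∈ Φ c} => D p.1) hl) (.const _ 1)) hid.snd.fst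
      (hid.snd.snd.pair hid.snd.fst)
    refine PolyTime.pushRows (D := fun p : Σ c, DivSystem (D c) × {x // x ∈ Φ c} => D p.1)
      (fun p => primPart_ne_zero p.2.2.1.lhs_ne_zero) hq (hout.congr fun p => ?_) ht
    simp only [Nat.cast_eq_one]
    split_ifs <;> rfl
  · have hB := polyBounded_size_rowBound hΦ hord
    have hd := polyBounded_dim hord
    obtain ⟨k, hk⟩ := (PolyBounded.const e 2).add
      ((hΦ.size.mul (hd.add (.const e 2))).mul
      (((PolyBounded.const e 12).add (hB.const_mul 2)).add
        ((hd.mul ((PolyBounded.const e 3).add hB)).const_mul 2)))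
    refine ⟨k, fun c l' hl' => le_trans ?_ (hk c)⟩
    have hsub : l'.map Subtype.val ⊆ Φ c := fun x hx => by
      obtain ⟨y, -, rfl⟩ := List.mem_map.1 hx
      exact y.2
    have he : l'.foldl (fun out x => pushConstraint (tab c) out x.1) [] =
        elimSystem (tab c) (l'.map Subtype.val) := by
      rw [elimSystem, List.foldl_map]
    rw [he]
    refine (size_encodeSystem_le fun x hx => ?_).trans (Nat.add_le_add_left
      (Nat.mul_le_mul_right _ ?_) 2)
    · have h := polyNorm_le_of_mem_elimSystem (hcl c) (elimSystem_subset hsub hx)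
      exact ⟨Nat.size_le_size h.1, Nat.size_le_size h.2⟩
    · refine (length_elimSystem_le fun x hx => ?_).trans (Nat.mul_le_mul_right _ ?_)
      · rw [← length_columns (ord c), ← (hcl c x (hsub hx)).1.1, List.length_map]
      · rw [List.length_map]
        exact (hl'.length_le.trans (by simp)).trans (length_le_size_encodeSystem (Φ c))

end Programs

end DivSys

/-- One program `P` closes, in time polynomial (`q`) in the size of its input, every system `Φ`
under the elimination property for every given order; `C` is the absolute constant hidden in the
exponents `O(d)` and `O(m³ d)`, where `m = Φ.length`. -/
theorem mainTheorem8 :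
    ∃ (P : DivSys.Prog) (q : Polynomial ℕ) (C : ℕ),
      ∀ (d : ℕ) (Φ : DivSys.DivSystem d) (ord : Equiv.Perm (Fin d)),
        ∃ Ψ : DivSys.DivSystem d,
          -- on input `(Φ, ord)`, the program halts with output `Ψ` within polynomial time
          (∃ t : ℕ, DivSys.Runs P (DivSys.encodeInput Φ ord) (DivSys.encodeSystem Ψ) t ∧
            t ≤ q.eval (DivSys.encodeInput Φ ord).size) ∧
          -- the output has the elimination property
          DivSys.HasElimination ord Ψ ∧
          -- equivalence over the integers and modulo every prime
          (∀ x : Fin d → ℤ, DivSys.IsSolution Φ x ↔ DivSys.IsSolution Ψ x) ∧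
          (∀ p : ℕ, p.Prime → ∀ x : Fin d → ℤ,
            DivSys.IsSolutionMod p Φ x ↔ DivSys.IsSolutionMod p Ψ x) ∧
          -- constraints with a left-hand side that is not primitive, and those with a primitive one
          (∀ f g : DivSys.LinPoly d, ¬ DivSys.IsPrimitive f →
            (DivSys.Occurs Φ f g ↔ DivSys.Occurs Ψ f g)) ∧
          (∀ c ∈ Ψ, DivSys.IsPrimitive c.lhs →
            ∃ c' ∈ Φ, DivSys.IsPrimitivePart c.lhs c'.lhs) ∧
          -- divisibility modules, and increasing forms
          (∀ f : DivSys.LinPoly d, DivSys.IsPrimitive f →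
            DivSys.divModule Φ f = DivSys.divModule Ψ f) ∧
          (∀ ord' : Equiv.Perm (Fin d),
            DivSys.IsIncreasing ord' Φ ↔ DivSys.IsIncreasing ord' Ψ) ∧
          -- size bounds
          DivSys.sysNorm Ψ ≤ (d + 1) ^ (C * max 1 d) *
            (Φ.length + DivSys.sysNorm Φ + 2) ^ (C * max 1 (Φ.length ^ 3 * d)) ∧
          Ψ.length ≤ Φ.length * (d + 2) := by
  obtain ⟨tab, h, P, k, hP⟩ := DivSys.PolyTime.exists_elimSystem
    (e := fun c : Σ d, DivSys.DivSystem d × Equiv.Perm (Fin d) => DivSys.encodeInput c.2.1 c.2.2)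
    (D := fun c => c.1) (Φ := fun c => c.2.1) (ord := fun c => c.2.2)
    (DivSys.PolyTime.id _).fst (DivSys.PolyTime.id _).snd
  refine ⟨P, Polynomial.X ^ k, 42, fun d Φ ord => ?_⟩
  have h := h ⟨d, Φ, ord⟩
  have hM := DivSys.divModule_elimSystem h
  obtain ⟨t, hr, ht⟩ := hP ⟨d, Φ, ord⟩
  refine ⟨_, ⟨t, hr, by simpa using ht⟩, DivSys.hasElimination_elimSystem h,
    DivSys.isSolution_elimSystem_iff h, fun p hp => DivSys.isSolutionMod_elimSystem_iff h hp,
    fun f g hf => DivSys.occurs_elimSystem_of_not_isPrimitive hf,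
    fun c hc hp => DivSys.exists_isPrimitivePart_of_mem_elimSystem hc hp, fun f _ => hM f,
    fun ord' => ?_, (DivSys.sysNorm_elimSystem_le h).trans
      (Nat.le_mul_of_pos_left _ (by positivity)), DivSys.length_elimSystem_le' h⟩
  simp only [DivSys.IsIncreasing, hM]
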